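/- For $d\ge 1$ and $a\in\mathbb{R}$ let $\mu_{d,a}$ be the measure $d\mu_{d,a}(x)=\|x\|_2^{-a}\,dx$ on $\mathbb{R}^d$. For $\mu=\mu_{d,a}$ and a measurable function $f$ on $\mathbb{R}^d$ let $$M_{\mu}f(x)=\sup_{r>0}\frac{1}{\mu(B(x,r))}\int_{B(x,r)}|f|\,d\mu ,$$ where $B(x,r)$ is the closed Euclidean ball and a ball of infinite measure contributes $0$ to the supremum. A function $f:\mathbb{R}^d\to\mathbb{R}$ is radial if $f(x)$ depends only on $\|x\|_2$ for $x\neq 0$. For $1\le p<\infty$ let $c_{p,d}(a)\in[0,\infty]$ be the smallest constant $c$ such that $$t\,\mu(\{M_{\mu}f\ge t\})^{1/p}\le c\,\|f\|_{L^p(\mu)}\qquad\text{for all radial } f\in L^p(\mu)\text{ and all } t>0,$$ and let $C_{p,d}(a)\in[0,\infty]$ be the smallest constant $c$ such that $\|M_{\mu}f\|_{L^p(\mu)}\le c\,\|f\|_{L^p(\mu)}$ for all radial $f\in L^p(\mu)$. 1. Let $1/2<\alpha<1$. For every $p\in[1,\infty)$ there are $b>1$ and $c>0$, depending only on $\alpha$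 and $p$, such that $c_{p,d}(\alpha d)\ge c\,b^d$ for all $d\ge1$. 2. There is an absolute constant $c>0$ such that for every real sequence $(\alpha_d)_{d\ge1}$ with $\alpha_d\le d/2$ for all $d\ge 1$, one has $c_{1,d}(\alpha_d)\ge c\,(\sqrt5/2)^{\alpha_d}$ for all $d\ge1$. In particular, for such a sequence, if $\limsup_{d\to\infty}\alpha_d=\infty$ then $\limsup_{d\to\infty}c_{1,d}(\alpha_d)=\infty$. 3. For every $\alpha\in\mathbb{R}$ there is a constant $C=C(\alpha)<\infty$ such that for every real sequence $(\alpha_d)_{d\ge1}$ with $\sup_d\alpha_d\le\alpha$ one has $c_{1,d}(\alpha_d)\le C$ for all $d\ge1$. Moreover, for every $\alpha\in\mathbb{R}$ and every $p\in(1,\infty)$ there is $C'=C'(\alpha,p)<\infty$ such that for every such sequence $C_{p,d}(\alpha_d)\le C'$ for all $d\ge1$. -/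

import Mathlib

open MeasureTheory Filter
open scoped ENNReal NNReal

noncomputable section

/-- The measure `‖x‖₂ ^ (-a) dx` on `ℝ^d`; the density is a null-set convention at `x = 0`
when `d ≥ 1`. -/
def powerMeasure (d : ℕ) (a : ℝ) : Measure (EuclideanSpace ℝ (Fin d)) :=
  volume.withDensity (fun x => ENNReal.ofReal (‖x‖ ^ (-a)))

/-- `f` is radial: away from the origin it depends only on `‖x‖₂`. -/
def IsRadialFun {d : ℕ} (f : EuclideanSpace ℝ (Fin d) → ℝ) : Prop :=
  ∃ f₀ : ℝ → ℝ, ∀ x, x ≠ 0 → f x = f₀ ‖x‖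

/-- The centered Hardy-Littlewood maximal function of `f` with respect to `μ`, over closed
Euclidean balls of positive measure. In `ℝ≥0∞` one has `∞ / ∞ = 0`, so that balls of infinite
measure contribute `0`. -/
def centeredMaximal {d : ℕ} (μ : Measure (EuclideanSpace ℝ (Fin d)))
    (f : EuclideanSpace ℝ (Fin d) → ℝ) (x : EuclideanSpace ℝ (Fin d)) : ℝ≥0∞ :=
  ⨆ (r : ℝ) (_ : 0 < r) (_ : 0 < μ (Metric.closedBall x r)),
    (∫⁻ y in Metric.closedBall x r, ‖f y‖ₑ ∂μ) / μ (Metric.closedBall x r)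

/-- The smallest constant `c` in the weak type `(p, p)` inequality
`t * μ {M_μ f ≥ t} ^ (1 / p) ≤ c * ‖f‖_p`, for all radial `f ∈ L^p(μ)` and all `t > 0`. -/
def radialWeakConst {d : ℕ} (p : ℝ≥0) (μ : Measure (EuclideanSpace ℝ (Fin d))) : ℝ≥0∞ :=
  sInf {c : ℝ≥0∞ | ∀ f : EuclideanSpace ℝ (Fin d) → ℝ, IsRadialFun f → MemLp f p μ →
    ∀ t : ℝ≥0, 0 < t →
      (t : ℝ≥0∞) * μ {x | (t : ℝ≥0∞) ≤ centeredMaximal μ f x} ^ (1 / (p : ℝ))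
        ≤ c * eLpNorm f p μ}

/-- The smallest constant `c` in the strong type `(p, p)` inequality
`‖M_μ f‖_p ≤ c * ‖f‖_p`, for all radial `f ∈ L^p(μ)`. -/
def radialStrongConst {d : ℕ} (p : ℝ≥0) (μ : Measure (EuclideanSpace ℝ (Fin d))) : ℝ≥0∞ :=
  sInf {c : ℝ≥0∞ | ∀ f : EuclideanSpace ℝ (Fin d) → ℝ, IsRadialFun f → MemLp f p μ →
    eLpNorm (centeredMaximal μ f) p μ ≤ c * eLpNorm f p μ}

end

set_option linter.unusedSectionVars false

noncomputable section

/-! Upper bounds. In polar coordinates `powerMeasure d a` is the sphere measure times `m =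
radialMeasure d a`. Let `N` be the uncentered maximal function over intervals of `(0, ∞)` with
respect to `m`. Finite families of intervals can be thinned to overlap at most two, so `N` has weak
`(1, 1)` and strong `(p, p)` bounds with constants that do not involve `m`. It remains to dominate
`M f (x)` by a dimension-free multiple of `N (‖x‖)`. A ray meeting `closedBall x r` meets it in a
chord, and the union of the chord with the interval `L` from the tangent radius to `‖x‖` is an
interval containing `‖x‖`. So the integral of `f` along the chord is at most `N (‖x‖)` times
(measure of the chord + measure of `L`). Integrated over directions, the chords give the measure of
the ball, and the `L` terms give the measure of a truncated tangent cone. That piece lies in a ball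
of radius at most `r`, and comparing weights bounds it by a constant times the measure of the ball
as long as `a` is bounded above (`cone_mul_le`, `setLIntegral_closedBall_le`).

Lower bound for `0 ≤ a ≤ d / 2`. Take `f` the indicator of a tiny ball at the origin. For `‖x‖ ≤ 1`
the ball about `x` that just swallows it lies in a ball of radius `1 + δ` centered on the unit
sphere, whose measure is at most `4 (2 / √5) ^ a` times that of the unit ball
(`powerMeasure_closedBall_unit_le`). The quotient is the weak type constant. For `a ≤ 0` a bound by
`1` is enough.

Exponential growth for `a = α d`, `1/2 < α < 1`. Take `f = ‖y‖ ^ (-γ)` truncated, with `p γ` just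
below `(1 - α) d`. Two integrations by parts against `(S² - ‖y - x‖²)₊²` times the weight show that
the weighted mean of `‖y‖²` near `x` is at most `(1 - κ) ‖x‖²` (`integral_paraboloid_norm_sq_le`);
this is where `α > 1/2` enters. By convexity the mean of `f` exceeds `f x` by the factor `(1 - κ) ^
(-γ / 2)`, exponential in `d`. The paraboloid is a superposition of indicators of balls about `x`,
so `M f` is at least as large, while the norm of `f` grows more slowly. -/

/-! ### Covering by intervals and the one-dimensional weak type bound. -/

theorem exists_forall_subset_of_total {ι X : Type*} (s : Finset ι) (hs : s.Nonempty)
    (R : ι → Set X) (htot : ∀ i ∈ s, ∀ j ∈ s, R i ⊆ R j ∨ R j ⊆ R i) :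
    ∃ i ∈ s, ∀ j ∈ s, R j ⊆ R i := by
  obtain ⟨i, hi, hmax⟩ := s.exists_maximalFor R hs
  refine ⟨i, hi, fun j hj => ?_⟩
  rcases htot i hi j hj with h | h
  · exact hmax hj h
  · exact h

/-- A finite family of intervals has a subfamily with the same union that covers every point at
most twice. -/
theorem exists_subfamily_overlap_le_two {ι X : Type*} [LinearOrder X] [DecidableEq ι]
    (U : ι → Set X) (s : Finset ι) (hU : ∀ i ∈ s, (U i).OrdConnected) :
    ∃ t ⊆ s, (⋃ i ∈ t, U i) = (⋃ i ∈ s, U i) ∧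
      ∀ x, ∑ i ∈ t, (U i).indicator (fun _ => (1 : ℝ≥0∞)) x ≤ 2 := by
  classical
  induction s using Finset.strongInduction with
  | H s ih =>
  by_cases h : ∀ x, ∑ i ∈ s, (U i).indicator (fun _ => (1 : ℝ≥0∞)) x ≤ 2
  · exact ⟨s, subset_rfl, rfl, h⟩
  push Not at h
  obtain ⟨x, hx⟩ := h
  set F := s.filter (fun i => x ∈ U i) with hF
  have hcard : 2 < F.card := by
    have : ∑ i ∈ s, (U i).indicator (fun _ => (1 : ℝ≥0∞)) x = (F.card : ℝ≥0∞) := by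
      simp [Set.indicator_apply, hF]
    rw [this] at hx
    exact_mod_cast hx
  have hFn : F.Nonempty := Finset.card_pos.1 (by omega)
  have hFs : ∀ i ∈ F, i ∈ s ∧ x ∈ U i := fun i hi => by simpa [hF] using hi
  -- The parts to the right of `x` of the intervals through `x` form a chain, so one of them reaches
  -- farthest; likewise on the left.
  obtain ⟨i, hi, hiR⟩ := exists_forall_subset_of_total F hFn (fun i => U i ∩ Set.Ici x) (by
    intro i hi j hj
    by_contra! hcon
    obtain ⟨y, ⟨hy, hxy⟩, hyj⟩ := Set.not_subset.1 hcon.1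
    obtain ⟨z, ⟨hz, hxz⟩, hzi⟩ := Set.not_subset.1 hcon.2
    rcases le_total y z with h | h
    · exact hyj ⟨(hU j (hFs j hj).1).out (hFs j hj).2 hz ⟨hxy, h⟩, hxy⟩
    · exact hzi ⟨(hU i (hFs i hi).1).out (hFs i hi).2 hy ⟨hxz, h⟩, hxz⟩)
  obtain ⟨j, hj, hjL⟩ := exists_forall_subset_of_total F hFn (fun i => U i ∩ Set.Iic x) (by
    intro i hi j hj
    by_contra! hcon
    obtain ⟨y, ⟨hy, hxy⟩, hyj⟩ := Set.not_subset.1 hcon.1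
    obtain ⟨z, ⟨hz, hxz⟩, hzi⟩ := Set.not_subset.1 hcon.2
    rcases le_total y z with h | h
    · exact hzi ⟨(hU i (hFs i hi).1).out hy (hFs i hi).2 ⟨h, hxz⟩, hxz⟩
    · exact hyj ⟨(hU j (hFs j hj).1).out hz (hFs j hj).2 ⟨h, hxy⟩, hxy⟩)
  -- A third interval through `x` is covered by the two extreme ones, so it can be discarded without
  -- changing the union.
  obtain ⟨k, hk, hkij⟩ : ∃ k ∈ F, k ∉ ({i, j} : Finset ι) := by
    by_contra! hcon
    have := Finset.card_le_card (show F ⊆ {i, j} from hcon)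
    have := Finset.card_le_two (a := i) (b := j)
    omega
  simp only [Finset.mem_insert, Finset.mem_singleton, not_or] at hkij
  obtain ⟨t, ht, htU, hto⟩ := ih (s.erase k) (Finset.erase_ssubset (hFs k hk).1)
    (fun i hi => hU i (Finset.mem_of_mem_erase hi))
  refine ⟨t, ht.trans (Finset.erase_subset _ _), htU.trans ?_, hto⟩
  apply Set.Subset.antisymm
  · exact Set.biUnion_subset_biUnion_left (fun a ha => Finset.mem_of_mem_erase ha)
  · refine Set.iUnion₂_subset fun l hl y hy => ?_
    by_cases hlk : l = k
    · subst hlk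
      rcases le_total x y with h | h
      · exact Set.mem_biUnion (Finset.mem_erase.2 ⟨Ne.symm hkij.1, (hFs i hi).1⟩)
          (hiR l hk ⟨hy, h⟩).1
      · exact Set.mem_biUnion (Finset.mem_erase.2 ⟨Ne.symm hkij.2, (hFs j hj).1⟩)
          (hjL l hk ⟨hy, h⟩).1
    · exact Set.mem_biUnion (Finset.mem_erase.2 ⟨hlk, hl⟩) hy

section Line

variable {X : Type*} [LinearOrder X] [TopologicalSpace X] [OrderTopology X]
  [SecondCountableTopology X] [MeasurableSpace X] [BorelSpace X]

/-- Overlap at most two replaces disjointness, so no doubling property of `m` is needed and the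
constant is universal. -/
theorem mul_measure_biUnion_finset_le {ι : Type*} (m ν : Measure X) (t : ℝ≥0∞) (s : Finset ι)
    (U : ι → Set X) (hO : ∀ i ∈ s, IsOpen (U i)) (hU : ∀ i ∈ s, (U i).OrdConnected)
    (h : ∀ i ∈ s, t * m (U i) ≤ ν (U i)) :
    t * m (⋃ i ∈ s, U i) ≤ 2 * ν Set.univ := by
  classical
  obtain ⟨r, hr, hrU, hov⟩ := exists_subfamily_overlap_le_two U s hU
  rw [← hrU]
  calc t * m (⋃ i ∈ r, U i) ≤ t * ∑ i ∈ r, m (U i) := by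
        gcongr; exact measure_biUnion_finset_le r U
    _ = ∑ i ∈ r, t * m (U i) := Finset.mul_sum ..
    _ ≤ ∑ i ∈ r, ν (U i) := Finset.sum_le_sum fun i hi => h i (hr hi)
    _ = ∑ i ∈ r, ∫⁻ x, (U i).indicator (fun _ => (1 : ℝ≥0∞)) x ∂ν := by
        refine Finset.sum_congr rfl fun i hi => ?_
        rw [lintegral_indicator (hO i (hr hi)).measurableSet]; simp
    _ = ∫⁻ x, ∑ i ∈ r, (U i).indicator (fun _ => (1 : ℝ≥0∞)) x ∂ν := by
        rw [lintegral_finsetSum']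
        exact fun i hi => (measurable_const.indicator (hO i (hr hi)).measurableSet).aemeasurable
    _ ≤ ∫⁻ _, 2 ∂ν := lintegral_mono hov
    _ = 2 * ν Set.univ := by simp

/-- The Lindelöf property reduces to a countable family, and continuity from below to finite ones.
-/
theorem mul_measure_sUnion_le (m ν : Measure X) (t : ℝ≥0∞) (S : Set (Set X))
    (hO : ∀ U ∈ S, IsOpen U) (hU : ∀ U ∈ S, U.OrdConnected) (h : ∀ U ∈ S, t * m U ≤ ν U) :
    t * m (⋃₀ S) ≤ 2 * ν Set.univ := by
  classical
  obtain ⟨T, hTc, hTS, hT⟩ := TopologicalSpace.isOpen_sUnion_countable S hO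
  rw [← hT]
  rcases T.eq_empty_or_nonempty with rfl | hne
  · simp
  obtain ⟨f, rfl⟩ := hTc.exists_eq_range hne
  have hf : ∀ n, f n ∈ S := fun n => hTS ⟨n, rfl⟩
  rw [Set.sUnion_range, measure_iUnion_eq_iSup_accumulate, ENNReal.mul_iSup]
  refine iSup_le fun n => ?_
  have : Set.accumulate f n = ⋃ i ∈ Finset.range (n + 1), f i := by
    ext x; simp [Set.mem_accumulate]
  rw [this]
  exact mul_measure_biUnion_finset_le m ν t _ f (fun i _ => hO _ (hf i)) (fun i _ => hU _ (hf i))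
    fun i _ => h _ (hf i)

/-- The uncentered maximal function on a line, over open intervals of finite measure. -/
def intervalMaximal (m ν : Measure X) (x : X) : ℝ≥0∞ :=
  ⨆ (U : Set X) (_ : IsOpen U ∧ U.OrdConnected ∧ x ∈ U ∧ m U ≠ ∞), ν U / m U

theorem setOf_lt_intervalMaximal (m ν : Measure X) (t : ℝ≥0∞) :
    {x | t < intervalMaximal m ν x} =
      ⋃₀ {U | IsOpen U ∧ U.OrdConnected ∧ m U ≠ ∞ ∧ t < ν U / m U} := by
  ext x
  simp only [intervalMaximal, lt_iSup_iff, Set.mem_ofPred_eq, Set.mem_sUnion]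
  constructor
  · rintro ⟨U, ⟨h1, h2, h3, h4⟩, h5⟩
    exact ⟨U, ⟨h1, h2, h4, h5⟩, h3⟩
  · rintro ⟨U, ⟨h1, h2, h4, h5⟩, h3⟩
    exact ⟨U, ⟨h1, h2, h3, h4⟩, h5⟩

theorem measurable_intervalMaximal (m ν : Measure X) : Measurable (intervalMaximal m ν) := by
  refine measurable_of_Ioi fun t => ?_
  have : intervalMaximal m ν ⁻¹' Set.Ioi t = {x | t < intervalMaximal m ν x} := rfl
  rw [this, setOf_lt_intervalMaximal]
  exact (isOpen_sUnion fun U hU => hU.1).measurableSet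

theorem mul_measure_lt_intervalMaximal_le (m ν : Measure X) (t : ℝ≥0∞) :
    t * m {x | t < intervalMaximal m ν x} ≤ 2 * ν Set.univ := by
  rw [setOf_lt_intervalMaximal]
  refine mul_measure_sUnion_le m ν t _ (fun U hU => hU.1) (fun U hU => hU.2.1) fun U hU => ?_
  exact ENNReal.mul_le_of_le_div hU.2.2.2.le

/-- On an interval where the mean of `g` exceeds `2 t`, the values `g ≤ t` account for at most `t *
m U`; the finiteness of `m U` allows this to be cancelled. Localizing the right side to `{t < g}` is
what the strong type bound requires. -/
theorem mul_measure_two_mul_lt_intervalMaximal_le (m : Measure X) (g : X → ℝ≥0∞)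
    (hg : Measurable g) (t : ℝ≥0) :
    t * m {x | 2 * (t : ℝ≥0∞) < intervalMaximal m (m.withDensity g) x} ≤
      2 * ∫⁻ x in {x | t < g x}, g x ∂m := by
  have hms : MeasurableSet {x | (t : ℝ≥0∞) < g x} := measurableSet_lt measurable_const hg
  rw [setOf_lt_intervalMaximal]
  have := mul_measure_sUnion_le m ((m.restrict {x | t < g x}).withDensity g) t
    {U | IsOpen U ∧ U.OrdConnected ∧ m U ≠ ∞ ∧ 2 * (t : ℝ≥0∞) < m.withDensity g U / m U}
    (fun U hU => hU.1) (fun U hU => hU.2.1) ?_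
  · simpa using this
  rintro U ⟨hO, -, hfin, hlt⟩
  have hUm := hO.measurableSet
  have h1 : 2 * (t : ℝ≥0∞) * m U ≤ m.withDensity g U := ENNReal.mul_le_of_le_div hlt.le
  rw [withDensity_apply _ hUm, Measure.restrict_restrict hUm]
  rw [withDensity_apply _ hUm, ← lintegral_inter_add_sdiff _ _ hms] at h1
  have h2 : ∫⁻ x in U \ {x | t < g x}, g x ∂m ≤ t * m U := by
    calc ∫⁻ x in U \ {x | t < g x}, g x ∂m ≤ ∫⁻ x in U \ {x | t < g x}, t ∂m := by
          refine setLIntegral_mono' (hUm.diff hms) fun x hx => ?_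
          simpa using hx.2
      _ = t * m (U \ {x | t < g x}) := by simp
      _ ≤ t * m U := by gcongr; exact Set.sdiff_subset
  have h3 : t * m U + t * m U ≤ (∫⁻ x in U ∩ {x | t < g x}, g x ∂m) + t * m U :=
    calc _ = 2 * (t : ℝ≥0∞) * m U := by ring
      _ ≤ _ := h1.trans (by gcongr)
  exact (ENNReal.add_le_add_iff_right (ENNReal.mul_ne_top ENNReal.coe_ne_top hfin)).1 h3

/-- `intervalMaximal` only sees open intervals. Outer regularity puts `J` inside an open set of
nearly the same measure, and the order-connected component of `x` in it is an open interval that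
still contains `J`. -/
theorem setLIntegral_le_intervalMaximal_mul (m : Measure X) [m.OuterRegular] (g : X → ℝ≥0∞)
    {J : Set X} (hJ : J.OrdConnected) {x : X} (hx : x ∈ J) (hfin : m J ≠ ∞) :
    ∫⁻ y in J, g y ∂m ≤ intervalMaximal m (m.withDensity g) x * m J := by
  have key : ∀ c, m J < c → ∫⁻ y in J, g y ∂m ≤ intervalMaximal m (m.withDensity g) x * c := by
    intro c hc
    obtain ⟨U, hJU, hUo, hUc⟩ := Set.exists_isOpen_lt_of_lt J c hc
    set V := U.ordConnectedComponent x with hV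
    have hxU := hJU hx
    have hVo : IsOpen V := by
      rw [isOpen_iff_mem_nhds]
      intro y hy
      rw [hV, Set.ordConnectedComponent_eq hy, Set.ordConnectedComponent_mem_nhds]
      exact hUo.mem_nhds (Set.ordConnectedComponent_subset hy)
    have hJV : J ⊆ V := Set.subset_ordConnectedComponent hx hJU
    have hVfin : m V ≠ ∞ := ((measure_mono Set.ordConnectedComponent_subset).trans_lt
      (hUc.trans_le le_top)).ne
    have hle : m.withDensity g V / m V ≤ intervalMaximal m (m.withDensity g) x :=
      le_iSup₂_of_le (f := fun U (_ : IsOpen U ∧ U.OrdConnected ∧ x ∈ U ∧ m U ≠ ∞) =>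
        m.withDensity g U / m U) V ⟨hVo, inferInstance, hJV hx, hVfin⟩ le_rfl
    calc ∫⁻ y in J, g y ∂m ≤ ∫⁻ y in V, g y ∂m := lintegral_mono_set hJV
      _ = m.withDensity g V := (withDensity_apply _ hVo.measurableSet).symm
      _ ≤ m.withDensity g V / m V * m V := by
          by_cases h0 : m V = 0
          · rw [withDensity_absolutelyContinuous m g h0]; simp
          · rw [ENNReal.div_mul_cancel h0 hVfin]
      _ ≤ intervalMaximal m (m.withDensity g) x * c := by
          gcongr
          exact (measure_mono Set.ordConnectedComponent_subset).trans hUc.le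
  set N := intervalMaximal m (m.withDensity g) x
  by_cases hN : N = ∞
  · by_cases h0 : m J = 0
    · rw [setLIntegral_measure_zero _ _ h0]; simp
    · rw [hN, ENNReal.top_mul h0]; exact le_top
  · by_cases hN0 : N = 0
    · have := key ∞ hfin.lt_top
      rw [hN0] at this ⊢
      simpa using this
    · have : ∀ c, m J < c → (∫⁻ y in J, g y ∂m) / N ≤ c := fun c hc =>
        ENNReal.div_le_of_le_mul' (key c hc)
      exact (ENNReal.div_le_iff_le_mul (.inl hN0) (.inl hN)).1 (le_of_forall_gt_imp_ge_of_dense this)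
        |>.trans_eq (mul_comm _ _)

end Line

/-! ### The one-dimensional strong type bound. -/

section Line

variable {X : Type*} [LinearOrder X] [TopologicalSpace X] [OrderTopology X]
  [SecondCountableTopology X] [MeasurableSpace X] [BorelSpace X]

/-- For `t ≥ 1` one has `g ≤ g ^ p` on `{t < g}`, so `t * m {N = ∞}` stays bounded as `t` grows. The
layer-cake formula used next is for real-valued functions, hence this check. -/
theorem intervalMaximal_ae_ne_top (m : Measure X) (g : X → ℝ≥0) (hg : Measurable g) {p : ℝ}
    (hp : 1 < p) (hfin : ∫⁻ x, (g x : ℝ≥0∞) ^ p ∂m ≠ ∞) :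
    ∀ᵐ x ∂m, intervalMaximal m (m.withDensity fun x => (g x : ℝ≥0∞)) x ≠ ∞ := by
  rw [ae_iff]
  simp only [not_not]
  set B := 2 * ∫⁻ x, (g x : ℝ≥0∞) ^ p ∂m with hB
  have hBfin : B ≠ ∞ := ENNReal.mul_ne_top (by simp) hfin
  have hms : ∀ t : ℝ≥0, MeasurableSet {x | t < g x} := fun t =>
    measurableSet_lt measurable_const hg
  have key : ∀ t : ℝ≥0, 1 ≤ t →
      t * m {x | intervalMaximal m (m.withDensity fun x => (g x : ℝ≥0∞)) x = ∞} ≤ B := by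
    intro t ht
    calc t * m {x | intervalMaximal m (m.withDensity fun x => (g x : ℝ≥0∞)) x = ∞}
        ≤ t * m {x | 2 * (t : ℝ≥0∞) < intervalMaximal m (m.withDensity fun x => (g x : ℝ≥0∞)) x} := by
          gcongr with x
          intro hx
          rw [hx]
          exact (ENNReal.mul_ne_top (by simp) (by simp)).lt_top
      _ ≤ 2 * ∫⁻ x in {x | t < g x}, g x ∂m := by
          simpa using mul_measure_two_mul_lt_intervalMaximal_le m (fun x => (g x : ℝ≥0∞))
            hg.coe_nnreal_ennreal t
      _ ≤ 2 * ∫⁻ x in {x | t < g x}, (g x : ℝ≥0∞) ^ p ∂m := by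
          gcongr 2 * ?_
          refine setLIntegral_mono' (hms t) fun x hx => ?_
          have : (1 : ℝ≥0∞) ≤ g x := by exact_mod_cast ht.trans (le_of_lt hx)
          simpa using ENNReal.rpow_le_rpow_of_exponent_le this hp.le
      _ ≤ B := by
          rw [hB]; gcongr; exact Measure.restrict_le_self
  by_contra h0
  obtain ⟨n, hn⟩ := ENNReal.exists_nat_mul_gt h0 hBfin
  have h1 := key (n + 1) (by simp)
  refine absurd (hn.trans_le ?_) (not_lt.2 h1)
  gcongr
  simp

/-- Marcinkiewicz interpolation by hand: layer cake, the truncated weak bound at height `t / 2`,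
then Tonelli. The inner integral of `4 t ^ (p - 2)` over `0 < t < 2 g x` produces the constant. -/
theorem lintegral_intervalMaximal_rpow_le (m : Measure X) [SFinite m] (g : X → ℝ≥0)
    (hg : Measurable g) {p : ℝ} (hp : 1 < p) :
    ∫⁻ x, intervalMaximal m (m.withDensity fun x => (g x : ℝ≥0∞)) x ^ p ∂m ≤
      ENNReal.ofReal (p * (4 * 2 ^ (p - 1) / (p - 1))) * ∫⁻ x, (g x : ℝ≥0∞) ^ p ∂m := by
  have hp1 : 0 < p - 1 := by linarith
  by_cases hfin : ∫⁻ x, (g x : ℝ≥0∞) ^ p ∂m = ∞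
  · rw [hfin, ENNReal.mul_top]
    · exact le_top
    · rw [ne_eq, ENNReal.ofReal_eq_zero, not_le]
      positivity
  set N := intervalMaximal m (m.withDensity fun x => (g x : ℝ≥0∞)) with hN
  have hNm : Measurable N := measurable_intervalMaximal _ _
  have h1 : ∫⁻ x, N x ^ p ∂m = ∫⁻ x, ENNReal.ofReal ((N x).toReal ^ p) ∂m := by
    refine lintegral_congr_ae ?_
    filter_upwards [intervalMaximal_ae_ne_top m g hg hp hfin] with x hx
    rw [← ENNReal.ofReal_rpow_of_nonneg ENNReal.toReal_nonneg (by linarith), ENNReal.ofReal_toReal hx]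
  rw [h1, lintegral_rpow_eq_lintegral_meas_lt_mul m (.of_forall fun _ => ENNReal.toReal_nonneg)
    hNm.ennreal_toReal.aemeasurable (by linarith)]
  have h2 : ∀ t ∈ Set.Ioi (0 : ℝ), m {a | t < (N a).toReal} * ENNReal.ofReal (t ^ (p - 1)) ≤
      ∫⁻ x, ENNReal.ofReal (4 * t ^ (p - 2)) * (g x : ℝ≥0∞) * (if t < 2 * g x then 1 else 0) ∂m := by
    intro t (ht : 0 < t)
    have hs : (t / 2).toNNReal ≠ 0 := by simpa using ht
    have := mul_measure_two_mul_lt_intervalMaximal_le m (fun x => (g x : ℝ≥0∞))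
      hg.coe_nnreal_ennreal (t / 2).toNNReal
    have h3 : m {a | t < (N a).toReal} ≤
        m {x | 2 * (((t / 2).toNNReal : ℝ≥0) : ℝ≥0∞) < N x} := by
      refine measure_mono fun x hx => ?_
      have hx' : t < (N x).toReal := hx
      have : 2 * (((t / 2).toNNReal : ℝ≥0) : ℝ≥0∞) = ENNReal.ofReal t := by
        rw [← ENNReal.ofReal, show (2 : ℝ≥0∞) = ENNReal.ofReal 2 by simp,
          ← ENNReal.ofReal_mul (by norm_num)]
        congr 1; ring
      simp only [this, Set.mem_ofPred_eq]
      by_cases hx2 : N x = ∞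
      · rw [hx2]; simp
      · exact (ENNReal.ofReal_lt_iff_lt_toReal ht.le hx2).2 hx'
    -- Splits off the factor `t / 2` that the weak bound at height `t / 2` consumes.
    have h4 : ENNReal.ofReal (t ^ (p - 1)) =
        ENNReal.ofReal (2 * t ^ (p - 2)) * ((t / 2).toNNReal : ℝ≥0∞) := by
      rw [← ENNReal.ofReal, ← ENNReal.ofReal_mul (by positivity)]
      congr 1
      rw [show p - 1 = (p - 2) + 1 by ring, Real.rpow_add ht, Real.rpow_one]
      ring
    calc m {a | t < (N a).toReal} * ENNReal.ofReal (t ^ (p - 1))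
        ≤ m {x | 2 * (((t / 2).toNNReal : ℝ≥0) : ℝ≥0∞) < N x} *
            (ENNReal.ofReal (2 * t ^ (p - 2)) * ((t / 2).toNNReal : ℝ≥0∞)) := by
          rw [h4]; gcongr
      _ = ENNReal.ofReal (2 * t ^ (p - 2)) * (((t / 2).toNNReal : ℝ≥0∞) *
            m {x | 2 * (((t / 2).toNNReal : ℝ≥0) : ℝ≥0∞) < N x}) := by ring
      _ ≤ ENNReal.ofReal (2 * t ^ (p - 2)) * (2 *
            ∫⁻ x in {x | (((t / 2).toNNReal : ℝ≥0) : ℝ≥0∞) < g x}, g x ∂m) := by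
          gcongr
      _ = ENNReal.ofReal (4 * t ^ (p - 2)) *
            ∫⁻ x in {x | (((t / 2).toNNReal : ℝ≥0) : ℝ≥0∞) < g x}, g x ∂m := by
          rw [← mul_assoc, show (2 : ℝ≥0∞) = ENNReal.ofReal 2 by simp,
            ← ENNReal.ofReal_mul (by positivity)]
          congr 2; ring
      _ = _ := by
          rw [← lintegral_indicator (measurableSet_lt measurable_const hg.coe_nnreal_ennreal),
            ← lintegral_const_mul]
          · refine lintegral_congr fun x => ?_
            have : (((t / 2).toNNReal : ℝ≥0) : ℝ≥0∞) < g x ↔ t < 2 * g x := by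
              rw [ENNReal.coe_lt_coe, Real.toNNReal_lt_iff_lt_coe (by positivity)]
              constructor <;> intro h <;> linarith
            by_cases hx : t < 2 * g x
            · simp only [Set.indicator_apply, Set.mem_ofPred_eq, if_pos (this.2 hx), if_pos hx, mul_one]
            · simp only [Set.indicator_apply, Set.mem_ofPred_eq, if_neg (mt this.1 hx), if_neg hx,
                mul_zero]
          · exact (hg.coe_nnreal_ennreal).indicator
              (measurableSet_lt measurable_const hg.coe_nnreal_ennreal)
  have hmeas : Measurable fun q : ℝ × X => ENNReal.ofReal (4 * q.1 ^ (p - 2)) *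
      (g q.2 : ℝ≥0∞) * (if q.1 < 2 * g q.2 then 1 else 0) := by
    refine Measurable.mul (by fun_prop) (Measurable.ite ?_ measurable_const measurable_const)
    exact measurableSet_lt measurable_fst (by fun_prop)
  calc ENNReal.ofReal p * ∫⁻ t in Set.Ioi 0, m {a | t < (N a).toReal} * ENNReal.ofReal (t ^ (p - 1))
      ≤ ENNReal.ofReal p * ∫⁻ t in Set.Ioi 0, ∫⁻ x, ENNReal.ofReal (4 * t ^ (p - 2)) * (g x : ℝ≥0∞)
          * (if t < 2 * g x then 1 else 0) ∂m := by
        gcongr 1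
        exact setLIntegral_mono' measurableSet_Ioi h2
    _ = ENNReal.ofReal p * ∫⁻ x, ∫⁻ t in Set.Ioi 0, ENNReal.ofReal (4 * t ^ (p - 2)) * (g x : ℝ≥0∞)
          * (if t < 2 * g x then 1 else 0) ∂volume ∂m := by
        rw [lintegral_lintegral_swap]
        exact hmeas.aemeasurable
    _ = ENNReal.ofReal p * ∫⁻ x, ENNReal.ofReal (4 * 2 ^ (p - 1) / (p - 1)) * (g x : ℝ≥0∞) ^ p ∂m := by
        congr 1
        refine lintegral_congr fun x => ?_
        have e1 : ∀ t, ENNReal.ofReal (4 * t ^ (p - 2)) * (g x : ℝ≥0∞) *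
            (if t < 2 * g x then 1 else 0) = (g x : ℝ≥0∞) *
              (Set.Iio (2 * (g x : ℝ))).indicator (fun t => ENNReal.ofReal (4 * t ^ (p - 2))) t := by
          intro t
          by_cases ht : t < 2 * g x
          · simp only [Set.indicator_apply, Set.mem_Iio, if_pos ht, mul_one]; rw [mul_comm]
          · simp only [Set.indicator_apply, Set.mem_Iio, if_neg ht, mul_zero]
        simp_rw [e1]
        rw [lintegral_const_mul _ (Measurable.indicator (by fun_prop) measurableSet_Iio),
          lintegral_indicator measurableSet_Iio, Measure.restrict_restrict measurableSet_Iio,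
          Set.inter_comm, Set.Ioi_inter_Iio, Measure.restrict_congr_set Ioo_ae_eq_Ioc]
        have hint : IntervalIntegrable (fun t : ℝ => 4 * t ^ (p - 2)) volume 0 (2 * g x) :=
          (intervalIntegral.intervalIntegrable_rpow' (by linarith)).const_mul 4
        rw [← ofReal_integral_eq_lintegral_ofReal hint.1,
          ← intervalIntegral.integral_of_le (by positivity), intervalIntegral.integral_const_mul,
          integral_rpow (.inl (by linarith))]
        · rw [show p - 2 + 1 = p - 1 by ring, Real.zero_rpow hp1.ne', sub_zero,
            Real.mul_rpow (by norm_num) (by positivity)]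
          have e2 : (g x : ℝ≥0∞) ^ p = ENNReal.ofReal ((g x : ℝ) ^ p) := by
            rw [← ENNReal.ofReal_rpow_of_nonneg (by positivity) (by linarith), ENNReal.ofReal_coe_nnreal]
          rw [e2, ← ENNReal.ofReal_mul (by positivity), ← ENNReal.ofReal_coe_nnreal,
            ← ENNReal.ofReal_mul (by positivity)]
          congr 1
          rcases eq_or_lt_of_le (g x).2 with h0 | h0
          · have h0' : (g x : ℝ) = 0 := h0.symm
            rw [h0', zero_mul, Real.zero_rpow (by positivity), mul_zero]
          · have : (g x : ℝ) ^ p = (g x : ℝ) * (g x : ℝ) ^ (p - 1) := by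
              rw [← Real.rpow_one_add' (by positivity) (by linarith)]; congr 1; ring
            rw [this]; ring
        · filter_upwards [ae_restrict_mem measurableSet_Ioc] with t ht
          have := ht.1.le
          positivity
    _ = _ := by
        rw [lintegral_const_mul _ (by fun_prop), ← mul_assoc, ← ENNReal.ofReal_mul (by linarith)]

end Line

/-! ### Polar coordinates and radial functions. -/

/-- The measure `ρ ^ (d - 1 - a) dρ` on `(0, ∞)`. -/
def radialMeasure (d : ℕ) (a : ℝ) : Measure (Set.Ioi (0 : ℝ)) :=
  (Measure.volumeIoiPow (d - 1)).withDensity fun ρ => ENNReal.ofReal (ρ.1 ^ (-a))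

instance (d : ℕ) (a : ℝ) : SFinite (radialMeasure d a) := by
  unfold radialMeasure; infer_instance

/-- The surface measure on the unit sphere of `ℝ^d`. -/
def sphereMeasure (d : ℕ) : Measure (Metric.sphere (0 : EuclideanSpace ℝ (Fin d)) 1) :=
  (volume : Measure (EuclideanSpace ℝ (Fin d))).toSphere

instance (d : ℕ) : IsFiniteMeasure (sphereMeasure d) := by
  unfold sphereMeasure; infer_instance

theorem nontrivial_euclidean {d : ℕ} (hd : 1 ≤ d) : Nontrivial (EuclideanSpace ℝ (Fin d)) := by
  have : NeZero d := ⟨by omega⟩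
  infer_instance

theorem powerMeasure_absolutelyContinuous (d : ℕ) (a : ℝ) : powerMeasure d a ≪ volume :=
  withDensity_absolutelyContinuous _ _

theorem lintegral_powerMeasure {d : ℕ} (a : ℝ)
    {h : EuclideanSpace ℝ (Fin d) → ℝ≥0∞} (hh : Measurable h) :
    ∫⁻ y, h y ∂powerMeasure d a = ∫⁻ y, ENNReal.ofReal (‖y‖ ^ (-a)) * h y := by
  rw [powerMeasure, lintegral_withDensity_eq_lintegral_mul _ (by fun_prop) hh]
  rfl

theorem lintegral_radialMeasure (d : ℕ) (a : ℝ) {h : Set.Ioi (0 : ℝ) → ℝ≥0∞} (hh : Measurable h) :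
    ∫⁻ ρ, h ρ ∂radialMeasure d a =
      ∫⁻ ρ, ENNReal.ofReal (ρ.1 ^ (-a)) * h ρ ∂Measure.volumeIoiPow (d - 1) := by
  rw [radialMeasure, lintegral_withDensity_eq_lintegral_mul _ (by fun_prop) hh]
  rfl

/-- Integration in polar coordinates. -/
theorem lintegral_powerMeasure_polar {d : ℕ} (hd : 1 ≤ d) (a : ℝ)
    {h : EuclideanSpace ℝ (Fin d) → ℝ≥0∞} (hh : Measurable h) :
    ∫⁻ y, h y ∂powerMeasure d a =
      ∫⁻ ω, ∫⁻ ρ, h (ρ.1 • ω.1) ∂radialMeasure d a ∂sphereMeasure d := by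
  have := nontrivial_euclidean hd
  set F : Metric.sphere (0 : EuclideanSpace ℝ (Fin d)) 1 × Set.Ioi (0 : ℝ) → ℝ≥0∞ :=
    fun q => ENNReal.ofReal (q.2.1 ^ (-a)) * h (q.2.1 • q.1.1) with hF
  have hFm : Measurable F := by
    refine Measurable.mul (by fun_prop) (hh.comp ?_)
    fun_prop
  have h1 := (Measure.measurePreserving_homeomorphUnitSphereProd
    (volume : Measure (EuclideanSpace ℝ (Fin d)))).lintegral_comp hFm
  have h2 : ∀ y : ({0}ᶜ : Set (EuclideanSpace ℝ (Fin d))),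
      F (homeomorphUnitSphereProd _ y) = ENNReal.ofReal (‖y.1‖ ^ (-a)) * h y.1 := by
    intro y
    have : ‖y.1‖ ≠ 0 := norm_ne_zero_iff.2 y.2
    simp [hF, smul_smul, this]
  rw [lintegral_powerMeasure a hh]
  calc ∫⁻ y, ENNReal.ofReal (‖y‖ ^ (-a)) * h y
      = ∫⁻ y in {0}ᶜ, ENNReal.ofReal (‖y‖ ^ (-a)) * h y := by rw [restrict_compl_singleton]
    _ = ∫⁻ y : ({0}ᶜ : Set (EuclideanSpace ℝ (Fin d))), ENNReal.ofReal (‖y.1‖ ^ (-a)) * h y.1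
          ∂(volume.comap Subtype.val) :=
        (lintegral_subtype_comap (measurableSet_singleton _).compl
          (fun y => ENNReal.ofReal (‖y‖ ^ (-a)) * h y)).symm
    _ = ∫⁻ q, F q ∂((volume : Measure (EuclideanSpace ℝ (Fin d))).toSphere.prod
          (Measure.volumeIoiPow (d - 1))) := by
        simp_rw [← h2]
        rw [h1, finrank_euclideanSpace_fin]
    _ = ∫⁻ ω, ∫⁻ ρ, F (ω, ρ) ∂(Measure.volumeIoiPow (d - 1)) ∂sphereMeasure d :=
        lintegral_prod _ hFm.aemeasurable
    _ = _ := by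
        refine lintegral_congr fun ω => ?_
        rw [lintegral_radialMeasure]
        exact hh.comp (by fun_prop)

theorem lintegral_powerMeasure_polar_swap {d : ℕ} (hd : 1 ≤ d) (a : ℝ)
    {h : EuclideanSpace ℝ (Fin d) → ℝ≥0∞} (hh : Measurable h) :
    ∫⁻ y, h y ∂powerMeasure d a =
      ∫⁻ ρ, ∫⁻ ω, h (ρ.1 • ω.1) ∂sphereMeasure d ∂radialMeasure d a := by
  rw [lintegral_powerMeasure_polar hd a hh, lintegral_lintegral_swap]
  refine (hh.comp ?_).aemeasurable
  fun_prop

theorem norm_smul_sphere {d : ℕ} (ρ : Set.Ioi (0 : ℝ))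
    (ω : Metric.sphere (0 : EuclideanSpace ℝ (Fin d)) 1) : ‖ρ.1 • ω.1‖ = ρ.1 := by
  have : 0 < ρ.1 := ρ.2
  simp [norm_smul, abs_of_pos this]

theorem smul_sphere_ne_zero {d : ℕ} (ρ : Set.Ioi (0 : ℝ))
    (ω : Metric.sphere (0 : EuclideanSpace ℝ (Fin d)) 1) : ρ.1 • ω.1 ≠ 0 := by
  rw [← norm_ne_zero_iff, norm_smul_sphere]
  exact ne_of_gt ρ.2

theorem sphereMeasure_univ_ne_zero {d : ℕ} (hd : 1 ≤ d) : sphereMeasure d Set.univ ≠ 0 := by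
  have := nontrivial_euclidean hd
  rw [sphereMeasure, ne_eq, Measure.measure_univ_eq_zero]
  exact Measure.toSphere_ne_zero _

theorem lintegral_norm_powerMeasure {d : ℕ} (hd : 1 ≤ d) (a : ℝ) {G : ℝ → ℝ≥0∞}
    (hG : Measurable G) :
    ∫⁻ y, G ‖y‖ ∂powerMeasure d a =
      sphereMeasure d Set.univ * ∫⁻ ρ, G ρ.1 ∂radialMeasure d a := by
  rw [lintegral_powerMeasure_polar hd a (h := fun y => G ‖y‖) (hG.comp measurable_norm)]
  simp only [norm_smul_sphere, lintegral_const]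
  rw [mul_comm]

theorem ae_powerMeasure_of_radial {d : ℕ} (hd : 1 ≤ d) (a : ℝ)
    {s : Set (EuclideanSpace ℝ (Fin d))} (hs : MeasurableSet s) :
    (∀ᵐ y ∂powerMeasure d a, y ∈ s) ↔
      ∀ᵐ ρ ∂radialMeasure d a, ∀ᵐ ω ∂sphereMeasure d, ρ.1 • ω.1 ∈ s := by
  have hm : Measurable (sᶜ.indicator fun _ => (1 : ℝ≥0∞)) := measurable_const.indicator hs.compl
  have h1 : powerMeasure d a sᶜ = ∫⁻ y, sᶜ.indicator (fun _ => (1 : ℝ≥0∞)) y ∂powerMeasure d a := by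
    rw [lintegral_indicator hs.compl]; simp
  have hm2 : Measurable fun q : Set.Ioi (0 : ℝ) × Metric.sphere (0 : EuclideanSpace ℝ (Fin d)) 1 =>
      sᶜ.indicator (fun _ => (1 : ℝ≥0∞)) (q.1.1 • q.2.1) := hm.comp (by fun_prop)
  change powerMeasure d a sᶜ = 0 ↔ _
  rw [h1, lintegral_powerMeasure_polar_swap hd a hm, lintegral_eq_zero_iff hm2.lintegral_prod_right']
  refine eventually_congr (.of_forall fun ρ => ?_)
  simp only [Pi.zero_apply]
  have hm3 : Measurable fun ω : Metric.sphere (0 : EuclideanSpace ℝ (Fin d)) 1 =>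
      sᶜ.indicator (fun _ => (1 : ℝ≥0∞)) (ρ.1 • ω.1) := hm.comp (by fun_prop)
  rw [lintegral_eq_zero_iff hm3]
  refine eventually_congr (.of_forall fun ω => ?_)
  simp

/-- A measurable radial function agrees a.e. with a measurable function of the norm. -/
theorem IsRadialFun.exists_measurable {d : ℕ} (hd : 1 ≤ d) (a : ℝ)
    {f : EuclideanSpace ℝ (Fin d) → ℝ} (hf : IsRadialFun f)
    (hm : AEStronglyMeasurable f (powerMeasure d a)) :
    ∃ G : ℝ → ℝ≥0, Measurable G ∧ ∀ᵐ y ∂powerMeasure d a, ‖f y‖ₑ = G ‖y‖ := by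
  obtain ⟨f₀, hf₀⟩ := hf
  set f' := hm.mk f
  have hf' : Measurable f' := hm.stronglyMeasurable_mk.measurable
  -- The profile `f₀` need not be measurable. The spherical mean of a measurable representative is,
  -- and on almost every sphere it equals `|f₀|`.
  set G : ℝ → ℝ≥0 := fun ρ =>
    ((∫⁻ ω, ‖f' (ρ • ω.1)‖ₑ ∂sphereMeasure d) / sphereMeasure d Set.univ).toNNReal with hG
  have hGm : Measurable G := by
    refine Measurable.ennreal_toNNReal (Measurable.div_const ?_ _)
    refine Measurable.lintegral_prod_right' (f := fun q : ℝ × Metric.sphere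
      (0 : EuclideanSpace ℝ (Fin d)) 1 => ‖f' (q.1 • q.2.1)‖ₑ) ?_
    exact (hf'.comp (by fun_prop)).enorm
  refine ⟨G, hGm, ?_⟩
  have h1 : ∀ᵐ ρ ∂radialMeasure d a, ∀ᵐ ω ∂sphereMeasure d, f' (ρ.1 • ω.1) = f₀ ρ.1 := by
    have := (ae_powerMeasure_of_radial hd a (measurableSet_toMeasurable (powerMeasure d a)
      {y | f y = f' y}ᶜ).compl).1 (by
        change powerMeasure d a (_ᶜᶜ) = 0
        rw [compl_compl, measure_toMeasurable]
        exact hm.ae_eq_mk)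
    filter_upwards [this] with ρ hρ
    filter_upwards [hρ] with ω hω
    have := Set.notMem_subset (subset_toMeasurable _ _) hω
    simp only [Set.mem_compl_iff, not_not] at this
    rw [← show f (ρ.1 • ω.1) = f' (ρ.1 • ω.1) from this, hf₀ _ (smul_sphere_ne_zero ρ ω),
      norm_smul_sphere]
  have h2 : ∀ᵐ y ∂powerMeasure d a, y ∈ {y | ‖f' y‖ₑ = G ‖y‖} := by
    rw [ae_powerMeasure_of_radial hd a (measurableSet_eq_fun hf'.enorm (by fun_prop))]
    filter_upwards [h1] with ρ hρ
    have hGρ : (G ρ.1 : ℝ≥0∞) = ‖f₀ ρ.1‖ₑ := by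
      have : ∫⁻ ω, ‖f' (ρ.1 • ω.1)‖ₑ ∂sphereMeasure d = ‖f₀ ρ.1‖ₑ * sphereMeasure d Set.univ := by
        rw [← lintegral_const]
        refine lintegral_congr_ae ?_
        filter_upwards [hρ] with ω hω
        rw [hω]
      rw [hG]
      simp only [this]
      rw [ENNReal.mul_div_cancel_right (sphereMeasure_univ_ne_zero hd) (measure_ne_top _ _),
        ENNReal.coe_toNNReal (by simp)]
    filter_upwards [hρ] with ω hω
    simp only [norm_smul_sphere, hGρ, hω]
  filter_upwards [h2, hm.ae_eq_mk] with y hy hy'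
  rw [hy']; exact hy

/-- The origin is not a point of `(0, ∞)`, so the density is continuous there and no bound on `a` is
needed. This supplies the outer regularity below. -/
instance (d : ℕ) (a : ℝ) : IsLocallyFiniteMeasure (radialMeasure d a) := by
  have : IsLocallyFiniteMeasure (Measure.volumeIoiPow (d - 1)) := by
    refine ⟨fun x => ⟨Set.Iio ⟨x.1 + 1, ?_⟩, Iio_mem_nhds ?_, ?_⟩⟩
    · have : (0 : ℝ) < x.1 := x.2
      exact Set.mem_Ioi.2 (by linarith)
    · rw [← Subtype.coe_lt_coe]; simp
    · rw [Measure.volumeIoiPow_apply_Iio]; exact ENNReal.ofReal_lt_top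
  refine IsLocallyFiniteMeasure.withDensity_ofReal ?_
  exact continuous_subtype_val.rpow_const fun x => .inl (ne_of_gt x.2)

instance (d : ℕ) (a : ℝ) : (radialMeasure d a).OuterRegular := by
  have : LocallyCompactSpace (Set.Ioi (0 : ℝ)) := isOpen_Ioi.locallyCompactSpace
  infer_instance

/-! ### Geometry of chords and of the tangent cone of a ball. -/

section Chord

variable {E : Type*} [NormedAddCommGroup E] [InnerProductSpace ℝ E]

theorem norm_smul_sub_sq {ω x : E} (hω : ‖ω‖ = 1) (ρ : ℝ) :
    ‖ρ • ω - x‖ ^ 2 = ρ ^ 2 - 2 * ρ * inner ℝ ω x + ‖x‖ ^ 2 := by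
  rw [norm_sub_sq_real, norm_smul, inner_smul_left, hω]
  simp; ring

theorem mem_closedBall_iff_sq {y x : E} {r : ℝ} (hr : 0 ≤ r) :
    y ∈ Metric.closedBall x r ↔ ‖y - x‖ ^ 2 ≤ r ^ 2 := by
  rw [Metric.mem_closedBall, dist_eq_norm, sq_le_sq₀ (norm_nonneg _) hr]

/-- The radius at which a ray from the origin is tangent to `closedBall x r`, or `0` if the
origin belongs to the ball. -/
def tangentRadius (x : E) (r : ℝ) : ℝ := Real.sqrt (‖x‖ ^ 2 - r ^ 2)

theorem tangentRadius_nonneg (x : E) (r : ℝ) : 0 ≤ tangentRadius x r := Real.sqrt_nonneg _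

theorem tangentRadius_le (x : E) (r : ℝ) : tangentRadius x r ≤ ‖x‖ :=
  Real.sqrt_le_iff.2 ⟨norm_nonneg _, by nlinarith [sq_nonneg r]⟩

theorem tangentRadius_sq {x : E} {r : ℝ} (hr : 0 ≤ r) (h : r ≤ ‖x‖) :
    tangentRadius x r ^ 2 = ‖x‖ ^ 2 - r ^ 2 := Real.sq_sqrt (by nlinarith)

theorem tangentRadius_eq_zero {x : E} {r : ℝ} (h : ‖x‖ ≤ r) : tangentRadius x r = 0 :=
  Real.sqrt_eq_zero_of_nonpos (by nlinarith [norm_nonneg x])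

theorem tangentRadius_sq_add_min {x : E} {r : ℝ} (hr : 0 ≤ r) :
    tangentRadius x r ^ 2 + min r ‖x‖ ^ 2 = ‖x‖ ^ 2 := by
  rcases le_total r ‖x‖ with h | h
  · rw [tangentRadius_sq hr h, min_eq_left h]; ring
  · rw [tangentRadius_eq_zero h, min_eq_right h]; ring

/-- Membership in the ball is `q ρ ≤ 0` for a convex quadratic `q`. At the tangent radius `c` one
has `q c = 2 c (c - ⟨ω, x⟩) ≤ 0` when the origin is outside the ball, and `q 0 ≤ 0` with `c = 0`
otherwise. So the chord reaches `c`, the left end of the added interval. Since `c` may be `0`,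
outside `(0, ∞)`, the argument uses `q` and not membership of `c`. -/
theorem ordConnected_chord_union {ω x : E} (hω : ‖ω‖ = 1) {r : ℝ} (hr : 0 ≤ r)
    (hS : r < ‖x‖ → tangentRadius x r ≤ inner ℝ ω x) :
    ({ρ : Set.Ioi (0 : ℝ) | ρ.1 • ω ∈ Metric.closedBall x r} ∪
      {ρ | tangentRadius x r ≤ ρ.1 ∧ ρ.1 ≤ ‖x‖}).OrdConnected := by
  set c := tangentRadius x r with hc
  set w := inner ℝ ω x with hw
  set R := ‖x‖ with hR
  have hmem : ∀ ρ : Set.Ioi (0 : ℝ), ρ.1 • ω ∈ Metric.closedBall x r ↔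
      ρ.1 ^ 2 - 2 * ρ.1 * w + R ^ 2 - r ^ 2 ≤ 0 := by
    intro ρ
    rw [mem_closedBall_iff_sq hr, norm_smul_sub_sq hω]
    constructor <;> intro h <;> linarith
  have hc0 : 0 ≤ c := tangentRadius_nonneg x r
  have hcR : c ≤ R := tangentRadius_le x r
  have hqc : c ^ 2 - 2 * c * w + R ^ 2 - r ^ 2 ≤ 0 := by
    rcases lt_or_ge r R with h | h
    · have := tangentRadius_sq hr h.le
      have := hS h
      nlinarith
    · rw [hc, tangentRadius_eq_zero h]
      nlinarith [norm_nonneg x]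
  have conv : ∀ u z v : ℝ, u ≤ z → z ≤ v → u ^ 2 - 2 * u * w + R ^ 2 - r ^ 2 ≤ 0 →
      v ^ 2 - 2 * v * w + R ^ 2 - r ^ 2 ≤ 0 → z ^ 2 - 2 * z * w + R ^ 2 - r ^ 2 ≤ 0 := by
    intro u z v huz hzv hu hv
    rcases huz.eq_or_lt with rfl | huz'
    · exact hu
    have huv : 0 < v - u := by linarith
    have h1 := mul_nonneg (sub_nonneg.2 huz) (sub_nonneg.2 hzv)
    have h2 := mul_nonneg_of_nonpos_of_nonpos hu (sub_nonpos.2 hzv)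
    have h3 := mul_nonneg_of_nonpos_of_nonpos hv (sub_nonpos.2 huz)
    by_contra! hcon
    nlinarith [mul_pos huv hcon, mul_nonneg h1 huv.le]
  refine ⟨fun a ha b hb z hz => ?_⟩
  have haz : a.1 ≤ z.1 := hz.1
  have hzb : z.1 ≤ b.1 := hz.2
  by_cases hzL : c ≤ z.1 ∧ z.1 ≤ R
  · exact .inr hzL
  · left
    rw [Set.mem_ofPred_eq, hmem]
    rcases lt_or_ge z.1 c with h | h
    · have ha' : a.1 • ω ∈ Metric.closedBall x r := by
        rcases ha with ha | ha
        · exact ha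
        · exact absurd ha.1 (by push Not; linarith)
      exact conv a.1 z.1 c haz h.le ((hmem a).1 ha') hqc
    · have hRz : R < z.1 := not_le.1 fun h' => hzL ⟨h, h'⟩
      have hb' : b.1 • ω ∈ Metric.closedBall x r := by
        rcases hb with hb | hb
        · exact hb
        · exact absurd hb.2 (by push Not; linarith)
      exact conv c z.1 b.1 h hzb hqc ((hmem b).1 hb')

/-- With `c` the tangent radius, `ρ² - 2 ρ ⟨ω, x⟩ + c² > (ρ - c)² ≥ 0`. -/
theorem not_mem_closedBall_of_inner_lt {ω x : E} (hω : ‖ω‖ = 1) {r : ℝ} (hr : 0 ≤ r)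
    (h : r < ‖x‖) (hlt : inner ℝ ω x < tangentRadius x r) {ρ : ℝ} (hρ : 0 < ρ) :
    ρ • ω ∉ Metric.closedBall x r := by
  rw [mem_closedBall_iff_sq hr, norm_smul_sub_sq hω]
  have := tangentRadius_sq hr h.le
  nlinarith [mul_lt_mul_of_pos_left hlt hρ, sq_nonneg (ρ - tangentRadius x r)]

theorem inner_tangent_center (ω x : E) (c : ℝ) (hx : x ≠ 0) :
    inner ℝ ω ((c / ‖x‖) • x) = c / ‖x‖ * inner ℝ ω x ∧ ‖(c / ‖x‖) • x‖ ^ 2 = c ^ 2 := by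
  have : ‖x‖ ≠ 0 := norm_ne_zero_iff.2 hx
  constructor
  · rw [inner_smul_right]
  · rw [norm_smul, mul_pow, Real.norm_eq_abs, sq_abs]; field_simp

/-- The part of the tangent cone of a ball between the tangent radius and the norm of the center
lies in a ball of the same radius. -/
theorem smul_mem_closedBall_tangent {ω x : E} (hω : ‖ω‖ = 1) (hx : x ≠ 0) {r : ℝ} (hr : 0 ≤ r)
    (hS : r < ‖x‖ → tangentRadius x r ≤ inner ℝ ω x) {ρ : ℝ} (hρ0 : 0 ≤ ρ) (hρR : ρ ≤ ‖x‖)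
    (hρ : tangentRadius x r ≤ ρ ∨ tangentRadius x r ≤ ‖x‖ / 2) :
    ρ • ω ∈ Metric.closedBall ((tangentRadius x r / ‖x‖) • x) (min r ‖x‖) := by
  have hR : 0 < ‖x‖ := norm_pos_iff.2 hx
  rw [mem_closedBall_iff_sq (le_min hr hR.le), norm_smul_sub_sq hω]
  obtain ⟨e1, e2⟩ := inner_tangent_center ω x (tangentRadius x r) hx
  rw [e1, e2]
  have hsum := tangentRadius_sq_add_min (x := x) hr
  have hcR := tangentRadius_le x r
  have hc0 := tangentRadius_nonneg x r
  rcases le_or_gt ‖x‖ r with h | h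
  · rw [tangentRadius_eq_zero h, min_eq_right h]
    simp only [zero_div, zero_mul, mul_zero, sub_zero]
    nlinarith
  have hw := hS h
  set c := tangentRadius x r
  set w := inner ℝ ω x
  set R := ‖x‖
  set m := min r R
  have h1 : ρ * (c / R * c) ≤ ρ * (c / R * w) := by gcongr
  have hm : m ^ 2 = R ^ 2 - c ^ 2 := by linarith
  rw [hm]
  -- With `c = k R` the right side minus the left side is `(R - ρ) (R + ρ - 2 k² R)`. The second
  -- factor is nonnegative if `ρ ≥ k R`, as `2 k² ≤ 1 + k`, and also if `k ≤ 1/2`.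
  suffices ρ ^ 2 - 2 * (ρ * (c / R * c)) + c ^ 2 ≤ R ^ 2 - c ^ 2 by nlinarith
  set k := c / R with hk
  have hck : c = k * R := by rw [hk]; field_simp
  have hk0 : 0 ≤ k := by positivity
  have hk1 : k ≤ 1 := by rw [hk, div_le_one hR]; exact hcR
  rw [hck] at hρ ⊢
  rcases hρ with hρ | hρ
  · have h2 : 0 ≤ (R - ρ) * (ρ - k * R) := mul_nonneg (by linarith) (by linarith)
    have h4 : 0 ≤ (1 - k) * R * ((R - ρ) * (1 + k)) := by
      have : 0 ≤ (1 - k) := by linarith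
      have : 0 ≤ R - ρ := by linarith
      positivity
    have h3 : 0 ≤ (1 - k) * (R - ρ) * (ρ - k * R) := by
      have : 0 ≤ (1 - k) := by linarith
      rw [mul_assoc]; exact mul_nonneg this h2
    nlinarith [mul_nonneg (mul_nonneg hk0 hk0) h2, mul_nonneg hk0 h2, mul_nonneg hk0 h4]
  · have hk2 : k ≤ 1 / 2 := by
      by_contra! hcon
      nlinarith
    have h2 : 0 ≤ (R - ρ) * (R + ρ - 2 * k ^ 2 * R) := by
      refine mul_nonneg (by linarith) ?_
      nlinarith [mul_nonneg hk0 hR.le, mul_nonneg (mul_nonneg hk0 hR.le) (sub_nonneg.2 hk2)]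
    nlinarith

/-- When `r < ‖x‖` the relevant quadratic in `ρ` is convex, bounded at `ρ = c` by `2 c (c - 5 ‖x‖ /
8)` and at `ρ = ‖x‖` by `c² - ‖x‖² / 4`, both nonpositive when `c ≤ ‖x‖ / 2`. It puts a cap of fixed
aperture inside the ball, which settles low dimensions. -/
theorem smul_mem_closedBall_of_inner {ω x : E} (hω : ‖ω‖ = 1) {r : ℝ} (hr : 0 ≤ r)
    (hw : 5 / 8 * ‖x‖ ≤ inner ℝ ω x) (hc : tangentRadius x r ≤ ‖x‖ / 2) {ρ : ℝ} (hρ0 : 0 ≤ ρ)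
    (hρ : tangentRadius x r ≤ ρ) (hρR : ρ ≤ ‖x‖) : ρ • ω ∈ Metric.closedBall x r := by
  rw [mem_closedBall_iff_sq hr, norm_smul_sub_sq hω]
  have h1 : ρ * (5 / 8 * ‖x‖) ≤ ρ * inner ℝ ω x := by gcongr
  rcases le_or_gt ‖x‖ r with h | h
  · nlinarith [norm_nonneg x]
  have hsq := tangentRadius_sq hr h.le
  have hc0 := tangentRadius_nonneg x r
  set c := tangentRadius x r
  set R := ‖x‖
  have h2 : 0 ≤ (R - ρ) * (ρ - c) := mul_nonneg (by linarith) (by linarith)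
  nlinarith [mul_nonneg hc0 (sub_nonneg.2 hρR), mul_nonneg hc0 (sub_nonneg.2 hc), mul_nonneg (sub_nonneg.2 hρ) (sub_nonneg.2 hc), mul_nonneg (sub_nonneg.2 hρR) (sub_nonneg.2 hc)]

end Chord

/-! ### Measures of balls and of truncated tangent cones. -/

theorem lintegral_radialMeasure_eq_Ioi {d : ℕ} (hd : 1 ≤ d) (a : ℝ) {h : ℝ → ℝ≥0∞}
    (hh : Measurable h) :
    ∫⁻ ρ, h ρ.1 ∂radialMeasure d a =
      ∫⁻ t in Set.Ioi 0, ENNReal.ofReal (t ^ ((d : ℝ) - 1 - a)) * h t := by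
  rw [lintegral_radialMeasure d a (h := fun ρ => h ρ.1) (hh.comp measurable_subtype_coe), Measure.volumeIoiPow,
    lintegral_withDensity_eq_lintegral_mul _ (by fun_prop) (by fun_prop)]
  rw [← lintegral_subtype_comap measurableSet_Ioi
    (fun t => ENNReal.ofReal (t ^ ((d : ℝ) - 1 - a)) * h t)]
  refine lintegral_congr fun ρ => ?_
  have hρ : (0 : ℝ) < ρ.1 := ρ.2
  simp only [Pi.mul_apply]
  rw [← mul_assoc, ← ENNReal.ofReal_mul (by positivity)]
  congr 2
  rw [← Real.rpow_natCast, ← Real.rpow_add hρ]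
  congr 1
  rw [Nat.cast_sub hd]; push_cast; ring

theorem radialMeasure_Iic {d : ℕ} (hd : 1 ≤ d) {a : ℝ} (ha : a < d) {R : ℝ} (hR : 0 ≤ R) :
    radialMeasure d a {ρ | ρ.1 ≤ R} = ENNReal.ofReal (R ^ ((d : ℝ) - a) / (d - a)) := by
  have hm : MeasurableSet {ρ : Set.Ioi (0 : ℝ) | ρ.1 ≤ R} :=
    measurableSet_le measurable_subtype_coe measurable_const
  have h1 : radialMeasure d a {ρ | ρ.1 ≤ R} =
      ∫⁻ ρ, (Set.Iic R).indicator (fun _ => (1 : ℝ≥0∞)) ρ.1 ∂radialMeasure d a := by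
    rw [← lintegral_indicator_one hm]; rfl
  rw [h1, lintegral_radialMeasure_eq_Ioi hd a (measurable_const.indicator measurableSet_Iic)]
  have h2 : ∀ t, ENNReal.ofReal (t ^ ((d : ℝ) - 1 - a)) *
      (Set.Iic R).indicator (fun _ => (1 : ℝ≥0∞)) t =
      (Set.Iic R).indicator (fun t => ENNReal.ofReal (t ^ ((d : ℝ) - 1 - a))) t := by
    intro t; by_cases ht : t ≤ R <;> simp [ht]
  simp_rw [h2]
  have hint : IntervalIntegrable (fun t : ℝ => t ^ ((d : ℝ) - 1 - a)) volume 0 R :=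
    intervalIntegral.intervalIntegrable_rpow' (by linarith)
  rw [lintegral_indicator measurableSet_Iic, Measure.restrict_restrict measurableSet_Iic,
    Set.inter_comm, Set.Ioi_inter_Iic, ← ofReal_integral_eq_lintegral_ofReal hint.1,
    ← intervalIntegral.integral_of_le hR, integral_rpow (.inl (by linarith))]
  · rw [show (d : ℝ) - 1 - a + 1 = d - a by ring, Real.zero_rpow (by linarith), sub_zero]
  · filter_upwards [ae_restrict_mem measurableSet_Ioc] with t ht
    have := ht.1.le
    positivity

theorem powerMeasure_closedBall_zero {d : ℕ} (hd : 1 ≤ d) {a : ℝ} (ha : a < d) {R : ℝ}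
    (hR : 0 ≤ R) : powerMeasure d a (Metric.closedBall 0 R) =
      sphereMeasure d Set.univ * ENNReal.ofReal (R ^ ((d : ℝ) - a) / (d - a)) := by
  rw [← radialMeasure_Iic hd ha hR]
  have h1 : powerMeasure d a (Metric.closedBall 0 R) =
      ∫⁻ y, (Set.Iic R).indicator (fun _ => (1 : ℝ≥0∞)) ‖y‖ ∂powerMeasure d a := by
    rw [← lintegral_indicator_one Metric.isClosed_closedBall.measurableSet]
    refine lintegral_congr fun y => ?_
    by_cases hy : ‖y‖ ≤ R <;> simp [hy]
  rw [h1, lintegral_norm_powerMeasure hd a (measurable_const.indicator measurableSet_Iic)]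
  congr 1
  rw [← lintegral_indicator_one (measurableSet_le measurable_subtype_coe measurable_const)]
  rfl

theorem powerMeasure_zero (d : ℕ) : powerMeasure d 0 = volume := by
  simp [powerMeasure]

theorem sphereMeasure_mul_radialMeasure_le {d : ℕ} (hd : 1 ≤ d) (a : ℝ)
    {S : Set (Metric.sphere (0 : EuclideanSpace ℝ (Fin d)) 1)} (hS : MeasurableSet S)
    {L : Set (Set.Ioi (0 : ℝ))} (hL : MeasurableSet L) {B : Set (EuclideanSpace ℝ (Fin d))}
    (hB : MeasurableSet B) (h : ∀ ω ∈ S, ∀ ρ ∈ L, ρ.1 • ω.1 ∈ B) :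
    sphereMeasure d S * radialMeasure d a L ≤ powerMeasure d a B := by
  rw [← lintegral_indicator_one hB, lintegral_powerMeasure_polar hd a
    (measurable_one.indicator hB)]
  calc sphereMeasure d S * radialMeasure d a L
      = ∫⁻ ω in S, radialMeasure d a L ∂sphereMeasure d := by rw [setLIntegral_const, mul_comm]
    _ ≤ ∫⁻ ω in S, ∫⁻ ρ, B.indicator 1 (ρ.1 • ω.1) ∂radialMeasure d a ∂sphereMeasure d := by
        refine setLIntegral_mono' hS fun ω hω => ?_
        rw [← lintegral_indicator_one hL]
        refine lintegral_mono fun ρ => ?_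
        by_cases hρ : ρ ∈ L
        · simp [hρ, h ω hω ρ hρ]
        · simp [hρ]
    _ ≤ _ := setLIntegral_le_lintegral _ _

theorem radialMeasure_le_const_mul {d : ℕ} {a k : ℝ}
    {L : Set (Set.Ioi (0 : ℝ))} (hL : MeasurableSet L) (h : ∀ ρ ∈ L, ρ.1 ^ (-a) ≤ k) :
    radialMeasure d a L ≤ ENNReal.ofReal k * radialMeasure d 0 L := by
  have h0 : radialMeasure d 0 L = Measure.volumeIoiPow (d - 1) L := by simp [radialMeasure]
  rw [h0, radialMeasure, withDensity_apply _ hL, ← setLIntegral_const]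
  exact setLIntegral_mono' hL fun ρ hρ => ENNReal.ofReal_le_ofReal (h ρ hρ)

theorem powerMeasure_le_const_mul {d : ℕ} {a k : ℝ} {s : Set (EuclideanSpace ℝ (Fin d))}
    (hs : MeasurableSet s) (h : ∀ y ∈ s, ‖y‖ ^ (-a) ≤ k) :
    powerMeasure d a s ≤ ENNReal.ofReal k * volume s := by
  rw [powerMeasure, withDensity_apply _ hs, ← setLIntegral_const]
  exact setLIntegral_mono' hs fun ρ hρ => ENNReal.ofReal_le_ofReal (h ρ hρ)

theorem const_mul_le_powerMeasure {d : ℕ} (hd : 1 ≤ d) {a k : ℝ}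
    {s : Set (EuclideanSpace ℝ (Fin d))}
    (hs : MeasurableSet s) (h : ∀ y ∈ s, y ≠ 0 → k ≤ ‖y‖ ^ (-a)) :
    ENNReal.ofReal k * volume s ≤ powerMeasure d a s := by
  have := nontrivial_euclidean hd
  rw [powerMeasure, withDensity_apply _ hs, ← setLIntegral_const]
  refine setLIntegral_mono_ae' hs ?_
  filter_upwards [compl_mem_ae_iff.2 (measure_singleton (0 : EuclideanSpace ℝ (Fin d)))] with y hy hys
  exact ENNReal.ofReal_le_ofReal (h y hys hy)

/-- At least half of a ball lies beyond the hyperplane through its center. -/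
theorem volume_closedBall_le_two_mul {d : ℕ} (x : EuclideanSpace ℝ (Fin d)) (r : ℝ) :
    volume (Metric.closedBall x r) ≤
      2 * volume (Metric.closedBall x r ∩ {y | ‖x‖ ^ 2 ≤ inner ℝ y x}) := by
  set H := Metric.closedBall x r ∩ {y | ‖x‖ ^ 2 ≤ inner ℝ y x}
  have hp := Measure.measurePreserving_sub_left (volume : Measure (EuclideanSpace ℝ (Fin d))) (x + x)
  have hH : MeasurableSet H := Metric.isClosed_closedBall.measurableSet.inter
    (measurableSet_le measurable_const (by fun_prop))
  have hsub : Metric.closedBall x r ⊆ H ∪ (fun y => x + x - y) ⁻¹' H := by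
    intro y hy
    rcases le_total (‖x‖ ^ 2) (inner ℝ y x) with h | h
    · exact .inl ⟨hy, h⟩
    · refine .inr ⟨?_, ?_⟩
      · rw [Metric.mem_closedBall, dist_eq_norm] at hy ⊢
        rw [show x + x - y - x = -(y - x) by abel, norm_neg]; exact hy
      · change ‖x‖ ^ 2 ≤ inner ℝ (x + x - y) x
        rw [inner_sub_left, inner_add_left, real_inner_self_eq_norm_sq]
        linarith
  calc volume (Metric.closedBall x r) ≤ volume H + volume ((fun y => x + x - y) ⁻¹' H) :=
        (measure_mono hsub).trans (measure_union_le _ _)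
    _ = 2 * volume H := by rw [hp.measure_preimage hH.nullMeasurableSet, two_mul]

/-- For `a ≤ 0` the weight grows with the norm, and `‖y‖ ≥ ‖x‖` on the half of the ball beyond its
center. -/
theorem volume_closedBall_le_powerMeasure_of_nonpos {d : ℕ} (hd : 1 ≤ d) {a : ℝ} (ha : a ≤ 0)
    {x : EuclideanSpace ℝ (Fin d)} (hx : x ≠ 0) {r' r : ℝ} (hr : r' ≤ r) :
    ENNReal.ofReal (‖x‖ ^ (-a)) * volume (Metric.closedBall x r') ≤
      2 * powerMeasure d a (Metric.closedBall x r) := by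
  have hR : 0 < ‖x‖ := norm_pos_iff.2 hx
  set H := Metric.closedBall x r' ∩ {y | ‖x‖ ^ 2 ≤ inner ℝ y x}
  have hH : MeasurableSet H := Metric.isClosed_closedBall.measurableSet.inter
    (measurableSet_le measurable_const (by fun_prop))
  calc ENNReal.ofReal (‖x‖ ^ (-a)) * volume (Metric.closedBall x r')
      ≤ ENNReal.ofReal (‖x‖ ^ (-a)) * (2 * volume H) := by
        gcongr; exact volume_closedBall_le_two_mul x r'
    _ = 2 * (ENNReal.ofReal (‖x‖ ^ (-a)) * volume H) := by ring
    _ ≤ 2 * powerMeasure d a H := by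
        gcongr
        refine const_mul_le_powerMeasure hd hH fun y hy _ => ?_
        have h1 : ‖x‖ ^ 2 ≤ inner ℝ y x := hy.2
        have h2 := real_inner_le_norm y x
        have h3 : ‖x‖ ≤ ‖y‖ := by nlinarith
        exact Real.rpow_le_rpow hR.le h3 (by linarith)
    _ ≤ 2 * powerMeasure d a (Metric.closedBall x r) := by
        gcongr
        exact Set.inter_subset_left.trans (Metric.closedBall_subset_closedBall hr)

theorem volume_closedBall_le_powerMeasure_of_nonneg {d : ℕ} (hd : 1 ≤ d) {a : ℝ} (ha : 0 ≤ a)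
    {x : EuclideanSpace ℝ (Fin d)} {r' r : ℝ} (hr : r' ≤ r)
    (hr' : r' ≤ ‖x‖) :
    ENNReal.ofReal ((2 * ‖x‖) ^ (-a)) * volume (Metric.closedBall x r') ≤
      powerMeasure d a (Metric.closedBall x r) := by
  refine (const_mul_le_powerMeasure hd Metric.isClosed_closedBall.measurableSet
    fun y hy hy0 => ?_).trans (measure_mono (Metric.closedBall_subset_closedBall hr))
  have h1 : ‖y‖ ≤ 2 * ‖x‖ := by
    have := norm_le_norm_add_norm_sub' y x
    rw [Metric.mem_closedBall, dist_eq_norm] at hy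
    linarith
  exact Real.rpow_le_rpow_of_nonpos (norm_pos_iff.2 hy0) h1 (by linarith)

theorem volume_closedBall_center {d : ℕ} (x y : EuclideanSpace ℝ (Fin d)) (r : ℝ) :
    volume (Metric.closedBall x r) = volume (Metric.closedBall y r) := by
  rw [Measure.addHaar_closedBall_center, Measure.addHaar_closedBall_center _ y]

/-- The constant depends on `d`, so this serves only finitely many dimensions. -/
theorem sphereMeasure_univ_le_mul_ball {d : ℕ}
    (e : Metric.sphere (0 : EuclideanSpace ℝ (Fin d)) 1) :
    sphereMeasure d Set.univ ≤
      (d / Measure.toSphereBallBound d (3 / 4) : ℝ≥0) * sphereMeasure d (Metric.ball e (3 / 4)) := by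
  have h := Measure.toSphereBallBound_mul_measure_unitBall_le_toSphere_ball
    (volume : Measure (EuclideanSpace ℝ (Fin d))) (show (0 : ℝ) < 3 / 4 by norm_num) e
  rw [finrank_euclideanSpace_fin] at h
  have hpos := Measure.toSphereBallBound_pos d (3 / 4)
  calc sphereMeasure d Set.univ = d * volume (Metric.ball (0 : EuclideanSpace ℝ (Fin d)) 1) := by
        rw [sphereMeasure, Measure.toSphere_apply_univ, finrank_euclideanSpace_fin]
    _ = (d / Measure.toSphereBallBound d (3 / 4) : ℝ≥0) * (Measure.toSphereBallBound d (3 / 4) *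
          volume (Metric.ball (0 : EuclideanSpace ℝ (Fin d)) 1)) := by
        rw [← mul_assoc, ← ENNReal.coe_mul, div_mul_cancel₀ _ hpos.ne']; simp
    _ ≤ _ := by gcongr; exact h

theorem inner_ge_of_mem_ball {d : ℕ} {ω e : EuclideanSpace ℝ (Fin d)} (hω : ‖ω‖ = 1)
    (he : ‖e‖ = 1) (h : dist ω e < 3 / 4) : 5 / 8 ≤ inner ℝ ω e := by
  rw [dist_eq_norm] at h
  have h1 := norm_sub_sq_real ω e
  rw [hω, he] at h1
  nlinarith [norm_nonneg (ω - e)]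

/-- A constant controlling the measure of a tangent cone by that of the ball. -/
def coneConst (A : ℝ) : ℝ≥0 :=
  2 + ((4 : ℝ) ^ A).toNNReal + ((A + 1) * 2 ^ A).toNNReal +
    ∑ n ∈ Finset.range (⌈A⌉₊ + 2), n / Measure.toSphereBallBound n (3 / 4)

/-- Directions of the rays meeting `closedBall x r`. -/
def coneDirections {d : ℕ} (x : EuclideanSpace ℝ (Fin d)) (r : ℝ) :
    Set (Metric.sphere (0 : EuclideanSpace ℝ (Fin d)) 1) :=
  {ω | r < ‖x‖ → tangentRadius x r ≤ inner ℝ ω.1 x}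

/-- Radii between the tangent radius and the norm of the center. -/
def tangentInterval {d : ℕ} (x : EuclideanSpace ℝ (Fin d)) (r : ℝ) : Set (Set.Ioi (0 : ℝ)) :=
  {ρ | tangentRadius x r ≤ ρ.1 ∧ ρ.1 ≤ ‖x‖}

theorem measurableSet_coneDirections {d : ℕ} (x : EuclideanSpace ℝ (Fin d)) (r : ℝ) :
    MeasurableSet (coneDirections x r) := by
  unfold coneDirections
  by_cases h : r < ‖x‖
  · simp only [h, forall_const]
    exact measurableSet_le measurable_const (by fun_prop)
  · simp [h]

theorem measurableSet_tangentInterval {d : ℕ} (x : EuclideanSpace ℝ (Fin d)) (r : ℝ) :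
    MeasurableSet (tangentInterval x r) :=
  (measurableSet_le measurable_const measurable_subtype_coe).inter
    (measurableSet_le measurable_subtype_coe measurable_const)

/-- The polar rectangle lies in a ball about another center, of radius `min r ‖x‖`, and Lebesgue
measure ignores the center. -/
theorem cone_mul_volume_le {d : ℕ} (hd : 1 ≤ d) {x : EuclideanSpace ℝ (Fin d)} (hx : x ≠ 0)
    {r : ℝ} (hr : 0 ≤ r) :
    sphereMeasure d (coneDirections x r) * radialMeasure d 0 (tangentInterval x r) ≤
      volume (Metric.closedBall x (min r ‖x‖)) := by
  rw [← volume_closedBall_center ((tangentRadius x r / ‖x‖) • x), ← powerMeasure_zero]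
  refine sphereMeasure_mul_radialMeasure_le hd 0 (measurableSet_coneDirections x r)
    (measurableSet_tangentInterval x r) Metric.isClosed_closedBall.measurableSet ?_
  intro ω hω ρ hρ
  exact smul_mem_closedBall_tangent (by simp) hx hr hω (le_of_lt ρ.2) hρ.2 (.inl hρ.1)

theorem cone_mul_volume_le' {d : ℕ} (hd : 1 ≤ d) {x : EuclideanSpace ℝ (Fin d)} (hx : x ≠ 0)
    {r : ℝ} (hr : 0 ≤ r) (h : tangentRadius x r ≤ ‖x‖ / 2) :
    sphereMeasure d (coneDirections x r) * radialMeasure d 0 {ρ | ρ.1 ≤ ‖x‖} ≤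
      volume (Metric.closedBall x (min r ‖x‖)) := by
  rw [← volume_closedBall_center ((tangentRadius x r / ‖x‖) • x), ← powerMeasure_zero]
  refine sphereMeasure_mul_radialMeasure_le hd 0 (measurableSet_coneDirections x r)
    (measurableSet_le measurable_subtype_coe measurable_const)
    Metric.isClosed_closedBall.measurableSet ?_
  intro ω hω ρ hρ
  exact smul_mem_closedBall_tangent (by simp) hx hr hω (le_of_lt ρ.2) hρ (.inr h)

theorem cone_mul_le_of_bound {d : ℕ} (hd : 1 ≤ d) {x : EuclideanSpace ℝ (Fin d)} (hx : x ≠ 0)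
    {r : ℝ} (hr : 0 ≤ r) {a k : ℝ} (hk : ∀ ρ ∈ tangentInterval x r, ρ.1 ^ (-a) ≤ k) :
    sphereMeasure d (coneDirections x r) * radialMeasure d a (tangentInterval x r) ≤
      ENNReal.ofReal k * volume (Metric.closedBall x (min r ‖x‖)) :=
  calc sphereMeasure d (coneDirections x r) * radialMeasure d a (tangentInterval x r)
      ≤ sphereMeasure d (coneDirections x r) *
          (ENNReal.ofReal k * radialMeasure d 0 (tangentInterval x r)) := by
        gcongr; exact radialMeasure_le_const_mul (measurableSet_tangentInterval x r) hk
    _ = ENNReal.ofReal k * (sphereMeasure d (coneDirections x r) *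
          radialMeasure d 0 (tangentInterval x r)) := by ring
    _ ≤ _ := by gcongr; exact cone_mul_volume_le hd hx hr

/-- The tangent cone truncated between the tangent radius and the norm of the center has measure
at most a constant times that of the ball. -/
theorem cone_mul_le {d : ℕ} (hd : 1 ≤ d) {A a : ℝ} (hA : 0 ≤ A) (ha : a ≤ A)
    {x : EuclideanSpace ℝ (Fin d)} (hx : x ≠ 0) {r : ℝ} (hr : 0 < r) :
    sphereMeasure d (coneDirections x r) * radialMeasure d a (tangentInterval x r) ≤
      coneConst A * powerMeasure d a (Metric.closedBall x r) := by
  have hR : 0 < ‖x‖ := norm_pos_iff.2 hx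
  -- The four summands of `coneConst` answer four cases. For `a ≤ 0` the weight on the cone piece is
  -- at most `‖x‖ ^ (-a)`, a value attained or exceeded on half of the ball.
  rcases le_or_gt a 0 with ha0 | ha0
  · calc _ ≤ ENNReal.ofReal (‖x‖ ^ (-a)) * volume (Metric.closedBall x (min r ‖x‖)) :=
          cone_mul_le_of_bound hd hx hr.le fun ρ hρ =>
            Real.rpow_le_rpow (le_of_lt ρ.2) hρ.2 (by linarith)
      _ ≤ 2 * powerMeasure d a (Metric.closedBall x r) :=
          volume_closedBall_le_powerMeasure_of_nonpos hd ha0 hx (min_le_left _ _)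
      _ ≤ _ := by
          gcongr
          rw [show (2 : ℝ≥0∞) = ((2 : ℝ≥0) : ℝ≥0∞) by simp]
          refine ENNReal.coe_le_coe.2 ?_
          rw [coneConst, add_assoc, add_assoc]; exact le_self_add
  have hlow := volume_closedBall_le_powerMeasure_of_nonneg hd ha0.le (x := x)
    (min_le_left r ‖x‖) (min_le_right r ‖x‖)
  -- Piece away from the origin: its weight is at most `(‖x‖ / 2) ^ (-a)`, that of the smaller ball
  -- at least `(2 ‖x‖) ^ (-a)`.
  rcases le_or_gt (‖x‖ / 2) (tangentRadius x r) with hc | hc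
  · calc _ ≤ ENNReal.ofReal ((‖x‖ / 2) ^ (-a)) * volume (Metric.closedBall x (min r ‖x‖)) :=
          cone_mul_le_of_bound hd hx hr.le fun ρ hρ =>
            Real.rpow_le_rpow_of_nonpos (by positivity) (hc.trans hρ.1) (by linarith)
      _ = ENNReal.ofReal (4 ^ a) * (ENNReal.ofReal ((2 * ‖x‖) ^ (-a)) *
            volume (Metric.closedBall x (min r ‖x‖))) := by
          rw [← mul_assoc, ← ENNReal.ofReal_mul (by positivity)]
          congr 2
          rw [show 2 * ‖x‖ = 4 * (‖x‖ / 2) by ring, Real.mul_rpow (by norm_num) (by positivity),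
            ← mul_assoc, ← Real.rpow_add (by norm_num)]
          simp
      _ ≤ ENNReal.ofReal (4 ^ a) * powerMeasure d a (Metric.closedBall x r) := by gcongr
      _ ≤ _ := by
          gcongr
          calc ENNReal.ofReal (4 ^ a) ≤ ENNReal.ofReal (4 ^ A) := by
                gcongr; norm_num
            _ ≤ _ := by
                refine ENNReal.coe_le_coe.2 ?_
                rw [coneConst, add_right_comm, add_assoc, add_right_comm]; exact le_add_self
  -- Piece near the origin, high dimension: extend the cone down to the origin, where the weight
  -- costs `d / (d - a) ≤ A + 1` relative to `‖x‖ ^ (-a)`.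
  rcases le_or_gt (A + 1) d with hdA | hdA
  · have had : a < d := by linarith
    have hsub : tangentInterval x r ⊆ {ρ | ρ.1 ≤ ‖x‖} := fun ρ hρ => hρ.2
    have hratio : radialMeasure d a {ρ | ρ.1 ≤ ‖x‖} ≤
        ENNReal.ofReal ((A + 1) * ‖x‖ ^ (-a)) * radialMeasure d 0 {ρ | ρ.1 ≤ ‖x‖} := by
      have hd0 : (0 : ℝ) < d := by exact_mod_cast hd
      rw [radialMeasure_Iic hd had hR.le, radialMeasure_Iic hd hd0 hR.le,
        ← ENNReal.ofReal_mul (by positivity)]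
      refine ENNReal.ofReal_le_ofReal ?_
      rw [sub_zero, sub_eq_add_neg (d : ℝ) a, Real.rpow_add hR]
      have h1 : 1 / ((d : ℝ) + -a) ≤ (A + 1) / d := by
        rw [div_le_div_iff₀ (by linarith) hd0]
        nlinarith
      calc ‖x‖ ^ (d : ℝ) * ‖x‖ ^ (-a) / (d + -a)
          = ‖x‖ ^ (d : ℝ) * ‖x‖ ^ (-a) * (1 / (d + -a)) := by ring
        _ ≤ ‖x‖ ^ (d : ℝ) * ‖x‖ ^ (-a) * ((A + 1) / d) := by gcongr
        _ = _ := by ring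
    calc sphereMeasure d (coneDirections x r) * radialMeasure d a (tangentInterval x r)
        ≤ sphereMeasure d (coneDirections x r) * (ENNReal.ofReal ((A + 1) * ‖x‖ ^ (-a)) *
            radialMeasure d 0 {ρ | ρ.1 ≤ ‖x‖}) := by
          gcongr; exact (measure_mono hsub).trans hratio
      _ = ENNReal.ofReal ((A + 1) * ‖x‖ ^ (-a)) * (sphereMeasure d (coneDirections x r) *
            radialMeasure d 0 {ρ | ρ.1 ≤ ‖x‖}) := by ring
      _ ≤ ENNReal.ofReal ((A + 1) * ‖x‖ ^ (-a)) * volume (Metric.closedBall x (min r ‖x‖)) := by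
          gcongr; exact cone_mul_volume_le' hd hx hr.le hc.le
      _ = ENNReal.ofReal ((A + 1) * 2 ^ a) * (ENNReal.ofReal ((2 * ‖x‖) ^ (-a)) *
            volume (Metric.closedBall x (min r ‖x‖))) := by
          rw [← mul_assoc, ← ENNReal.ofReal_mul (by positivity)]
          congr 2
          rw [Real.mul_rpow (by norm_num) (by positivity), mul_assoc,
            ← mul_assoc (2 ^ a), ← Real.rpow_add (by norm_num)]
          simp
      _ ≤ ENNReal.ofReal ((A + 1) * 2 ^ a) * powerMeasure d a (Metric.closedBall x r) := by gcongr
      _ ≤ _ := by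
          gcongr
          calc ENNReal.ofReal ((A + 1) * 2 ^ a) ≤ ENNReal.ofReal ((A + 1) * 2 ^ A) := by
                gcongr; norm_num
            _ ≤ _ := by
                refine ENNReal.coe_le_coe.2 ?_
                rw [coneConst, add_right_comm]; exact le_add_self
  -- Finitely many dimensions remain, with `a ≥ d` possible. A cap around `x / ‖x‖` is a fixed
  -- fraction of the sphere, and over it the whole radial interval lies in the ball.
  · set e : Metric.sphere (0 : EuclideanSpace ℝ (Fin d)) 1 :=
      ⟨(‖x‖⁻¹ : ℝ) • x, by simp [norm_smul, hR.ne']⟩ with he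
    have hball : sphereMeasure d (Metric.ball e (3 / 4)) * radialMeasure d a (tangentInterval x r) ≤
        powerMeasure d a (Metric.closedBall x r) := by
      refine sphereMeasure_mul_radialMeasure_le hd a Metric.isOpen_ball.measurableSet
        (measurableSet_tangentInterval x r) Metric.isClosed_closedBall.measurableSet ?_
      intro ω hω ρ hρ
      refine smul_mem_closedBall_of_inner (by simp) hr.le ?_ hc.le (le_of_lt ρ.2) hρ.1 hρ.2
      have h1 : 5 / 8 ≤ inner ℝ ω.1 e.1 := inner_ge_of_mem_ball (by simp) (by simp) hω
      have h2 : inner ℝ ω.1 e.1 = ‖x‖⁻¹ * inner ℝ ω.1 x := by rw [he]; simp [inner_smul_right]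
      rw [h2, inv_mul_eq_div, le_div_iff₀ hR] at h1
      exact h1
    calc sphereMeasure d (coneDirections x r) * radialMeasure d a (tangentInterval x r)
        ≤ ((d / Measure.toSphereBallBound d (3 / 4) : ℝ≥0) *
            sphereMeasure d (Metric.ball e (3 / 4))) * radialMeasure d a (tangentInterval x r) := by
          gcongr
          exact (measure_mono (Set.subset_univ _)).trans (sphereMeasure_univ_le_mul_ball e)
      _ = (d / Measure.toSphereBallBound d (3 / 4) : ℝ≥0) *
            (sphereMeasure d (Metric.ball e (3 / 4)) *
              radialMeasure d a (tangentInterval x r)) := by ring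
      _ ≤ (d / Measure.toSphereBallBound d (3 / 4) : ℝ≥0) *
            powerMeasure d a (Metric.closedBall x r) := by gcongr
      _ ≤ _ := by
          gcongr
          have hmem : d ∈ Finset.range (⌈A⌉₊ + 2) := by
            rw [Finset.mem_range]
            have : (d : ℝ) < (⌈A⌉₊ + 1 : ℕ) := by
              push_cast; linarith [Nat.le_ceil A]
            have : d < ⌈A⌉₊ + 1 := by exact_mod_cast this
            omega
          rw [coneConst]
          exact (Finset.single_le_sum (f := fun n : ℕ => (n : ℝ≥0) /
            Measure.toSphereBallBound n (3 / 4)) (fun _ _ => zero_le) hmem).trans le_add_self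

/-! ### Domination by the one-dimensional maximal function, and the upper bounds. -/

/-- The average of a radial function over a ball is controlled by the one-dimensional uncentered
maximal function at the norm of the center. -/
theorem setLIntegral_closedBall_le {d : ℕ} (hd : 1 ≤ d) {A a : ℝ} (hA : 0 ≤ A) (ha : a ≤ A)
    {G : ℝ → ℝ≥0∞} (hG : Measurable G) (x : EuclideanSpace ℝ (Fin d)) (hx : x ≠ 0)
    {r : ℝ} (hr : 0 < r) (hfin : powerMeasure d a (Metric.closedBall x r) ≠ ∞) :
    ∫⁻ y in Metric.closedBall x r, G ‖y‖ ∂powerMeasure d a ≤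
      intervalMaximal (radialMeasure d a) ((radialMeasure d a).withDensity fun ρ => G ρ.1)
        ⟨‖x‖, norm_pos_iff.2 hx⟩ *
        ((1 + coneConst A : ℝ≥0) * powerMeasure d a (Metric.closedBall x r)) := by
  have hBm : MeasurableSet (Metric.closedBall x r) := Metric.isClosed_closedBall.measurableSet
  set N := intervalMaximal (radialMeasure d a) ((radialMeasure d a).withDensity fun ρ => G ρ.1)
        ⟨‖x‖, norm_pos_iff.2 hx⟩ with hN
  set I : Metric.sphere (0 : EuclideanSpace ℝ (Fin d)) 1 → Set (Set.Ioi (0 : ℝ)) :=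
    fun ω => {ρ | ρ.1 • ω.1 ∈ Metric.closedBall x r} with hI
  have hIm : ∀ ω, MeasurableSet (I ω) := fun ω => by
    have : Measurable fun ρ : Set.Ioi (0 : ℝ) => ρ.1 • ω.1 := by fun_prop
    exact this hBm
  have hS := measurableSet_coneDirections x r
  set L := tangentInterval x r with hL
  have hLm : MeasurableSet L := measurableSet_tangentInterval x r
  have hcone := cone_mul_le hd hA ha hx hr
  have hpolar : ∀ H : ℝ → ℝ≥0∞, Measurable H →
      ∫⁻ y in Metric.closedBall x r, H ‖y‖ ∂powerMeasure d a =
        ∫⁻ ω, ∫⁻ ρ in I ω, H ρ.1 ∂radialMeasure d a ∂sphereMeasure d := by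
    intro H hH
    rw [← lintegral_indicator hBm, lintegral_powerMeasure_polar hd a
      (show Measurable ((Metric.closedBall x r).indicator fun y => H ‖y‖) from
        (hH.comp measurable_norm).indicator hBm)]
    refine lintegral_congr fun ω => ?_
    rw [← lintegral_indicator (hIm ω)]
    refine lintegral_congr fun ρ => ?_
    by_cases h : ρ.1 • ω.1 ∈ Metric.closedBall x r
    · rw [Set.indicator_of_mem h, Set.indicator_of_mem (show ρ ∈ I ω from h), norm_smul_sphere]
    · rw [Set.indicator_of_notMem h, Set.indicator_of_notMem (show ρ ∉ I ω from h)]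
  have hvol : ∫⁻ ω, radialMeasure d a (I ω) ∂sphereMeasure d =
      powerMeasure d a (Metric.closedBall x r) := by
    have := hpolar (fun _ => 1) measurable_const
    simpa using this.symm
  have hmI : Measurable fun ω => radialMeasure d a (I ω) := by
    have hm : Measurable fun q : Metric.sphere (0 : EuclideanSpace ℝ (Fin d)) 1 × Set.Ioi (0 : ℝ) =>
        q.2.1 • q.1.1 := by fun_prop
    exact measurable_measure_prodMk_left (hm hBm)
  -- `T ω` bounds the measure of the enlarged chord in direction `ω`; its integral is the measure of
  -- the ball plus that of the cone piece.
  set T : Metric.sphere (0 : EuclideanSpace ℝ (Fin d)) 1 → ℝ≥0∞ := fun ω =>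
    radialMeasure d a (I ω) + (coneDirections x r).indicator (fun _ => radialMeasure d a L) ω with hT
  have hTint : ∫⁻ ω, T ω ∂sphereMeasure d ≤
      (1 + coneConst A : ℝ≥0) * powerMeasure d a (Metric.closedBall x r) := by
    rw [hT, lintegral_add_left hmI, hvol, lintegral_indicator hS, setLIntegral_const,
      ENNReal.coe_add, add_mul, ENNReal.coe_one, one_mul, mul_comm (radialMeasure d a L)]
    gcongr
  have hTm : Measurable T := hmI.add (measurable_const.indicator hS)
  -- Intervals of infinite measure are invisible to `intervalMaximal`; a ball of finite measure has
  -- almost no such enlarged chords.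
  have hTfin : ∀ᵐ ω ∂sphereMeasure d, T ω < ∞ := by
    refine ae_lt_top hTm (ne_of_lt (hTint.trans_lt ?_))
    exact ENNReal.mul_lt_top ENNReal.coe_lt_top hfin.lt_top
  rw [hpolar G hG]
  calc ∫⁻ ω, ∫⁻ ρ in I ω, G ρ.1 ∂radialMeasure d a ∂sphereMeasure d
      ≤ ∫⁻ ω, N * T ω ∂sphereMeasure d := by
        refine lintegral_mono_ae ?_
        filter_upwards [hTfin] with ω hω
        by_cases hωS : ω ∈ coneDirections x r
        · have hTω : T ω = radialMeasure d a (I ω) + radialMeasure d a L := by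
            simp [hT, Set.indicator_of_mem hωS]
          have hle : radialMeasure d a (I ω ∪ L) ≤ T ω := hTω ▸ measure_union_le _ _
          calc ∫⁻ ρ in I ω, G ρ.1 ∂radialMeasure d a
              ≤ ∫⁻ ρ in I ω ∪ L, G ρ.1 ∂radialMeasure d a :=
                lintegral_mono_set Set.subset_union_left
            _ ≤ N * radialMeasure d a (I ω ∪ L) := by
                refine setLIntegral_le_intervalMaximal_mul (radialMeasure d a)
                  (fun ρ => G ρ.1) ?_ ?_ (ne_of_lt (hle.trans_lt hω))
                · exact ordConnected_chord_union (by simp) hr.le hωS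
                · exact .inr ⟨tangentRadius_le x r, le_rfl⟩
            _ ≤ N * T ω := by gcongr
        · have : I ω = ∅ := by
            simp only [coneDirections, Set.mem_ofPred_eq, Classical.not_imp, not_le] at hωS
            refine Set.eq_empty_of_forall_notMem fun ρ => ?_
            exact not_mem_closedBall_of_inner_lt (by simp) hr.le hωS.1 hωS.2 ρ.2
          simp [this]
    _ = N * ∫⁻ ω, T ω ∂sphereMeasure d := lintegral_const_mul _ hTm
    _ ≤ _ := by gcongr

theorem centeredMaximal_le {d : ℕ} (hd : 1 ≤ d) {A a : ℝ} (hA : 0 ≤ A) (ha : a ≤ A)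
    {f : EuclideanSpace ℝ (Fin d) → ℝ} {G : ℝ → ℝ≥0} (hG : Measurable G)
    (hfG : ∀ᵐ y ∂powerMeasure d a, ‖f y‖ₑ = G ‖y‖)
    (x : EuclideanSpace ℝ (Fin d)) (hx : x ≠ 0) :
    centeredMaximal (powerMeasure d a) f x ≤ (1 + coneConst A : ℝ≥0) *
      intervalMaximal (radialMeasure d a)
        ((radialMeasure d a).withDensity fun ρ => (G ρ.1 : ℝ≥0∞)) ⟨‖x‖, norm_pos_iff.2 hx⟩ := by
  refine iSup_le fun r => iSup_le fun hr => iSup_le fun hpos => ?_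
  by_cases hfin : powerMeasure d a (Metric.closedBall x r) = ∞
  · rw [hfin, ENNReal.div_top]; exact zero_le
  rw [setLIntegral_congr_fun_ae Metric.isClosed_closedBall.measurableSet
    (hfG.mono fun y hy _ => hy)]
  refine ENNReal.div_le_of_le_mul ((setLIntegral_closedBall_le hd hA ha
    hG.coe_nnreal_ennreal x hx hr hfin).trans_eq ?_)
  ring

/-- Extension by zero of a function on `(0, ∞)`. -/
def extendZero (H : Set.Ioi (0 : ℝ) → ℝ≥0∞) (t : ℝ) : ℝ≥0∞ :=
  if h : t ∈ Set.Ioi (0 : ℝ) then H ⟨t, h⟩ else 0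

theorem measurable_extendZero {H : Set.Ioi (0 : ℝ) → ℝ≥0∞} (hH : Measurable H) :
    Measurable (extendZero H) :=
  Measurable.dite hH measurable_const measurableSet_Ioi

theorem extendZero_coe (H : Set.Ioi (0 : ℝ) → ℝ≥0∞) (ρ : Set.Ioi (0 : ℝ)) :
    extendZero H ρ.1 = H ρ := dif_pos ρ.2

theorem extendZero_norm {d : ℕ} (H : Set.Ioi (0 : ℝ) → ℝ≥0∞) {x : EuclideanSpace ℝ (Fin d)}
    (hx : x ≠ 0) : extendZero H ‖x‖ = H ⟨‖x‖, norm_pos_iff.2 hx⟩ := dif_pos (norm_pos_iff.2 hx)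

theorem lintegral_extendZero_norm {d : ℕ} (hd : 1 ≤ d) (a : ℝ)
    {H : Set.Ioi (0 : ℝ) → ℝ≥0∞} (hH : Measurable H) :
    ∫⁻ y, extendZero H ‖y‖ ∂powerMeasure d a =
      sphereMeasure d Set.univ * ∫⁻ ρ, H ρ ∂radialMeasure d a := by
  rw [lintegral_norm_powerMeasure hd a (measurable_extendZero hH)]
  simp_rw [extendZero_coe]

theorem powerMeasure_singleton_zero {d : ℕ} (hd : 1 ≤ d) (a : ℝ) :
    powerMeasure d a {0} = 0 := by
  have := nontrivial_euclidean hd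
  exact powerMeasure_absolutelyContinuous d a (measure_singleton 0)

theorem ae_ne_zero_powerMeasure {d : ℕ} (hd : 1 ≤ d) (a : ℝ) :
    ∀ᵐ y ∂powerMeasure d a, y ≠ 0 :=
  compl_mem_ae_iff.2 (powerMeasure_singleton_zero hd a)

theorem radialWeakConst_one_le {d : ℕ} (hd : 1 ≤ d) {A a : ℝ} (hA : 0 ≤ A) (ha : a ≤ A) :
    radialWeakConst 1 (powerMeasure d a) ≤ (4 * (1 + coneConst A) : ℝ≥0) := by
  refine sInf_le fun f hf hfL t ht => ?_
  obtain ⟨G, hG, hfG⟩ := hf.exists_measurable hd a hfL.1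
  set K : ℝ≥0 := 1 + coneConst A with hK
  have hK0 : 0 < K := by rw [hK]; positivity
  set m := radialMeasure d a
  set N := intervalMaximal m (m.withDensity fun ρ => (G ρ.1 : ℝ≥0∞)) with hN
  have hNm : Measurable N := measurable_intervalMaximal _ _
  -- The extra `2` turns the level condition `≥ t` into the strict one `> s` of the weak bound for
  -- `N`.
  set s : ℝ≥0 := t / (2 * K) with hs
  have hsK : s * (2 * K) = t := div_mul_cancel₀ _ (by positivity)
  have hms : MeasurableSet {ρ | (s : ℝ≥0∞) < N ρ} := measurableSet_lt measurable_const hNm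
  have hH : Measurable ({ρ | (s : ℝ≥0∞) < N ρ}.indicator fun _ => (1 : ℝ≥0∞)) :=
    measurable_const.indicator hms
  have hnorm : eLpNorm f 1 (powerMeasure d a) =
      sphereMeasure d Set.univ * ∫⁻ ρ, (G ρ.1 : ℝ≥0∞) ∂m := by
    rw [eLpNorm_one_eq_lintegral_enorm, lintegral_congr_ae hfG,
      lintegral_norm_powerMeasure hd a hG.coe_nnreal_ennreal]
  have h1 : powerMeasure d a {x | (t : ℝ≥0∞) ≤ centeredMaximal (powerMeasure d a) f x} ≤
      sphereMeasure d Set.univ * m {ρ | (s : ℝ≥0∞) < N ρ} := by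
    set h : EuclideanSpace ℝ (Fin d) → ℝ≥0∞ := fun x =>
      extendZero ({ρ | (s : ℝ≥0∞) < N ρ}.indicator fun _ => (1 : ℝ≥0∞)) ‖x‖ with hh
    have hhm : Measurable h := (measurable_extendZero hH).comp measurable_norm
    have hsub : {x | (t : ℝ≥0∞) ≤ centeredMaximal (powerMeasure d a) f x} ≤ᵐ[powerMeasure d a]
        {x | 1 ≤ h x} := by
      filter_upwards [ae_ne_zero_powerMeasure hd a] with x hx
      intro hxt
      have hle := le_trans (show (t : ℝ≥0∞) ≤ centeredMaximal (powerMeasure d a) f x from hxt)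
        (centeredMaximal_le hd hA ha hG hfG x hx)
      have hlt : (s : ℝ≥0∞) < N ⟨‖x‖, norm_pos_iff.2 hx⟩ := by
        by_contra! hcon
        have : (t : ℝ≥0∞) ≤ (K * s : ℝ≥0) := hle.trans (by
          rw [ENNReal.coe_mul]; gcongr)
        have h2 : t ≤ K * s := ENNReal.coe_le_coe.1 this
        rw [← hsK] at h2
        have h3 : 0 < s := by rw [hs]; positivity
        have h4 : K * s < s * (2 * K) := by
          rw [show s * (2 * K) = K * s + K * s by ring]
          exact lt_add_of_pos_right _ (by positivity)
        exact absurd h2 (not_le.2 h4)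
      change 1 ≤ h x
      rw [hh]
      simp only
      rw [extendZero_norm _ hx, Set.indicator_of_mem
        (show (⟨‖x‖, norm_pos_iff.2 hx⟩ : Set.Ioi (0 : ℝ)) ∈ {ρ | (s : ℝ≥0∞) < N ρ} from hlt)]
    calc _ ≤ powerMeasure d a {x | 1 ≤ h x} := measure_mono_ae hsub
      _ ≤ ∫⁻ x, h x ∂powerMeasure d a := by
          simpa using mul_meas_ge_le_lintegral hhm 1
      _ = _ := by
          rw [hh, lintegral_extendZero_norm hd a hH, lintegral_indicator_const hms, one_mul]
  have h2 : (s : ℝ≥0∞) * m {ρ | (s : ℝ≥0∞) < N ρ} ≤ 2 * ∫⁻ ρ, (G ρ.1 : ℝ≥0∞) ∂m := by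
    simpa using mul_measure_lt_intervalMaximal_le m (m.withDensity fun ρ => (G ρ.1 : ℝ≥0∞)) s
  simp only [NNReal.coe_one, div_one, ENNReal.rpow_one, ENNReal.coe_one]
  calc (t : ℝ≥0∞) * powerMeasure d a {x | (t : ℝ≥0∞) ≤ centeredMaximal (powerMeasure d a) f x}
      ≤ (s * (2 * K) : ℝ≥0) * (sphereMeasure d Set.univ * m {ρ | (s : ℝ≥0∞) < N ρ}) := by
        rw [hsK]; gcongr
    _ = 2 * K * sphereMeasure d Set.univ * (s * m {ρ | (s : ℝ≥0∞) < N ρ}) := by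
        push_cast; ring
    _ ≤ 2 * K * sphereMeasure d Set.univ * (2 * ∫⁻ ρ, (G ρ.1 : ℝ≥0∞) ∂m) := by gcongr
    _ = _ := by rw [hnorm]; push_cast; ring

/-- The constant in the strong type bound for the one-dimensional maximal function. -/
def intervalStrongConst (p : ℝ) : ℝ≥0 := (p * (4 * 2 ^ (p - 1) / (p - 1))).toNNReal

theorem radialStrongConst_le {d : ℕ} (hd : 1 ≤ d) {A a : ℝ} (hA : 0 ≤ A) (ha : a ≤ A)
    {p : ℝ≥0} (hp : 1 < p) :
    radialStrongConst p (powerMeasure d a) ≤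
      ((1 + coneConst A) * intervalStrongConst p ^ (1 / (p : ℝ)) : ℝ≥0) := by
  refine sInf_le fun f hf hfL => ?_
  obtain ⟨G, hG, hfG⟩ := hf.exists_measurable hd a hfL.1
  set K : ℝ≥0 := 1 + coneConst A with hK
  set m := radialMeasure d a
  set N := intervalMaximal m (m.withDensity fun ρ => (G ρ.1 : ℝ≥0∞)) with hN
  have hNm : Measurable N := measurable_intervalMaximal _ _
  have hp1 : (1 : ℝ) < p := by exact_mod_cast hp
  have hp0 : (0 : ℝ) < p := by linarith
  have hpe : (p : ℝ≥0∞) ≠ 0 := by exact_mod_cast (zero_lt_one.trans hp).ne'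
  rw [eLpNorm_eq_lintegral_rpow_enorm_toReal hpe ENNReal.coe_ne_top,
    eLpNorm_eq_lintegral_rpow_enorm_toReal hpe ENNReal.coe_ne_top, ENNReal.coe_toReal]
  have hf' : ∫⁻ y, ‖f y‖ₑ ^ (p : ℝ) ∂powerMeasure d a =
      sphereMeasure d Set.univ * ∫⁻ ρ, (G ρ.1 : ℝ≥0∞) ^ (p : ℝ) ∂m := by
    rw [← lintegral_norm_powerMeasure hd a (hG.coe_nnreal_ennreal.pow_const (p : ℝ))]
    refine lintegral_congr_ae ?_
    filter_upwards [hfG] with y hy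
    rw [hy]
  have hM : ∫⁻ y, ‖centeredMaximal (powerMeasure d a) f y‖ₑ ^ (p : ℝ) ∂powerMeasure d a ≤
      (K : ℝ≥0∞) ^ (p : ℝ) * (sphereMeasure d Set.univ * ∫⁻ ρ, N ρ ^ (p : ℝ) ∂m) := by
    rw [← lintegral_extendZero_norm hd a (hNm.pow_const (p : ℝ)), ← lintegral_const_mul']
    · refine lintegral_mono_ae ?_
      filter_upwards [ae_ne_zero_powerMeasure hd a] with x hx
      rw [extendZero_norm _ hx, ← ENNReal.mul_rpow_of_nonneg _ _ hp0.le, enorm_eq_self]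
      exact ENNReal.rpow_le_rpow (centeredMaximal_le hd hA ha hG hfG x hx) hp0.le
    · exact ENNReal.rpow_ne_top_of_nonneg hp0.le ENNReal.coe_ne_top
  have hS := lintegral_intervalMaximal_rpow_le m (fun ρ => G ρ.1)
    (hG.comp measurable_subtype_coe) hp1
  calc _ ≤ ((K : ℝ≥0∞) ^ (p : ℝ) * (sphereMeasure d Set.univ *
          (intervalStrongConst p * ∫⁻ ρ, (G ρ.1 : ℝ≥0∞) ^ (p : ℝ) ∂m))) ^ (1 / (p : ℝ)) := by
        gcongr
        exact hM.trans (by gcongr; exact hS)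
    _ = ((K : ℝ≥0∞) ^ (p : ℝ) * intervalStrongConst p *
          ∫⁻ y, ‖f y‖ₑ ^ (p : ℝ) ∂powerMeasure d a) ^ (1 / (p : ℝ)) := by
        rw [hf']; congr 1; ring
    _ = _ := by
        rw [ENNReal.mul_rpow_of_nonneg _ _ (by positivity),
          ENNReal.mul_rpow_of_nonneg _ _ (by positivity), ← ENNReal.rpow_mul,
          mul_one_div_cancel hp0.ne', ENNReal.rpow_one, ENNReal.coe_mul,
          ENNReal.coe_rpow_of_nonneg _ (by positivity)]

/-! ### Lower bound for the weak type `(1, 1)` constant when `a ≤ d / 2`. -/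

theorem le_radialWeakConst {d : ℕ} {p : ℝ≥0} {μ : Measure (EuclideanSpace ℝ (Fin d))}
    {f : EuclideanSpace ℝ (Fin d) → ℝ} (hf : IsRadialFun f) (hL : MemLp f p μ)
    (h0 : eLpNorm f p μ ≠ 0) {t : ℝ≥0} (ht : 0 < t) {k : ℝ≥0∞}
    (h : k * eLpNorm f p μ ≤
      t * μ {x | (t : ℝ≥0∞) ≤ centeredMaximal μ f x} ^ (1 / (p : ℝ))) :
    k ≤ radialWeakConst p μ := by
  refine le_sInf fun c hc => ?_
  exact (ENNReal.mul_le_mul_iff_left h0 hL.2.ne).1 (h.trans (hc f hf hL t ht))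

theorem le_centeredMaximal {d : ℕ} {μ : Measure (EuclideanSpace ℝ (Fin d))}
    {f : EuclideanSpace ℝ (Fin d) → ℝ} {x : EuclideanSpace ℝ (Fin d)} {r : ℝ} (hr : 0 < r)
    (hpos : 0 < μ (Metric.closedBall x r)) :
    (∫⁻ y in Metric.closedBall x r, ‖f y‖ₑ ∂μ) / μ (Metric.closedBall x r) ≤
      centeredMaximal μ f x :=
  le_iSup_of_le r (le_iSup_of_le hr (le_iSup_of_le hpos le_rfl))

theorem volume_absolutelyContinuous_powerMeasure {d : ℕ} (hd : 1 ≤ d) (a : ℝ) :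
    volume ≪ powerMeasure d a := by
  have := nontrivial_euclidean hd
  refine withDensity_absolutelyContinuous' (by fun_prop) ?_
  filter_upwards [compl_mem_ae_iff.2 (measure_singleton (0 : EuclideanSpace ℝ (Fin d)))] with y hy
  have : 0 < ‖y‖ := norm_pos_iff.2 hy
  simp only [ne_eq, ENNReal.ofReal_eq_zero, not_le]
  positivity

theorem powerMeasure_closedBall_pos {d : ℕ} (hd : 1 ≤ d) (a : ℝ) (x : EuclideanSpace ℝ (Fin d))
    {r : ℝ} (hr : 0 < r) : 0 < powerMeasure d a (Metric.closedBall x r) := by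
  refine pos_iff_ne_zero.2 fun h => ?_
  exact (Metric.measure_closedBall_pos volume x hr).ne'
    (volume_absolutelyContinuous_powerMeasure hd a h)

theorem powerMeasure_closedBall_zero_lt_top {d : ℕ} (hd : 1 ≤ d) {a : ℝ} (ha : a < d) {R : ℝ}
    (hR : 0 ≤ R) : powerMeasure d a (Metric.closedBall 0 R) < ∞ := by
  rw [powerMeasure_closedBall_zero hd ha hR]
  exact ENNReal.mul_lt_top (measure_lt_top _ _) ENNReal.ofReal_lt_top

theorem powerMeasure_closedBall_zero_eq_rpow_mul {d : ℕ} (hd : 1 ≤ d) {a : ℝ} (ha : a < d) {R : ℝ}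
    (hR : 0 ≤ R) : powerMeasure d a (Metric.closedBall 0 R) =
      ENNReal.ofReal (R ^ ((d : ℝ) - a)) * powerMeasure d a (Metric.closedBall 0 1) := by
  rw [powerMeasure_closedBall_zero hd ha hR, powerMeasure_closedBall_zero hd ha zero_le_one,
    Real.one_rpow, div_eq_mul_one_div, ENNReal.ofReal_mul (by positivity)]
  ring

/-- The measures with decreasing density are largest on centered balls. -/
theorem powerMeasure_closedBall_le_center {d : ℕ} (hd : 1 ≤ d) {a : ℝ} (ha : 0 ≤ a)
    (c : EuclideanSpace ℝ (Fin d)) {ρ : ℝ} (hρ : 0 < ρ) :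
    powerMeasure d a (Metric.closedBall c ρ) ≤ powerMeasure d a (Metric.closedBall 0 ρ) := by
  set B := Metric.closedBall c ρ
  set B₀ := Metric.closedBall (0 : EuclideanSpace ℝ (Fin d)) ρ
  have hB : MeasurableSet B := Metric.isClosed_closedBall.measurableSet
  have hB₀ : MeasurableSet B₀ := Metric.isClosed_closedBall.measurableSet
  -- The two differences have equal volume, and the weight is at least `ρ ^ (-a)` inside `B₀` and at
  -- most that outside.
  have hvol : volume (B \ B₀) = volume (B₀ \ B) := by
    have h1 := measure_inter_add_sdiff B hB₀ (μ := volume)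
    have h2 := measure_inter_add_sdiff B₀ hB (μ := volume)
    rw [Set.inter_comm, ← volume_closedBall_center c 0, ← h1] at h2
    refine ((ENNReal.add_right_inj (ne_of_lt ?_)).1 h2).symm
    exact (measure_mono Set.inter_subset_left).trans_lt measure_closedBall_lt_top
  have hle : powerMeasure d a (B \ B₀) ≤ powerMeasure d a (B₀ \ B) :=
    calc powerMeasure d a (B \ B₀) ≤ ENNReal.ofReal (ρ ^ (-a)) * volume (B \ B₀) := by
          refine powerMeasure_le_const_mul (hB.diff hB₀) fun y hy => ?_
          have : ρ ≤ ‖y‖ := by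
            have := hy.2
            rw [mem_closedBall_zero_iff] at this
            exact (not_le.1 this).le
          exact Real.rpow_le_rpow_of_nonpos hρ this (by linarith)
      _ = ENNReal.ofReal (ρ ^ (-a)) * volume (B₀ \ B) := by rw [hvol]
      _ ≤ _ := by
          refine const_mul_le_powerMeasure hd (hB₀.diff hB) fun y hy hy0 => ?_
          exact Real.rpow_le_rpow_of_nonpos (norm_pos_iff.2 hy0)
            (mem_closedBall_zero_iff.1 hy.1) (by linarith)
  calc powerMeasure d a B = powerMeasure d a (B ∩ B₀) + powerMeasure d a (B \ B₀) :=
        (measure_inter_add_sdiff B hB₀).symm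
    _ ≤ powerMeasure d a (B₀ ∩ B) + powerMeasure d a (B₀ \ B) := by
        rw [Set.inter_comm]; gcongr
    _ = _ := measure_inter_add_sdiff B₀ hB

theorem volume_closedBall_eq {d : ℕ} (c : EuclideanSpace ℝ (Fin d)) {ρ : ℝ} (hρ : 0 ≤ ρ) :
    volume (Metric.closedBall c ρ) =
      ENNReal.ofReal (ρ ^ d) * volume (Metric.closedBall (0 : EuclideanSpace ℝ (Fin d)) 1) := by
  rw [Measure.addHaar_closedBall _ _ hρ, finrank_euclideanSpace_fin,
    Measure.addHaar_closedBall _ (0 : EuclideanSpace ℝ (Fin d)) zero_le_one]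
  simp

theorem volume_unit_closedBall_le {d : ℕ} (hd : 1 ≤ d) {a : ℝ} (ha : 0 ≤ a) :
    volume (Metric.closedBall (0 : EuclideanSpace ℝ (Fin d)) 1) ≤
      powerMeasure d a (Metric.closedBall 0 1) := by
  have := const_mul_le_powerMeasure hd (a := a) (k := 1)
    (s := Metric.closedBall (0 : EuclideanSpace ℝ (Fin d)) 1)
    Metric.isClosed_closedBall.measurableSet fun y hy hy0 =>
      Real.one_le_rpow_of_pos_of_le_one_of_nonpos (norm_pos_iff.2 hy0)
        (mem_closedBall_zero_iff.1 hy) (by linarith)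
  simpa using this

theorem norm_sub_smul_sq {E : Type*} [NormedAddCommGroup E] [InnerProductSpace ℝ E] {u : E}
    (hu : ‖u‖ = 1) (y : E) (c : ℝ) :
    ‖y - c • u‖ ^ 2 = ‖y‖ ^ 2 - 2 * c * inner ℝ y u + c ^ 2 := by
  rw [norm_sub_sq_real, norm_smul, inner_smul_right, hu, mul_one, Real.norm_eq_abs, sq_abs]
  ring

/-- A ball slightly larger than the unit ball, centered on the unit sphere, is exponentially small
compared with the centered unit ball. -/
theorem powerMeasure_closedBall_unit_le {d : ℕ} (hd : 1 ≤ d) {a : ℝ} (ha : 0 ≤ a)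
    (had : a ≤ d / 2) {u : EuclideanSpace ℝ (Fin d)} (hu : ‖u‖ = 1) {q δ : ℝ} (hq : 0 < q)
    (hq2 : q ^ 2 = 4 / 5) (hδ : 0 ≤ δ) (hδ' : δ ≤ 1 / 100) (hδd : (1 + δ) ^ d ≤ 2) :
    powerMeasure d a (Metric.closedBall u (1 + δ)) ≤
      ENNReal.ofReal (4 * q ^ a) * powerMeasure d a (Metric.closedBall 0 1) := by
  have hd0 : (1 : ℝ) ≤ d := by exact_mod_cast hd
  have had' : a < d := by linarith
  have hq1 : q ≤ 1 := by nlinarith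
  have hq89 : 0.89 ≤ q := by nlinarith
  set M₁ := powerMeasure d a (Metric.closedBall 0 1) with hM₁
  set B := Metric.closedBall u (1 + δ) with hB
  have hBm : MeasurableSet B := Metric.isClosed_closedBall.measurableSet
  have hBy : ∀ y ∈ B, ‖y‖ ^ 2 - 2 * inner ℝ y u ≤ 3 / 100 := by
    intro y hy
    have h1 := (mem_closedBall_iff_sq (by linarith)).1 hy
    have h2 := norm_sub_smul_sq hu y 1
    rw [one_smul] at h2
    nlinarith
  have hV := volume_unit_closedBall_le hd ha
  -- Cut at the radii `1` and `q⁻¹ = √5 / 2`; each piece is a constant times `q ^ a` relative to the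
  -- unit ball.
  set P₁ := B ∩ {y | ‖y‖ ≤ 1}
  set P₂ := B ∩ {y | 1 ≤ ‖y‖ ∧ ‖y‖ ≤ q⁻¹}
  set P₃ := B ∩ {y | q⁻¹ ≤ ‖y‖}
  have hP₂m : MeasurableSet P₂ := hBm.inter
    ((measurableSet_le measurable_const measurable_norm).inter
      (measurableSet_le measurable_norm measurable_const))
  have hP₃m : MeasurableSet P₃ := hBm.inter (measurableSet_le measurable_const measurable_norm)
  -- By `hBy`, `‖y - u / 2‖² ≤ ‖y‖² / 2 + 3 / 200 + 1 / 4 < 4 / 5 = q²`. Moving the ball to the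
  -- origin only increases its measure, and `d - a ≥ a`.
  have h1 : powerMeasure d a P₁ ≤ ENNReal.ofReal (q ^ a) * M₁ :=
    calc powerMeasure d a P₁ ≤ powerMeasure d a (Metric.closedBall ((1 / 2 : ℝ) • u) q) := by
          refine measure_mono fun y hy => ?_
          rw [mem_closedBall_iff_sq hq.le, norm_sub_smul_sq hu, hq2]
          have := hBy y hy.1
          have hy2 : ‖y‖ ≤ 1 := hy.2
          nlinarith [norm_nonneg y]
      _ ≤ powerMeasure d a (Metric.closedBall 0 q) := powerMeasure_closedBall_le_center hd ha _ hq
      _ = ENNReal.ofReal (q ^ ((d : ℝ) - a)) * M₁ :=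
          powerMeasure_closedBall_zero_eq_rpow_mul hd had' hq.le
      _ ≤ _ := by
          gcongr ENNReal.ofReal ?_ * _
          exact Real.rpow_le_rpow_of_exponent_ge hq hq1 (by linarith)
  -- Here the weight is at most `1`. By `hBy`, `‖y - 5 u / 8‖² ≤ 3 ‖y‖² / 8 + 3 / 160 + 25 / 64 <
  -- 0.89 ≤ q`, so the relative volume is at most `q ^ (d / 2) ≤ q ^ a`.
  have h2 : powerMeasure d a P₂ ≤ ENNReal.ofReal (q ^ a) * M₁ :=
    calc powerMeasure d a P₂ ≤ ENNReal.ofReal 1 * volume P₂ := by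
          refine powerMeasure_le_const_mul hP₂m fun y hy => ?_
          exact Real.rpow_le_one_of_one_le_of_nonpos hy.2.1 (by linarith)
      _ ≤ volume (Metric.closedBall ((5 / 8 : ℝ) • u) (Real.sqrt q)) := by
          rw [ENNReal.ofReal_one, one_mul]
          refine measure_mono fun y hy => ?_
          rw [mem_closedBall_iff_sq (Real.sqrt_nonneg q), norm_sub_smul_sq hu, Real.sq_sqrt hq.le]
          have := hBy y hy.1
          have hy2 : ‖y‖ ≤ q⁻¹ := hy.2.2
          have hy3 : ‖y‖ ^ 2 ≤ 5 / 4 := by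
            calc ‖y‖ ^ 2 ≤ (q⁻¹) ^ 2 := by gcongr
              _ = 5 / 4 := by rw [inv_pow, hq2]; norm_num
          nlinarith
      _ = ENNReal.ofReal (Real.sqrt q ^ d) *
            volume (Metric.closedBall (0 : EuclideanSpace ℝ (Fin d)) 1) :=
          volume_closedBall_eq _ (Real.sqrt_nonneg q)
      _ ≤ ENNReal.ofReal (q ^ a) * M₁ := by
          gcongr
          rw [Real.sqrt_eq_rpow, ← Real.rpow_natCast, ← Real.rpow_mul hq.le]
          exact Real.rpow_le_rpow_of_exponent_ge hq hq1 (by linarith)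
  -- Far out the weight alone gives `q ^ a`; the volume costs only `(1 + δ) ^ d ≤ 2`.
  have h3 : powerMeasure d a P₃ ≤ ENNReal.ofReal (2 * q ^ a) * M₁ :=
    calc powerMeasure d a P₃ ≤ ENNReal.ofReal (q ^ a) * volume P₃ := by
          refine powerMeasure_le_const_mul hP₃m fun y hy => ?_
          calc ‖y‖ ^ (-a) ≤ (q⁻¹) ^ (-a) :=
                Real.rpow_le_rpow_of_nonpos (by positivity) hy.2 (by linarith)
            _ = q ^ a := by rw [Real.inv_rpow hq.le, Real.rpow_neg hq.le, inv_inv]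
      _ ≤ ENNReal.ofReal (q ^ a) * (ENNReal.ofReal 2 * M₁) := by
          gcongr
          refine (measure_mono Set.inter_subset_left).trans ?_
          rw [hB, volume_closedBall_eq _ (by linarith)]
          gcongr
      _ = _ := by
          rw [← mul_assoc, ← ENNReal.ofReal_mul (by positivity), mul_comm (q ^ a)]
  have hsub : B ⊆ P₁ ∪ P₂ ∪ P₃ := by
    intro y hy
    rcases le_total ‖y‖ 1 with h | h
    · exact .inl (.inl ⟨hy, h⟩)
    rcases le_total ‖y‖ q⁻¹ with h' | h'
    · exact .inl (.inr ⟨hy, h, h'⟩)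
    · exact .inr ⟨hy, h'⟩
  calc powerMeasure d a B ≤ powerMeasure d a P₁ + powerMeasure d a P₂ + powerMeasure d a P₃ :=
        (measure_mono hsub).trans ((measure_union_le _ _).trans (by
          gcongr; exact measure_union_le _ _))
    _ ≤ ENNReal.ofReal (q ^ a) * M₁ + ENNReal.ofReal (q ^ a) * M₁ +
          ENNReal.ofReal (2 * q ^ a) * M₁ := by gcongr
    _ = _ := by
        rw [← add_mul, ← add_mul, ← ENNReal.ofReal_add (by positivity) (by positivity),
          ← ENNReal.ofReal_add (by positivity) (by positivity)]
        congr 2; ring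

theorem isRadialFun_indicator_closedBall {d : ℕ} (R : ℝ) (g : ℝ → ℝ) :
    IsRadialFun ((Metric.closedBall (0 : EuclideanSpace ℝ (Fin d)) R).indicator
      fun y => g ‖y‖) := by
  refine ⟨(Set.Iic R).indicator g, fun x _ => ?_⟩
  by_cases h : ‖x‖ ≤ R <;> simp [h]

theorem eLpNorm_one_indicator_closedBall {d : ℕ} (a R : ℝ) :
    eLpNorm ((Metric.closedBall (0 : EuclideanSpace ℝ (Fin d)) R).indicator fun _ => (1 : ℝ))
      ((1 : ℝ≥0) : ℝ≥0∞) (powerMeasure d a) = powerMeasure d a (Metric.closedBall 0 R) := by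
  rw [ENNReal.coe_one, eLpNorm_indicator_const Metric.isClosed_closedBall.measurableSet
    (by simp) (by simp)]
  simp

theorem memLp_one_indicator_closedBall {d : ℕ} (hd : 1 ≤ d) {a : ℝ} (ha : a < d) {R : ℝ}
    (hR : 0 ≤ R) :
    MemLp ((Metric.closedBall (0 : EuclideanSpace ℝ (Fin d)) R).indicator fun _ => (1 : ℝ))
      ((1 : ℝ≥0) : ℝ≥0∞) (powerMeasure d a) := by
  refine ⟨(measurable_const.indicator
    Metric.isClosed_closedBall.measurableSet).aestronglyMeasurable, ?_⟩
  rw [eLpNorm_one_indicator_closedBall]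
  exact powerMeasure_closedBall_zero_lt_top hd ha hR

theorem setLIntegral_indicator_closedBall {d : ℕ} (a R : ℝ) {B : Set (EuclideanSpace ℝ (Fin d))} :
    ∫⁻ y in B, ‖(Metric.closedBall (0 : EuclideanSpace ℝ (Fin d)) R).indicator
      (fun _ => (1 : ℝ)) y‖ₑ ∂powerMeasure d a = powerMeasure d a (B ∩ Metric.closedBall 0 R) := by
  have hm : MeasurableSet (Metric.closedBall (0 : EuclideanSpace ℝ (Fin d)) R) :=
    Metric.isClosed_closedBall.measurableSet
  have : ∀ y, ‖(Metric.closedBall (0 : EuclideanSpace ℝ (Fin d)) R).indicator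
      (fun _ => (1 : ℝ)) y‖ₑ = (Metric.closedBall (0 : EuclideanSpace ℝ (Fin d)) R).indicator
      (fun _ => (1 : ℝ≥0∞)) y := by
    intro y
    by_cases h : ‖y‖ ≤ R <;> simp [h]
  simp_rw [this]
  rw [lintegral_indicator_const hm, one_mul, Measure.restrict_apply hm, Set.inter_comm]

/-- For the indicator of the unit ball some average equals `1` at each interior point. This settles
negative exponents, where `(√5 / 2) ^ a ≤ 1`. -/
theorem one_le_radialWeakConst {d : ℕ} (hd : 1 ≤ d) {a : ℝ} (ha : a < d) :
    1 ≤ radialWeakConst 1 (powerMeasure d a) := by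
  have := nontrivial_euclidean hd
  refine le_radialWeakConst (t := 1) (isRadialFun_indicator_closedBall 1 fun _ => 1)
    (memLp_one_indicator_closedBall hd ha zero_le_one) ?_ one_pos ?_
  · rw [eLpNorm_one_indicator_closedBall]
    exact (powerMeasure_closedBall_pos hd a 0 one_pos).ne'
  rw [eLpNorm_one_indicator_closedBall]
  simp only [ENNReal.coe_one, one_mul, NNReal.coe_one, div_one, ENNReal.rpow_one]
  have hsphere : powerMeasure d a (Metric.sphere 0 1) = 0 :=
    powerMeasure_absolutelyContinuous d a (Measure.addHaar_sphere _ _ _)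
  calc powerMeasure d a (Metric.closedBall 0 1)
      ≤ powerMeasure d a (Metric.ball 0 1) + powerMeasure d a (Metric.sphere 0 1) := by
        rw [← Metric.ball_union_sphere]; exact measure_union_le _ _
    _ = powerMeasure d a (Metric.ball 0 1) := by rw [hsphere, add_zero]
    _ ≤ _ := by
        refine measure_mono fun x hx => ?_
        rw [mem_ball_zero_iff] at hx
        have hr : 0 < 1 - ‖x‖ := by linarith
        have hsub : Metric.closedBall x (1 - ‖x‖) ⊆ Metric.closedBall 0 1 := by
          refine Metric.closedBall_subset_closedBall' ?_
          rw [dist_zero_right]; linarith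
        have hpos := powerMeasure_closedBall_pos hd a x hr
        refine le_trans (le_of_eq ?_) (le_centeredMaximal hr hpos)
        rw [setLIntegral_indicator_closedBall a 1,
          Set.inter_eq_left.2 hsub, ENNReal.div_self hpos.ne'
            (ne_of_lt ((measure_mono hsub).trans_lt
              (powerMeasure_closedBall_zero_lt_top hd ha zero_le_one)))]

theorem rpow_le_radialWeakConst {d : ℕ} (hd : 1 ≤ d) {a : ℝ} (ha : 0 ≤ a) (had : a ≤ d / 2) :
    ENNReal.ofReal (1 / 4 * (Real.sqrt 5 / 2) ^ a) ≤ radialWeakConst 1 (powerMeasure d a) := by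
  have := nontrivial_euclidean hd
  have hd0 : (1 : ℝ) ≤ d := by exact_mod_cast hd
  have had' : a < d := by linarith
  set q : ℝ := (Real.sqrt 5 / 2)⁻¹ with hq
  have hq0 : 0 < q := by positivity
  have hq2 : q ^ 2 = 4 / 5 := by
    rw [hq, inv_pow, div_pow, Real.sq_sqrt (by norm_num)]; norm_num
  have hqa : (Real.sqrt 5 / 2) ^ a = (q ^ a)⁻¹ := by
    rw [hq, Real.inv_rpow (by positivity), inv_inv]
  -- Small enough that enlarging radii by `1 + δ` costs a factor at most `2` in volume.
  set δ : ℝ := 1 / (100 * d) with hδ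
  have hδ0 : 0 < δ := by positivity
  have hδ1 : δ ≤ 1 / 100 := by
    rw [hδ]; gcongr; linarith
  have hδd : (1 + δ) ^ d ≤ 2 := by
    calc (1 + δ) ^ d ≤ (Real.exp δ) ^ d := by
          gcongr; linarith [Real.add_one_le_exp δ]
      _ = Real.exp (1 / 100) := by
          rw [← Real.exp_nat_mul]; congr 1; rw [hδ]; field_simp
      _ ≤ Real.exp (Real.log 2) := by
          gcongr; linarith [Real.log_two_gt_d9]
      _ = 2 := Real.exp_log (by norm_num)
  set M₁ := powerMeasure d a (Metric.closedBall 0 1) with hM₁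
  set m := powerMeasure d a (Metric.closedBall 0 δ) with hm
  have hM₁0 : M₁ ≠ 0 := (powerMeasure_closedBall_pos hd a 0 one_pos).ne'
  have hM₁t : M₁ ≠ ∞ := (powerMeasure_closedBall_zero_lt_top hd had' zero_le_one).ne
  have hm0 : m ≠ 0 := (powerMeasure_closedBall_pos hd a 0 hδ0).ne'
  have hmt : m ≠ ∞ := (powerMeasure_closedBall_zero_lt_top hd had' hδ0.le).ne
  set D := ENNReal.ofReal (4 * q ^ a) * M₁ with hD
  have hk0 : ENNReal.ofReal (4 * q ^ a) ≠ 0 := by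
    rw [ne_eq, ENNReal.ofReal_eq_zero, not_le]; positivity
  have hD0 : D ≠ 0 := mul_ne_zero hk0 hM₁0
  have hDt : D ≠ ∞ := ENNReal.mul_ne_top ENNReal.ofReal_ne_top hM₁t
  have ht : ((m / D).toNNReal : ℝ≥0∞) = m / D :=
    ENNReal.coe_toNNReal (ENNReal.div_ne_top hmt hD0)
  refine le_radialWeakConst (t := (m / D).toNNReal) (isRadialFun_indicator_closedBall δ fun _ => 1)
    (memLp_one_indicator_closedBall hd had' hδ0.le) ?_ ?_ ?_
  · rw [eLpNorm_one_indicator_closedBall]; exact hm0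
  · exact ENNReal.toNNReal_pos (ENNReal.div_pos hm0 hDt).ne' (ENNReal.div_ne_top hmt hD0)
  rw [eLpNorm_one_indicator_closedBall, ht]
  simp only [NNReal.coe_one, div_one, ENNReal.rpow_one]
  have hset : Metric.closedBall 0 1 ⊆ {x | m / D ≤ centeredMaximal (powerMeasure d a)
      ((Metric.closedBall (0 : EuclideanSpace ℝ (Fin d)) δ).indicator fun _ => (1 : ℝ)) x} := by
    intro x hx
    rw [mem_closedBall_zero_iff] at hx
    have hr : 0 < ‖x‖ + δ := by positivity
    refine le_trans ?_ (le_centeredMaximal hr (powerMeasure_closedBall_pos hd a x hr))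
    have hsub : Metric.closedBall 0 δ ⊆ Metric.closedBall x (‖x‖ + δ) := by
      refine Metric.closedBall_subset_closedBall' ?_
      rw [dist_zero_left]; linarith
    rw [setLIntegral_indicator_closedBall a δ,
      Set.inter_eq_right.2 hsub]
    gcongr
    -- `u` is a nearest point of the unit sphere, so `closedBall x (‖x‖ + δ)` lies in `closedBall u
    -- (1 + δ)`.
    obtain ⟨u, hu, hux⟩ : ∃ u : EuclideanSpace ℝ (Fin d), ‖u‖ = 1 ∧ dist x u = 1 - ‖x‖ := by
      by_cases h0 : x = 0
      · obtain ⟨u, hu⟩ := exists_norm_eq (EuclideanSpace ℝ (Fin d)) zero_le_one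
        exact ⟨u, hu, by simp [h0, hu]⟩
      · have hx0 : 0 < ‖x‖ := norm_pos_iff.2 h0
        refine ⟨(‖x‖⁻¹ : ℝ) • x, by simp [norm_smul, hx0.ne'], ?_⟩
        rw [dist_comm, dist_eq_norm]
        have : (‖x‖⁻¹ : ℝ) • x - x = (‖x‖⁻¹ - 1 : ℝ) • x := by rw [sub_smul, one_smul]
        rw [this, norm_smul, Real.norm_eq_abs, abs_of_nonneg
          (sub_nonneg.2 ((one_le_inv₀ hx0).2 hx)), sub_mul, inv_mul_cancel₀ hx0.ne', one_mul]
    calc powerMeasure d a (Metric.closedBall x (‖x‖ + δ))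
        ≤ powerMeasure d a (Metric.closedBall u (1 + δ)) := by
          refine measure_mono (Metric.closedBall_subset_closedBall' ?_)
          rw [hux]; linarith
      _ ≤ D := powerMeasure_closedBall_unit_le hd ha had hu hq0 hq2 hδ0.le hδ1 hδd
  refine le_trans (le_of_eq ?_) (mul_le_mul_right (measure_mono hset) _)
  have hinv : ENNReal.ofReal (1 / 4 * (Real.sqrt 5 / 2) ^ a) = (ENNReal.ofReal (4 * q ^ a))⁻¹ := by
    rw [hqa, ← ENNReal.ofReal_inv_of_pos (by positivity)]
    congr 1; field_simp
  rw [hinv, hD, ENNReal.div_eq_inv_mul, ENNReal.mul_inv (.inl hk0) (.inl ENNReal.ofReal_ne_top)]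
  rw [mul_right_comm, mul_assoc _ (M₁⁻¹) M₁, ENNReal.inv_mul_cancel hM₁0 hM₁t, mul_one]

theorem limsup_eq_top_of_rpow_le {c : ℝ} (hc : 0 < c) {α : ℕ → ℝ} {F : ℕ → ℝ≥0∞}
    (hF : ∀ d : ℕ, 1 ≤ d → ENNReal.ofReal (c * (Real.sqrt 5 / 2) ^ (α d)) ≤ F d)
    (h : limsup (fun d : ℕ => (α d : EReal)) atTop = ⊤) : limsup F atTop = ⊤ := by
  have h5 : 1 < Real.sqrt 5 / 2 := by
    have : (2 : ℝ) < Real.sqrt 5 := Real.lt_sqrt_of_sq_lt (by norm_num)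
    linarith
  refine ENNReal.eq_top_of_forall_nnreal_le fun M => ?_
  obtain ⟨n, hn⟩ := pow_unbounded_of_one_lt (M / c : ℝ) h5
  suffices hM : ∃ᶠ d in atTop, (M : ℝ≥0∞) ≤ F d from le_limsup_of_frequently_le hM
  have hfr : ∃ᶠ d in atTop, ((n : ℝ) : EReal) < (α d : EReal) := by
    have hlt : ((n : ℝ) : EReal) < limsup (fun d : ℕ => (α d : EReal)) atTop := by
      rw [h]; exact EReal.coe_lt_top _
    exact frequently_lt_of_lt_limsup (by isBoundedDefault) hlt
  refine (hfr.and_eventually (eventually_ge_atTop 1)).mono fun d hd => ?_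
  refine le_trans ?_ (hF d hd.2)
  have hnd : (n : ℝ) < α d := EReal.coe_lt_coe_iff.1 hd.1
  rw [← ENNReal.ofReal_coe_nnreal]
  refine ENNReal.ofReal_le_ofReal ?_
  have h6 : (Real.sqrt 5 / 2) ^ n ≤ (Real.sqrt 5 / 2) ^ (α d) := by
    rw [← Real.rpow_natCast]
    exact Real.rpow_le_rpow_of_exponent_le h5.le hnd.le
  have h7 := hn.trans_le h6
  rw [div_lt_iff₀ hc] at h7
  linarith

/-! ### Integration by parts and concentration for `α > 1/2`. -/

/-- The field `y - c` has divergence `d`; the integration by parts is done coordinate by coordinate.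
-/
theorem integral_fderiv_sub_center {d : ℕ} {ψ : EuclideanSpace ℝ (Fin d) → ℝ}
    (hψ : ContDiff ℝ 1 ψ) (hc : HasCompactSupport ψ) (c : EuclideanSpace ℝ (Fin d)) :
    ∫ y, fderiv ℝ ψ y (y - c) = -(d * ∫ y, ψ y) := by
  set e : Fin d → EuclideanSpace ℝ (Fin d) := fun i => EuclideanSpace.single i 1 with he
  have hcf : Continuous (fderiv ℝ ψ) := hψ.continuous_fderiv one_ne_zero
  have hcs : HasCompactSupport (fderiv ℝ ψ) := hc.fderiv ℝ
  have hint : ∀ i, Integrable fun y => fderiv ℝ ψ y (e i) * (y i - c i) := by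
    intro i
    refine Continuous.integrable_of_hasCompactSupport (by fun_prop) ?_
    refine HasCompactSupport.mul_right ?_
    exact hcs.comp_left (g := fun L : EuclideanSpace ℝ (Fin d) →L[ℝ] ℝ => L (e i)) rfl
  have hg : ∀ i y, HasFDerivAt (fun y : EuclideanSpace ℝ (Fin d) => y i - c i)
      (EuclideanSpace.proj i : EuclideanSpace ℝ (Fin d) →L[ℝ] ℝ) y := fun i y =>
    ((EuclideanSpace.proj i : EuclideanSpace ℝ (Fin d) →L[ℝ] ℝ).hasFDerivAt).sub_const _
  have hi : ∀ i, ∫ y, fderiv ℝ ψ y (e i) * (y i - c i) = -∫ y, ψ y := by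
    intro i
    have hge : ∀ y, fderiv ℝ (fun y : EuclideanSpace ℝ (Fin d) => y i - c i) y (e i) = 1 := by
      intro y
      rw [(hg i y).fderiv]; simp [he]
    have := integral_mul_fderiv_eq_neg_fderiv_mul_of_integrable (μ := volume) (f := ψ)
      (g := fun y : EuclideanSpace ℝ (Fin d) => y i - c i) (v := e i) (hint i) ?_ ?_
      (fun y _ => (hψ.differentiable one_ne_zero) y) (fun y _ => (hg i y).differentiableAt)
    · simp_rw [hge, mul_one] at this
      rw [this, neg_neg]
    · simp_rw [hge, mul_one]
      exact hψ.continuous.integrable_of_hasCompactSupport hc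
    · exact Continuous.integrable_of_hasCompactSupport
        (hψ.continuous.mul (by fun_prop)) hc.mul_right
  have hsum : ∀ y, fderiv ℝ ψ y (y - c) = ∑ i, fderiv ℝ ψ y (e i) * (y i - c i) := by
    intro y
    have : y - c = ∑ i, (y i - c i) • e i := by
      ext j
      simp [he, Finset.sum_apply, Pi.single_apply]
    conv_lhs => rw [this]
    rw [map_sum]
    refine Finset.sum_congr rfl fun i _ => ?_
    rw [map_smul, smul_eq_mul, mul_comm]
  simp_rw [hsum]
  rw [integral_finsetSum _ fun i _ => hint i]
  simp_rw [hi]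
  simp

theorem hasDerivAt_max_zero_sq (t : ℝ) : HasDerivAt (fun t : ℝ => max t 0 ^ 2) (2 * max t 0) t := by
  rcases lt_trichotomy t 0 with h | rfl | h
  · rw [max_eq_right h.le, mul_zero]
    refine (hasDerivAt_const t (0 : ℝ)).congr_of_eventuallyEq ?_
    filter_upwards [Iio_mem_nhds h] with s hs
    rw [max_eq_right (le_of_lt hs)]; simp
  · have : HasFDerivAt (fun t : ℝ => max t 0 ^ 2) (0 : ℝ →L[ℝ] ℝ) 0 := by
      refine Asymptotics.IsBigO.hasFDerivAt (n := 2) ?_ one_lt_two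
      refine Asymptotics.IsBigO.of_bound 1 (.of_forall fun s => ?_)
      simp only [sub_zero, norm_pow, one_mul, Real.norm_eq_abs]
      gcongr
      rcases le_total s 0 with hs | hs <;> simp [hs, le_abs_self]
    simpa using this.hasDerivAt
  · rw [max_eq_left h.le]
    refine (HasDerivAt.congr_of_eventuallyEq (f := fun t : ℝ => t ^ 2) (by simpa using hasDerivAt_pow 2 t) ?_)
    filter_upwards [Ioi_mem_nhds h] with s hs
    rw [max_eq_left (le_of_lt hs)]

/-- The positive part is not `C¹` but its square is, hence squared paraboloids as test functions. -/
theorem contDiff_max_zero_sq : ContDiff ℝ 1 fun t : ℝ => max t 0 ^ 2 := by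
  rw [contDiff_one_iff_deriv]
  refine ⟨fun t => (hasDerivAt_max_zero_sq t).differentiableAt, ?_⟩
  have : deriv (fun t : ℝ => max t 0 ^ 2) = fun t => 2 * max t 0 :=
    funext fun t => (hasDerivAt_max_zero_sq t).deriv
  rw [this]; fun_prop

section Bump

variable {E : Type*} [NormedAddCommGroup E] [InnerProductSpace ℝ E]

/-- The paraboloid `(S² - ‖y - x‖²)₊`. -/
def paraboloid (x : E) (S : ℝ) (y : E) : ℝ := max (S ^ 2 - ‖y - x‖ ^ 2) 0

theorem paraboloid_nonneg (x : E) (S : ℝ) (y : E) : 0 ≤ paraboloid x S y := le_max_right _ _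

theorem continuous_paraboloid (x : E) (S : ℝ) : Continuous (paraboloid x S) := by
  unfold paraboloid; fun_prop

theorem paraboloid_eq_zero {x : E} {S : ℝ} (hS : 0 ≤ S) {y : E} (h : S ≤ ‖y - x‖) :
    paraboloid x S y = 0 := max_eq_right (by nlinarith)

theorem norm_sub_lt_of_paraboloid_ne_zero {x : E} {S : ℝ} (hS : 0 ≤ S) {y : E}
    (h : paraboloid x S y ≠ 0) : ‖y - x‖ < S := by
  by_contra! hcon
  exact h (paraboloid_eq_zero hS hcon)

theorem hasCompactSupport_paraboloid [FiniteDimensional ℝ E] (x : E) {S : ℝ} (hS : 0 ≤ S) :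
    HasCompactSupport (paraboloid x S) := by
  have := FiniteDimensional.proper_real E
  refine HasCompactSupport.of_support_subset_isCompact (isCompact_closedBall x S) fun y hy => ?_
  rw [Metric.mem_closedBall, dist_eq_norm]
  exact (norm_sub_lt_of_paraboloid_ne_zero hS hy).le

theorem paraboloid_sq (x : E) (S : ℝ) (y : E) :
    paraboloid x S y ^ 2 = S ^ 2 * paraboloid x S y - paraboloid x S y * ‖y - x‖ ^ 2 := by
  unfold paraboloid
  rcases le_total (S ^ 2 - ‖y - x‖ ^ 2) 0 with h | h
  · rw [max_eq_right h]; ring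
  · rw [max_eq_left h]; ring

theorem ne_zero_of_norm_sub_lt {x y : E} {S : ℝ} (hSx : S < ‖x‖) (h : ‖y - x‖ < S) : y ≠ 0 := by
  rintro rfl
  rw [zero_sub, norm_neg] at h
  linarith

/-- Functions that are continuous away from the origin, multiplied by a paraboloid supported away
from the origin. -/
theorem continuous_paraboloid_mul {x : E} {S : ℝ} (hS : 0 ≤ S) (hSx : S < ‖x‖) {g : E → ℝ}
    (hg : ∀ y, y ≠ 0 → ContinuousAt g y) : Continuous fun y => paraboloid x S y * g y := by
  rw [continuous_iff_continuousAt]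
  intro y
  by_cases hy : y = 0
  · have hev : (fun y => paraboloid x S y * g y) =ᶠ[nhds y] fun _ => 0 := by
      have : ∀ᶠ v in nhds y, S < ‖v - x‖ := by
        refine ContinuousAt.eventually_lt (by fun_prop) (by fun_prop) ?_
        rw [hy, zero_sub, norm_neg]; exact hSx
      filter_upwards [this] with v hv
      rw [paraboloid_eq_zero hS hv.le, zero_mul]
    exact continuousAt_const.congr hev.symm
  · exact (continuous_paraboloid x S).continuousAt.mul (hg y hy)

theorem continuousAt_norm_sq_rpow {y : E} (hy : y ≠ 0) (q : ℝ) :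
    ContinuousAt (fun y : E => (‖y‖ ^ 2) ^ q) y :=
  ContinuousAt.rpow_const (by fun_prop) (.inl (by positivity))

/-- Since `S < ‖x‖`, the product vanishes near the origin, where the power of the norm may be
singular. Differentiating the square leaves one factor `paraboloid`, the weight of the moments
studied below. -/
theorem hasFDerivAt_paraboloid_sq_mul {x : E} {S : ℝ} (hS : 0 ≤ S) (hSx : S < ‖x‖) (q : ℝ)
    (y : E) : HasFDerivAt (fun y => paraboloid x S y ^ 2 * (‖y‖ ^ 2) ^ q)
      ((-4 * (paraboloid x S y * (‖y‖ ^ 2) ^ q)) • innerSL ℝ (y - x) +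
        (2 * q * (paraboloid x S y ^ 2 * (‖y‖ ^ 2) ^ (q - 1))) • innerSL ℝ y) y := by
  by_cases hy : y = 0
  · have hev : (fun y => paraboloid x S y ^ 2 * (‖y‖ ^ 2) ^ q) =ᶠ[nhds y] fun _ => 0 := by
      have : ∀ᶠ v in nhds y, S < ‖v - x‖ := by
        refine ContinuousAt.eventually_lt (by fun_prop) (by fun_prop) ?_
        rw [hy, zero_sub, norm_neg]; exact hSx
      filter_upwards [this] with v hv
      rw [paraboloid_eq_zero hS hv.le]; simp
    have h0 : paraboloid x S y = 0 := paraboloid_eq_zero hS (by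
      rw [hy, zero_sub, norm_neg]; exact hSx.le)
    rw [h0]
    refine HasFDerivAt.congr_of_eventuallyEq ?_ hev
    convert hasFDerivAt_const (0 : ℝ) y using 1
    simp
  · have h1 : HasFDerivAt (fun v : E => S ^ 2 - ‖v - x‖ ^ 2) (-(2 • innerSL ℝ (y - x))) y := by
      have := ((hasFDerivAt_id (𝕜 := ℝ) y).sub_const x).norm_sq.const_sub (S ^ 2)
      simpa using this
    have h2 := (hasDerivAt_max_zero_sq (S ^ 2 - ‖y - x‖ ^ 2)).comp_hasFDerivAt y h1
    have h3 : HasFDerivAt (fun v : E => ‖v‖ ^ 2) (2 • innerSL ℝ y) y := by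
      have := (hasFDerivAt_id (𝕜 := ℝ) y).norm_sq
      simpa using this
    have h4 := (Real.hasDerivAt_rpow_const (x := ‖y‖ ^ 2) (p := q)
      (.inl (by positivity))).comp_hasFDerivAt y h3
    refine (h2.mul h4).congr_fderiv ?_
    ext v
    simp [paraboloid]
    ring

theorem contDiff_paraboloid_sq_mul {x : E} {S : ℝ} (hS : 0 ≤ S) (hSx : S < ‖x‖) (q : ℝ) :
    ContDiff ℝ 1 fun y => paraboloid x S y ^ 2 * (‖y‖ ^ 2) ^ q := by
  rw [contDiff_iff_contDiffAt]
  intro y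
  by_cases hy : y = 0
  · have hev : (fun y => paraboloid x S y ^ 2 * (‖y‖ ^ 2) ^ q) =ᶠ[nhds y] fun _ => 0 := by
      have : ∀ᶠ v in nhds y, S < ‖v - x‖ := by
        refine ContinuousAt.eventually_lt (by fun_prop) (by fun_prop) ?_
        rw [hy, zero_sub, norm_neg]; exact hSx
      filter_upwards [this] with v hv
      rw [paraboloid_eq_zero hS hv.le]; simp
    exact contDiffAt_const.congr_of_eventuallyEq hev
  · refine ContDiffAt.mul ?_ ?_
    · refine contDiff_max_zero_sq.contDiffAt.comp y (f := fun v => S ^ 2 - ‖v - x‖ ^ 2) ?_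
      exact contDiffAt_const.sub ((contDiffAt_id.sub contDiffAt_const).norm_sq ℝ)
    · exact (contDiffAt_id.norm_sq ℝ).rpow_const_of_ne (by
        have : ‖y‖ ≠ 0 := norm_ne_zero_iff.2 hy
        exact pow_ne_zero 2 this)

end Bump

/-- The gain in the concentration estimate for the exponent `α * d`. -/
def concentrationGain (α : ℝ) : ℝ := ((2 * α - 1) / 4) ^ 2 * (2 * α - 1) / 14

theorem concentrationGain_pos {α : ℝ} (h1 : 1 / 2 < α) : 0 < concentrationGain α := by
  have : 0 < 2 * α - 1 := by linarith
  unfold concentrationGain; positivity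

theorem concentrationGain_lt_one {α : ℝ} (h1 : 1 / 2 < α) (h2 : α < 1) :
    concentrationGain α < 1 := by
  have h3 : 0 < 2 * α - 1 := by linarith
  have h4 : 2 * α - 1 ≤ 1 := by linarith
  unfold concentrationGain
  have : ((2 * α - 1) / 4) ^ 2 ≤ 1 := by
    rw [sq_le_one_iff_abs_le_one, abs_of_pos (by positivity)]; linarith
  nlinarith

section

variable {d : ℕ} {x : EuclideanSpace ℝ (Fin d)} {S : ℝ}

theorem integrable_paraboloid_mul (hS : 0 ≤ S) (hSx : S < ‖x‖)
    {g : EuclideanSpace ℝ (Fin d) → ℝ} (hg : ∀ y, y ≠ 0 → ContinuousAt g y) :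
    Integrable fun y => paraboloid x S y * g y :=
  (continuous_paraboloid_mul hS hSx hg).integrable_of_hasCompactSupport
    (hasCompactSupport_paraboloid x hS).mul_right

/-- Integration by parts against the field `y`. -/
theorem integral_paraboloid_origin (hS : 0 ≤ S) (hSx : S < ‖x‖) (a : ℝ) :
    ((d : ℝ) - a) * ∫ y, paraboloid x S y ^ 2 * (‖y‖ ^ 2) ^ (-a / 2) =
      2 * ∫ y, paraboloid x S y * ((‖y‖ ^ 2) ^ (-a / 2) * (‖y‖ ^ 2 + ‖y - x‖ ^ 2 - ‖x‖ ^ 2)) := by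
  set q := -a / 2 with hq
  have hc : HasCompactSupport fun y => paraboloid x S y ^ 2 * (‖y‖ ^ 2) ^ q := by
    simp_rw [sq (paraboloid x S _), mul_assoc]
    exact (hasCompactSupport_paraboloid x hS).mul_right
  have hw : ∀ y : EuclideanSpace ℝ (Fin d), y ≠ 0 →
      ContinuousAt (fun y => (‖y‖ ^ 2) ^ q) y := fun y hy => continuousAt_norm_sq_rpow hy q
  have h := integral_fderiv_sub_center (contDiff_paraboloid_sq_mul hS hSx q) hc 0
  have hpt : ∀ y, fderiv ℝ (fun y => paraboloid x S y ^ 2 * (‖y‖ ^ 2) ^ q) y (y - 0) =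
      -2 * (paraboloid x S y * ((‖y‖ ^ 2) ^ q * (‖y‖ ^ 2 + ‖y - x‖ ^ 2 - ‖x‖ ^ 2))) -
        a * (paraboloid x S y * (paraboloid x S y * (‖y‖ ^ 2) ^ q)) := by
    intro y
    rw [(hasFDerivAt_paraboloid_sq_mul hS hSx q y).fderiv, sub_zero]
    by_cases h0 : paraboloid x S y = 0
    · simp [h0]
    have hy : y ≠ 0 := ne_zero_of_norm_sub_lt hSx (norm_sub_lt_of_paraboloid_ne_zero hS h0)
    have hy2 : 0 < ‖y‖ ^ 2 := by positivity
    have hin : 2 * inner ℝ (y - x) y = ‖y‖ ^ 2 + ‖y - x‖ ^ 2 - ‖x‖ ^ 2 := by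
      have := norm_sub_sq_real y (y - x)
      rw [sub_sub_cancel, real_inner_comm] at this
      linarith
    have hpow : (‖y‖ ^ 2) ^ (q - 1) * ‖y‖ ^ 2 = (‖y‖ ^ 2) ^ q := by
      rw [Real.rpow_sub_one hy2.ne', div_mul_cancel₀ _ hy2.ne']
    simp only [add_apply, smul_apply, innerSL_apply_apply,
      smul_eq_mul, real_inner_self_eq_norm_sq]
    rw [← hin, ← hpow, hq]
    ring
  simp_rw [hpt] at h
  rw [integral_sub, integral_const_mul, integral_const_mul] at h
  · simp_rw [sq (paraboloid x S _), mul_assoc] at h ⊢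
    linarith
  · refine (integrable_paraboloid_mul hS hSx fun y hy => ?_).const_mul _
    exact (hw y hy).mul (by fun_prop)
  · refine (integrable_paraboloid_mul hS hSx fun y hy => ?_).const_mul _
    exact (continuous_paraboloid x S).continuousAt.mul (hw y hy)

/-- Integration by parts against the field `y - x`. -/
theorem integral_paraboloid_center_le (hS : 0 ≤ S) (hSx : S < ‖x‖) {a σ : ℝ} (ha : 0 ≤ a)
    (hσ : S ≤ σ * (‖x‖ - S)) :
    ((d : ℝ) - a * σ) * ∫ y, paraboloid x S y ^ 2 * (‖y‖ ^ 2) ^ (-a / 2) ≤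
      4 * ∫ y, paraboloid x S y * ((‖y‖ ^ 2) ^ (-a / 2) * ‖y - x‖ ^ 2) := by
  set q := -a / 2 with hq
  have hc : HasCompactSupport fun y => paraboloid x S y ^ 2 * (‖y‖ ^ 2) ^ q := by
    simp_rw [sq (paraboloid x S _), mul_assoc]
    exact (hasCompactSupport_paraboloid x hS).mul_right
  have hw : ∀ q : ℝ, ∀ y : EuclideanSpace ℝ (Fin d), y ≠ 0 →
      ContinuousAt (fun y => (‖y‖ ^ 2) ^ q) y := fun q y hy => continuousAt_norm_sq_rpow hy q
  have h := integral_fderiv_sub_center (contDiff_paraboloid_sq_mul hS hSx q) hc x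
  have hint1 : Integrable fun y => paraboloid x S y * ((‖y‖ ^ 2) ^ q * ‖y - x‖ ^ 2) :=
    integrable_paraboloid_mul hS hSx fun y hy => (hw q y hy).mul (by fun_prop)
  have hint2 : Integrable fun y => paraboloid x S y * (paraboloid x S y * (‖y‖ ^ 2) ^ q) :=
    integrable_paraboloid_mul hS hSx fun y hy =>
      (continuous_paraboloid x S).continuousAt.mul (hw q y hy)
  have hpt : ∀ y, -4 * (paraboloid x S y * ((‖y‖ ^ 2) ^ q * ‖y - x‖ ^ 2)) -
        a * σ * (paraboloid x S y * (paraboloid x S y * (‖y‖ ^ 2) ^ q)) ≤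
      fderiv ℝ (fun y => paraboloid x S y ^ 2 * (‖y‖ ^ 2) ^ q) y (y - x) := by
    intro y
    rw [(hasFDerivAt_paraboloid_sq_mul hS hSx q y).fderiv]
    by_cases h0 : paraboloid x S y = 0
    · simp [h0]
    have hlt := norm_sub_lt_of_paraboloid_ne_zero hS h0
    have hy : y ≠ 0 := ne_zero_of_norm_sub_lt hSx hlt
    have hy0 : 0 < ‖y‖ := norm_pos_iff.2 hy
    have hy2 : 0 < ‖y‖ ^ 2 := by positivity
    have hpow : (‖y‖ ^ 2) ^ (q - 1) * ‖y‖ ^ 2 = (‖y‖ ^ 2) ^ q := by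
      rw [Real.rpow_sub_one hy2.ne', div_mul_cancel₀ _ hy2.ne']
    -- On the support `‖y - x‖ < S ≤ σ (‖x‖ - S) ≤ σ ‖y‖`, so the derivative of the weight along `y
    -- - x` is a small error.
    have hin : inner ℝ y (y - x) ≤ σ * ‖y‖ ^ 2 := by
      have h1 := real_inner_le_norm y (y - x)
      have h2 : ‖x‖ - S ≤ ‖y‖ := by
        have := norm_sub_norm_le x y
        rw [norm_sub_rev] at this
        linarith
      have hσ0 : 0 ≤ σ := by
        by_contra! hcon
        nlinarith
      have h3 : ‖y - x‖ ≤ σ * ‖y‖ := by nlinarith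
      nlinarith
    simp only [add_apply, smul_apply, innerSL_apply_apply,
      smul_eq_mul, real_inner_self_eq_norm_sq]
    have h4 : 0 ≤ a * (paraboloid x S y ^ 2 * (‖y‖ ^ 2) ^ (q - 1)) := by positivity
    have h5 := mul_le_mul_of_nonneg_left hin h4
    have h6 : 2 * q = -a := by rw [hq]; ring
    rw [h6, ← hpow]
    nlinarith
  have hmono := integral_mono ((hint1.const_mul (-4)).sub (hint2.const_mul (a * σ))) (by
    refine Continuous.integrable_of_hasCompactSupport ?_ ?_
    · exact ((contDiff_paraboloid_sq_mul hS hSx q).continuous_fderiv one_ne_zero).clm_apply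
        (by fun_prop)
    · refine HasCompactSupport.intro (isCompact_closedBall x S) fun y hy => ?_
      rw [Metric.mem_closedBall, dist_eq_norm, not_le] at hy
      rw [(hasFDerivAt_paraboloid_sq_mul hS hSx q y).fderiv, paraboloid_eq_zero hS hy.le]
      simp) hpt
  rw [h] at hmono
  simp only [Pi.sub_apply] at hmono
  rw [integral_sub (hint1.const_mul _) (hint2.const_mul _), integral_const_mul,
    integral_const_mul] at hmono
  simp_rw [sq (paraboloid x S _), mul_assoc] at hmono ⊢
  linarith

end

/-- Here `A₀`, `Y`, `Z` are the weighted masses of `1`, `‖y‖²`, `‖y - x‖²`. Ignoring errors, `e2`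
says `D U ≤ 4 Z`, and `e1` then gives `Y ≤ R² A₀ - Z + 2 (1 - α) Z = R² A₀ - β Z`: a gain exactly
when `α > 1/2`. The error `β / 3` still leaves `β / 2`. Finally `U ≤ D U ≤ 6 Z`, so `e4` gives `S²
A₀ ≤ 7 Z`, whence the `14`. -/
theorem moment_le_of_identities {D α β A₀ Y Z U S R : ℝ} (hD : 1 ≤ D) (hβ0 : 0 < β) (hβ1 : β < 1)
    (hα : α = (1 + β) / 2) (hU : 0 ≤ U) (hZ : 0 ≤ Z)
    (e1 : (D - α * D) * U = 2 * (Y + Z - R ^ 2 * A₀))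
    (e2 : (D - α * D * (β / 3)) * U ≤ 4 * Z) (e4 : U = S ^ 2 * A₀ - Z) :
    Y ≤ R ^ 2 * A₀ - S ^ 2 * A₀ * (β / 14) := by
  obtain ⟨V, hV⟩ : ∃ V, V = D * U := ⟨_, rfl⟩
  have hUV : U ≤ V := by rw [hV]; nlinarith
  have e5 : (1 - α * (β / 3)) * V ≤ 4 * Z := by rw [hV]; linarith
  have e6 : (1 - α) * V = 2 * (Y + Z - R ^ 2 * A₀) := by rw [hV]; linarith
  have hV0 : 0 ≤ V := hU.trans hUV
  subst hα
  have e7 : (1 - β / 3) * V ≤ 4 * Z := by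
    have : 0 ≤ (1 - β) * (β / 6) * V := mul_nonneg (by nlinarith) hV0
    nlinarith
  have e8 : V ≤ 6 * Z := by nlinarith
  have e9 : S ^ 2 * A₀ ≤ 7 * Z := by linarith
  have e10 : Y ≤ R ^ 2 * A₀ - Z * (β / 2) := by
    have e11 : (1 - β) * ((1 - β / 3) * V) ≤ (1 - β) * (4 * Z) :=
      mul_le_mul_of_nonneg_left e7 (by linarith)
    have e12 : (1 - β / 3) * Y ≤ (1 - β / 3) * (R ^ 2 * A₀ - Z * (β / 2)) := by
      nlinarith [mul_nonneg hZ hβ0.le, mul_nonneg (mul_nonneg hZ hβ0.le) (sub_nonneg.2 hβ1.le)]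
    exact le_of_mul_le_mul_left e12 (by linarith)
  nlinarith [mul_le_mul_of_nonneg_right e9 (show 0 ≤ β / 14 by positivity)]

/-- For the weight `‖y‖ ^ (-α d)` with `α > 1/2`, small balls around `x` are concentrated inside the
centered ball through `x`. -/
theorem integral_paraboloid_norm_sq_le {d : ℕ} (hd : 1 ≤ d) {α : ℝ} (h1 : 1 / 2 < α) (h2 : α < 1)
    {x : EuclideanSpace ℝ (Fin d)} (hx : x ≠ 0) :
    ∫ y, paraboloid x ((2 * α - 1) / 4 * ‖x‖) y * ((‖y‖ ^ 2) ^ (-(α * d) / 2) * ‖y‖ ^ 2) ≤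
      (1 - concentrationGain α) * ‖x‖ ^ 2 *
        ∫ y, paraboloid x ((2 * α - 1) / 4 * ‖x‖) y * (‖y‖ ^ 2) ^ (-(α * d) / 2) := by
  have hR : 0 < ‖x‖ := norm_pos_iff.2 hx
  have hd0 : (1 : ℝ) ≤ d := by exact_mod_cast hd
  set β := 2 * α - 1 with hβ
  have hβ0 : 0 < β := by linarith
  have hβ1 : β < 1 := by linarith
  set S := β / 4 * ‖x‖ with hSdef
  have hS : 0 ≤ S := by positivity
  have hSx : S < ‖x‖ := by rw [hSdef]; nlinarith
  have hα0 : 0 ≤ α * d := by positivity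
  -- With `S = β ‖x‖ / 4` this amounts to `3 ≤ 4 - β`.
  have hσ : S ≤ β / 3 * (‖x‖ - S) := by rw [hSdef]; nlinarith [mul_pos hβ0 hR]
  have e1 := integral_paraboloid_origin hS hSx (α * d)
  have e2 := integral_paraboloid_center_le hS hSx hα0 hσ
  set q := -(α * d) / 2
  have hw : ∀ y : EuclideanSpace ℝ (Fin d), y ≠ 0 →
      ContinuousAt (fun y => (‖y‖ ^ 2) ^ q) y := fun y hy => continuousAt_norm_sq_rpow hy q
  have i0 : Integrable fun y => paraboloid x S y * (‖y‖ ^ 2) ^ q :=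
    integrable_paraboloid_mul hS hSx hw
  have iY : Integrable fun y => paraboloid x S y * ((‖y‖ ^ 2) ^ q * ‖y‖ ^ 2) :=
    integrable_paraboloid_mul hS hSx fun y hy => (hw y hy).mul (by fun_prop)
  have iZ : Integrable fun y => paraboloid x S y * ((‖y‖ ^ 2) ^ q * ‖y - x‖ ^ 2) :=
    integrable_paraboloid_mul hS hSx fun y hy => (hw y hy).mul (by fun_prop)
  set A₀ := ∫ y, paraboloid x S y * (‖y‖ ^ 2) ^ q
  set Y := ∫ y, paraboloid x S y * ((‖y‖ ^ 2) ^ q * ‖y‖ ^ 2)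
  set Z := ∫ y, paraboloid x S y * ((‖y‖ ^ 2) ^ q * ‖y - x‖ ^ 2) with hZ
  set U := ∫ y, paraboloid x S y ^ 2 * (‖y‖ ^ 2) ^ q with hU
  have hU0 : 0 ≤ U := integral_nonneg fun y => by positivity
  have hA0 : 0 ≤ A₀ := integral_nonneg fun y =>
    mul_nonneg (paraboloid_nonneg _ _ _) (by positivity)
  have hZ0 : 0 ≤ Z := integral_nonneg fun y =>
    mul_nonneg (paraboloid_nonneg _ _ _) (by positivity)
  have e3 : ∫ y, paraboloid x S y * ((‖y‖ ^ 2) ^ q * (‖y‖ ^ 2 + ‖y - x‖ ^ 2 - ‖x‖ ^ 2)) =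
      Y + Z - ‖x‖ ^ 2 * A₀ := by
    have iYZ : Integrable fun y => paraboloid x S y * ((‖y‖ ^ 2) ^ q * ‖y‖ ^ 2) +
        paraboloid x S y * ((‖y‖ ^ 2) ^ q * ‖y - x‖ ^ 2) := iY.add iZ
    rw [← integral_const_mul, ← integral_add iY iZ, ← integral_sub iYZ (i0.const_mul _)]
    congr 1; ext y; ring
  have e4 : U = S ^ 2 * A₀ - Z := by
    rw [hU, hZ, ← integral_const_mul, ← integral_sub (i0.const_mul _) iZ]
    congr 1; ext y; rw [paraboloid_sq]; ring
  rw [e3] at e1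
  have e5 := moment_le_of_identities hd0 hβ0 hβ1 (by rw [hβ]; ring) hU0 hZ0 e1 e2 e4
  calc Y ≤ ‖x‖ ^ 2 * A₀ - S ^ 2 * A₀ * (β / 14) := e5
    _ = _ := by rw [concentrationGain, hSdef, hβ]; ring

/-- The tangent line at `v = 1` of a convex power; it takes the place of Jensen's inequality. -/
theorem one_sub_le_rpow_neg {q v : ℝ} (hq : 0 ≤ q) (hv : 0 < v) :
    1 - q * (v - 1) ≤ v ^ (-q) := by
  rw [Real.rpow_def_of_pos hv]
  have h1 := Real.add_one_le_exp (Real.log v * -q)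
  have h2 := Real.log_le_sub_one_of_pos hv
  nlinarith

/-- The average of a negative power of the norm is exponentially larger than its value at the
center. -/
theorem integral_paraboloid_rpow_ge {d : ℕ} (hd : 1 ≤ d) {α : ℝ} (h1 : 1 / 2 < α) (h2 : α < 1)
    {x : EuclideanSpace ℝ (Fin d)} (hx : x ≠ 0) {γ : ℝ} (hγ : 0 ≤ γ) :
    ((1 - concentrationGain α) * ‖x‖ ^ 2) ^ (-(γ / 2)) *
        ∫ y, paraboloid x ((2 * α - 1) / 4 * ‖x‖) y * (‖y‖ ^ 2) ^ (-(α * d) / 2) ≤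
      ∫ y, paraboloid x ((2 * α - 1) / 4 * ‖x‖) y *
        ((‖y‖ ^ 2) ^ (-(α * d) / 2) * (‖y‖ ^ 2) ^ (-(γ / 2))) := by
  have hR : 0 < ‖x‖ := norm_pos_iff.2 hx
  have hκ := concentrationGain_lt_one h1 h2
  have key := integral_paraboloid_norm_sq_le hd h1 h2 hx
  set x₀ := (1 - concentrationGain α) * ‖x‖ ^ 2 with hx₀
  have hx₀0 : 0 < x₀ := mul_pos (by linarith) (by positivity)
  set S := (2 * α - 1) / 4 * ‖x‖ with hSdef
  have hS : 0 ≤ S := mul_nonneg (by linarith) hR.le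
  have hSx : S < ‖x‖ := by rw [hSdef]; nlinarith
  set q := -(α * d) / 2
  have hw : ∀ q : ℝ, ∀ y : EuclideanSpace ℝ (Fin d), y ≠ 0 →
      ContinuousAt (fun y => (‖y‖ ^ 2) ^ q) y := fun q y hy => continuousAt_norm_sq_rpow hy q
  have i0 : Integrable fun y => paraboloid x S y * (‖y‖ ^ 2) ^ q :=
    integrable_paraboloid_mul hS hSx (hw q)
  have iY : Integrable fun y => paraboloid x S y * ((‖y‖ ^ 2) ^ q * ‖y‖ ^ 2) :=
    integrable_paraboloid_mul hS hSx fun y hy => (hw q y hy).mul (by fun_prop)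
  have iG : Integrable fun y => paraboloid x S y *
      ((‖y‖ ^ 2) ^ q * (‖y‖ ^ 2) ^ (-(γ / 2))) :=
    integrable_paraboloid_mul hS hSx fun y hy => (hw q y hy).mul (hw _ y hy)
  set T := x₀ ^ (-(γ / 2)) with hT
  have hT0 : 0 < T := Real.rpow_pos_of_pos hx₀0 _
  -- Tangent line at `x₀`, an upper bound for the mean of `‖y‖²`. Its slope is nonpositive, so an
  -- upper bound for the mean suffices.
  have hpt : ∀ y, T * (1 + γ / 2) * (paraboloid x S y * (‖y‖ ^ 2) ^ q) -
      T * (γ / 2) / x₀ * (paraboloid x S y * ((‖y‖ ^ 2) ^ q * ‖y‖ ^ 2)) ≤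
      paraboloid x S y * ((‖y‖ ^ 2) ^ q * (‖y‖ ^ 2) ^ (-(γ / 2))) := by
    intro y
    by_cases h0 : paraboloid x S y = 0
    · simp [h0]
    have hy : y ≠ 0 := ne_zero_of_norm_sub_lt hSx (norm_sub_lt_of_paraboloid_ne_zero hS h0)
    have hy2 : 0 < ‖y‖ ^ 2 := by positivity
    have hb := one_sub_le_rpow_neg (show 0 ≤ γ / 2 by positivity) (div_pos hy2 hx₀0)
    rw [Real.div_rpow hy2.le hx₀0.le, ← hT, le_div_iff₀ hT0] at hb
    have hnn : 0 ≤ paraboloid x S y * (‖y‖ ^ 2) ^ q :=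
      mul_nonneg (paraboloid_nonneg _ _ _) (by positivity)
    calc _ = paraboloid x S y * (‖y‖ ^ 2) ^ q * ((1 - γ / 2 * (‖y‖ ^ 2 / x₀ - 1)) * T) := by
          field_simp; ring
      _ ≤ paraboloid x S y * (‖y‖ ^ 2) ^ q * (‖y‖ ^ 2) ^ (-(γ / 2)) := by gcongr
      _ = _ := by ring
  have hmono := integral_mono ((i0.const_mul _).sub (iY.const_mul _)) iG hpt
  simp only [Pi.sub_apply] at hmono
  rw [integral_sub (i0.const_mul _) (iY.const_mul _), integral_const_mul,
    integral_const_mul] at hmono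
  refine le_trans ?_ hmono
  have hk := mul_le_mul_of_nonneg_left key (show 0 ≤ T * (γ / 2) / x₀ by positivity)
  have : T * (γ / 2) / x₀ * (x₀ * ∫ y, paraboloid x S y * (‖y‖ ^ 2) ^ q) =
      T * (γ / 2) * ∫ y, paraboloid x S y * (‖y‖ ^ 2) ^ q := by field_simp
  rw [this] at hk
  linarith

/-! ### Exponential growth for `1/2 < α < 1`. -/

theorem norm_sq_rpow {E : Type*} [NormedAddCommGroup E] (y : E) (q : ℝ) :
    (‖y‖ ^ 2) ^ q = ‖y‖ ^ (2 * q) := by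
  rw [← Real.rpow_natCast, ← Real.rpow_mul (norm_nonneg y)]; norm_num

theorem lintegral_paraboloid_mul {d : ℕ} {x : EuclideanSpace ℝ (Fin d)} {S : ℝ} (hS : 0 ≤ S)
    (hSx : S < ‖x‖) (a γ : ℝ) :
    ∫⁻ y, ENNReal.ofReal (paraboloid x S y) * ENNReal.ofReal (‖y‖ ^ (-γ)) ∂powerMeasure d a =
      ENNReal.ofReal (∫ y, paraboloid x S y * ((‖y‖ ^ 2) ^ (-a / 2) * (‖y‖ ^ 2) ^ (-(γ / 2)))) := by
  have hpm : Measurable (paraboloid x S) := (continuous_paraboloid x S).measurable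
  rw [lintegral_powerMeasure a (by fun_prop), ofReal_integral_eq_lintegral_ofReal]
  · refine lintegral_congr fun y => ?_
    have hp := paraboloid_nonneg x S y
    rw [norm_sq_rpow, norm_sq_rpow, show 2 * (-a / 2) = -a by ring,
      show 2 * -(γ / 2) = -γ by ring, ENNReal.ofReal_mul hp, ENNReal.ofReal_mul (by positivity)]
    ring
  · exact integrable_paraboloid_mul hS hSx fun y hy =>
      (continuousAt_norm_sq_rpow hy _).mul (continuousAt_norm_sq_rpow hy _)
  · exact .of_forall fun y => mul_nonneg (paraboloid_nonneg _ _ _) (by positivity)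

/-- Averages against a paraboloid are dominated by the centered maximal function. -/
theorem lintegral_paraboloid_le_centeredMaximal {d : ℕ} (hd : 1 ≤ d) {a : ℝ} (ha : a < d)
    {x : EuclideanSpace ℝ (Fin d)} {S : ℝ} {f : EuclideanSpace ℝ (Fin d) → ℝ}
    (hf : Measurable f) :
    ∫⁻ y, ENNReal.ofReal (paraboloid x S y) * ‖f y‖ₑ ∂powerMeasure d a ≤
      centeredMaximal (powerMeasure d a) f x *
        ∫⁻ y, ENNReal.ofReal (paraboloid x S y) ∂powerMeasure d a := by
  have := nontrivial_euclidean hd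
  set μ := powerMeasure d a
  have hpm : Measurable (paraboloid x S) := (continuous_paraboloid x S).measurable
  have hν : ∫⁻ y, ENNReal.ofReal (paraboloid x S y) * ‖f y‖ₑ ∂μ =
      ∫⁻ y, ENNReal.ofReal (paraboloid x S y) ∂(μ.withDensity fun y => ‖f y‖ₑ) := by
    rw [lintegral_withDensity_eq_lintegral_mul _ hf.enorm (by fun_prop)]
    exact lintegral_congr fun y => mul_comm _ _
  rw [hν, lintegral_eq_lintegral_meas_le _ (.of_forall fun y => paraboloid_nonneg x S y)
    hpm.aemeasurable, lintegral_eq_lintegral_meas_le _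
    (.of_forall fun y => paraboloid_nonneg x S y) hpm.aemeasurable, ← lintegral_const_mul]
  swap
  · exact Antitone.measurable fun s t hst => measure_mono fun y hy => hst.trans hy
  refine setLIntegral_mono' measurableSet_Ioi fun t (ht : 0 < t) => ?_
  have hiff : ∀ y, t ≤ paraboloid x S y ↔ ‖y - x‖ ^ 2 ≤ S ^ 2 - t := by
    intro y
    rw [paraboloid, le_max_iff, or_iff_left (by linarith)]
    constructor <;> intro h <;> linarith
  -- Layer cake: below height `S²` the superlevel sets are balls about `x`, at which the maximal
  -- function can be used; from `S²` on they are null.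
  rcases lt_or_ge t (S ^ 2) with h | h
  · have hr : 0 < Real.sqrt (S ^ 2 - t) := Real.sqrt_pos.2 (by linarith)
    have hset : {y | t ≤ paraboloid x S y} = Metric.closedBall x (Real.sqrt (S ^ 2 - t)) := by
      ext y
      rw [Set.mem_ofPred_eq, hiff, mem_closedBall_iff_sq hr.le, Real.sq_sqrt (by linarith)]
    rw [hset, withDensity_apply _ Metric.isClosed_closedBall.measurableSet]
    have hpos := powerMeasure_closedBall_pos hd a x hr
    have hfin : μ (Metric.closedBall x (Real.sqrt (S ^ 2 - t))) ≠ ∞ := by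
      refine ne_of_lt ((measure_mono ?_).trans_lt (powerMeasure_closedBall_zero_lt_top hd ha
        (show 0 ≤ Real.sqrt (S ^ 2 - t) + ‖x‖ by positivity)))
      exact Metric.closedBall_subset_closedBall' (by rw [dist_zero_right])
    exact (ENNReal.div_le_iff_le_mul (.inl hpos.ne') (.inl hfin)).1 (le_centeredMaximal hr hpos)
  · have hsub : {y | t ≤ paraboloid x S y} ⊆ {x} := by
      intro y hy
      have h1 := (hiff y).1 hy
      have h2 : ‖y - x‖ ^ 2 = 0 := le_antisymm (by linarith) (sq_nonneg _)
      rw [pow_eq_zero_iff two_ne_zero, norm_eq_zero, sub_eq_zero] at h2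
      exact h2
    have h0 : μ {x} = 0 := powerMeasure_absolutelyContinuous d a (measure_singleton x)
    rw [measure_mono_null hsub (withDensity_absolutelyContinuous _ _ h0)]
    exact zero_le

/-- The truncated power `‖y‖ ^ (-γ)`. -/
def truncatedPower (d : ℕ) (γ ρ : ℝ) : EuclideanSpace ℝ (Fin d) → ℝ :=
  (Metric.closedBall (0 : EuclideanSpace ℝ (Fin d)) ρ).indicator fun y => ‖y‖ ^ (-γ)

theorem measurable_truncatedPower (d : ℕ) (γ ρ : ℝ) : Measurable (truncatedPower d γ ρ) :=
  Measurable.indicator (by fun_prop) Metric.isClosed_closedBall.measurableSet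

/-- For `‖x‖ ≤ 1` the paraboloid is supported within the truncation radius, so the truncation is
invisible. Dropping `‖x‖ ^ (-γ) ≥ 1` makes the bound uniform on the punctured unit ball. -/
theorem le_centeredMaximal_truncatedPower {d : ℕ} (hd : 1 ≤ d) {α : ℝ} (h1 : 1 / 2 < α)
    (h2 : α < 1) {γ : ℝ} (hγ : 0 ≤ γ) {x : EuclideanSpace ℝ (Fin d)} (hx : x ≠ 0) (hx1 : ‖x‖ ≤ 1) :
    ENNReal.ofReal ((1 - concentrationGain α) ^ (-(γ / 2))) ≤
      centeredMaximal (powerMeasure d (α * d))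
        (truncatedPower d γ (1 + (2 * α - 1) / 4)) x := by
  have hR : 0 < ‖x‖ := norm_pos_iff.2 hx
  have hd0 : (1 : ℝ) ≤ d := by exact_mod_cast hd
  have had : α * d < d := by nlinarith
  have hκ := concentrationGain_lt_one h1 h2
  set S := (2 * α - 1) / 4 * ‖x‖ with hSdef
  have hS : 0 < S := mul_pos (by linarith) hR
  have hSx : S < ‖x‖ := by rw [hSdef]; nlinarith
  set f := truncatedPower d γ (1 + (2 * α - 1) / 4) with hf
  set μ := powerMeasure d (α * d)
  set I := ∫⁻ y, ENNReal.ofReal (paraboloid x S y) ∂μ with hI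
  have hI' : I = ENNReal.ofReal (∫ y, paraboloid x S y * (‖y‖ ^ 2) ^ (-(α * d) / 2)) := by
    have := lintegral_paraboloid_mul hS.le hSx (α * d) 0
    simpa using this
  have hIpos : I ≠ 0 := by
    rw [hI]
    have hcont : Continuous fun y => ENNReal.ofReal (paraboloid x S y) :=
      ENNReal.continuous_ofReal.comp (continuous_paraboloid x S)
    rw [ne_eq, lintegral_eq_zero_iff hcont.measurable]
    intro h0
    have hball := powerMeasure_closedBall_pos hd (α * d) x (half_pos hS)
    refine hball.ne' (measure_mono_null (fun y hy => ?_) h0)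
    rw [Metric.mem_closedBall, dist_eq_norm] at hy
    simp only [Set.mem_compl_iff, Set.mem_ofPred_eq, Pi.zero_apply, ENNReal.ofReal_eq_zero, not_le]
    refine lt_max_of_lt_left ?_
    nlinarith [norm_nonneg (y - x)]
  have hfy : ∀ y, ENNReal.ofReal (paraboloid x S y) * ENNReal.ofReal (‖y‖ ^ (-γ)) =
      ENNReal.ofReal (paraboloid x S y) * ‖f y‖ₑ := by
    intro y
    by_cases h0 : paraboloid x S y = 0
    · simp [h0]
    have hlt := norm_sub_lt_of_paraboloid_ne_zero hS.le h0
    have hy : y ∈ Metric.closedBall (0 : EuclideanSpace ℝ (Fin d)) (1 + (2 * α - 1) / 4) := by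
      rw [mem_closedBall_zero_iff]
      have := norm_le_norm_add_norm_sub' y x
      have : S ≤ (2 * α - 1) / 4 := by
        rw [hSdef]; exact mul_le_of_le_one_right (by linarith) hx1
      linarith
    rw [hf, truncatedPower, Set.indicator_of_mem hy, Real.enorm_of_nonneg (by positivity)]
  set T := ((1 - concentrationGain α) * ‖x‖ ^ 2) ^ (-(γ / 2)) with hT
  have hT0 : 0 ≤ T := Real.rpow_nonneg (mul_nonneg (by linarith) (by positivity)) _
  have key : ENNReal.ofReal T * I ≤ centeredMaximal μ f x * I :=
    calc ENNReal.ofReal T * I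
        = ENNReal.ofReal (T * ∫ y, paraboloid x S y * (‖y‖ ^ 2) ^ (-(α * d) / 2)) := by
          rw [hI', ENNReal.ofReal_mul hT0]
      _ ≤ ENNReal.ofReal (∫ y, paraboloid x S y *
            ((‖y‖ ^ 2) ^ (-(α * d) / 2) * (‖y‖ ^ 2) ^ (-(γ / 2)))) :=
          ENNReal.ofReal_le_ofReal (integral_paraboloid_rpow_ge hd h1 h2 hx hγ)
      _ = ∫⁻ y, ENNReal.ofReal (paraboloid x S y) * ‖f y‖ₑ ∂μ := by
          rw [← lintegral_paraboloid_mul hS.le hSx]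
          exact lintegral_congr hfy
      _ ≤ _ := lintegral_paraboloid_le_centeredMaximal hd had (measurable_truncatedPower _ _ _)
  have hTle : ENNReal.ofReal T ≤ centeredMaximal μ f x :=
    (ENNReal.mul_le_mul_iff_left hIpos (by rw [hI']; exact ENNReal.ofReal_ne_top)).1 key
  refine le_trans (ENNReal.ofReal_le_ofReal ?_) hTle
  refine Real.rpow_le_rpow_of_nonpos (mul_pos (by linarith) (by positivity)) ?_ (by linarith)
  exact mul_le_of_le_one_right (by linarith) (by nlinarith)

theorem eLpNorm_truncatedPower {d : ℕ} (hd : 1 ≤ d) {a γ : ℝ} {p : ℝ≥0} (hp : 1 ≤ p)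
    (h : a + p * γ < d) {ρ : ℝ} (hρ : 0 ≤ ρ) :
    eLpNorm (truncatedPower d γ ρ) p (powerMeasure d a) =
      (sphereMeasure d Set.univ *
        ENNReal.ofReal (ρ ^ ((d : ℝ) - (a + p * γ)) / (d - (a + p * γ)))) ^ (1 / (p : ℝ)) := by
  have := nontrivial_euclidean hd
  have hp0 : (0 : ℝ) < p := by
    have : (1 : ℝ) ≤ p := by exact_mod_cast hp
    linarith
  have hpe : (p : ℝ≥0∞) ≠ 0 := by exact_mod_cast (zero_lt_one.trans_le hp).ne'
  have hBm : MeasurableSet (Metric.closedBall (0 : EuclideanSpace ℝ (Fin d)) ρ) :=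
    Metric.isClosed_closedBall.measurableSet
  rw [eLpNorm_eq_lintegral_rpow_enorm_toReal hpe ENNReal.coe_ne_top, ENNReal.coe_toReal,
    ← powerMeasure_closedBall_zero hd h hρ]
  congr 1
  rw [← lintegral_indicator_one hBm, lintegral_powerMeasure _ (measurable_one.indicator hBm),
    lintegral_powerMeasure _ ((measurable_truncatedPower d γ ρ).enorm.pow_const _)]
  refine lintegral_congr_ae ?_
  filter_upwards [compl_mem_ae_iff.2 (measure_singleton (0 : EuclideanSpace ℝ (Fin d)))] with y hy
  have hy0 : 0 < ‖y‖ := norm_pos_iff.2 hy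
  by_cases hyB : y ∈ Metric.closedBall (0 : EuclideanSpace ℝ (Fin d)) ρ
  · rw [truncatedPower, Set.indicator_of_mem hyB, Set.indicator_of_mem hyB,
      Real.enorm_of_nonneg (by positivity), ENNReal.ofReal_rpow_of_nonneg (by positivity) hp0.le,
      ← ENNReal.ofReal_mul (by positivity), ← Real.rpow_mul hy0.le, ← Real.rpow_add hy0,
      Pi.one_apply, mul_one]
    congr 2; ring
  · rw [truncatedPower, Set.indicator_of_notMem hyB, Set.indicator_of_notMem hyB]
    simp [hp0]

theorem exponential_le_radialWeakConst {α : ℝ} (h1 : 1 / 2 < α) (h2 : α < 1) {p : ℝ≥0}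
    (hp : 1 ≤ p) :
    ∃ b : ℝ, 1 < b ∧ ∃ c : ℝ, 0 < c ∧ ∀ d : ℕ, 1 ≤ d →
      ENNReal.ofReal (c * b ^ d) ≤ radialWeakConst p (powerMeasure d (α * d)) := by
  have hp1 : (1 : ℝ) ≤ p := by exact_mod_cast hp
  have hp0 : (0 : ℝ) < p := by linarith
  set κ := concentrationGain α with hκdef
  have hκ0 : 0 < κ := concentrationGain_pos h1
  have hκ1 : κ < 1 := concentrationGain_lt_one h1 h2
  set s := (2 * α - 1) / 4 with hs
  have hs0 : 0 < s := by rw [hs]; linarith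
  have hs1 : s ≤ 1 := by rw [hs]; linarith
  have hε : 0 < 1 - α := by linarith
  -- The choice `p γ = (1 - α - η) d` keeps `f` in `L^p`, its norm growing like `(1 + s) ^ (η d /
  -- p)` relative to the unit ball. The gain is `(1 - κ) ^ (-g d / 2)`, and `η / p < g κ / 2` makes
  -- it win, so `b > 1`.
  set η := (1 - α) * κ / 4 with hη
  have hη0 : 0 < η := by positivity
  set g := (1 - α - η) / p with hg
  have hpg : p * g = 1 - α - η := by rw [hg]; field_simp
  have hηlt : η < 1 - α := by rw [hη]; nlinarith
  have hg0 : 0 ≤ g := div_nonneg (by linarith) hp0.le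
  set b := (1 - κ) ^ (-(g / 2)) * (1 + s) ^ (-(η / p)) with hb
  have hκ' : 0 < 1 - κ := by linarith
  have hs' : 0 < 1 + s := by linarith
  refine ⟨b, ?_, (η / (1 - α)) ^ (1 / (p : ℝ)), by positivity, fun d hd => ?_⟩
  · rw [hb, Real.rpow_def_of_pos hκ', Real.rpow_def_of_pos hs', ← Real.exp_add, Real.one_lt_exp_iff]
    have l1 : κ ≤ -Real.log (1 - κ) := by linarith [Real.log_le_sub_one_of_pos hκ']
    have l2 : Real.log (1 + s) ≤ 1 := by linarith [Real.log_le_sub_one_of_pos hs']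
    have l3 : η / p < g / 2 * κ := by
      rw [hg, hη]
      rw [div_lt_iff₀ hp0]
      field_simp
      nlinarith [mul_pos hε hκ0, mul_pos (mul_pos hε hκ0) (sub_pos.2 hκ1)]
    have l4 : g / 2 * κ ≤ g / 2 * -Real.log (1 - κ) := by gcongr
    have l5 : η / p * Real.log (1 + s) ≤ η / p * 1 := by gcongr
    linarith
  have hd0 : (1 : ℝ) ≤ d := by exact_mod_cast hd
  have hdpos : (0 : ℝ) < d := by linarith
  set γ := g * d with hγ
  have hγ0 : 0 ≤ γ := by positivity
  have hexp : (d : ℝ) - (α * d + p * γ) = η * d := by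
    rw [hγ, ← mul_assoc, hpg]; ring
  have hlt : α * d + p * γ < d := by
    have : 0 < η * d := by positivity
    linarith
  have had : α * d < d := by nlinarith
  set σ := sphereMeasure d Set.univ with hσ
  have hσ0 : σ ≠ 0 := sphereMeasure_univ_ne_zero hd
  have hσt : σ ≠ ∞ := measure_ne_top _ _
  have hnorm := eLpNorm_truncatedPower hd hp hlt hs'.le
  rw [hexp] at hnorm
  have hL : MemLp (truncatedPower d γ (1 + s)) p (powerMeasure d (α * d)) := by
    refine ⟨(measurable_truncatedPower _ _ _).aestronglyMeasurable, ?_⟩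
    rw [hnorm]
    exact ENNReal.rpow_lt_top_of_nonneg (by positivity)
      (ENNReal.mul_ne_top hσt ENNReal.ofReal_ne_top)
  have hQ : 0 < (1 + s) ^ (η * d) / (η * d) := by positivity
  set t : ℝ := (1 - κ) ^ (-(γ / 2)) with ht
  have ht0 : 0 < t := Real.rpow_pos_of_pos hκ' _
  refine le_radialWeakConst (t := t.toNNReal) (isRadialFun_indicator_closedBall (1 + s)
    fun r => r ^ (-γ)) hL ?_ (Real.toNNReal_pos.2 ht0) ?_
  · change eLpNorm (truncatedPower d γ (1 + s)) p (powerMeasure d (α * d)) ≠ 0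
    rw [hnorm]
    refine (ENNReal.rpow_pos (pos_iff_ne_zero.2 (mul_ne_zero hσ0 ?_))
      (ENNReal.mul_ne_top hσt ENNReal.ofReal_ne_top)).ne'
    rw [ne_eq, ENNReal.ofReal_eq_zero, not_le]; exact hQ
  change ENNReal.ofReal ((η / (1 - α)) ^ (1 / (p : ℝ)) * b ^ d) *
    eLpNorm (truncatedPower d γ (1 + s)) p (powerMeasure d (α * d)) ≤
      (t.toNNReal : ℝ≥0∞) * powerMeasure d (α * d) {x | (t.toNNReal : ℝ≥0∞) ≤
        centeredMaximal (powerMeasure d (α * d)) (truncatedPower d γ (1 + s)) x} ^ (1 / (p : ℝ))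
  have hlevel : σ * ENNReal.ofReal (1 / ((1 - α) * d)) ≤ powerMeasure d (α * d)
      {x | (t.toNNReal : ℝ≥0∞) ≤ centeredMaximal (powerMeasure d (α * d))
        (truncatedPower d γ (1 + s)) x} := by
    have hb1 := powerMeasure_closedBall_zero hd had zero_le_one
    rw [Real.one_rpow, show (d : ℝ) - α * d = (1 - α) * d by ring] at hb1
    rw [← hb1]
    refine measure_mono_ae ?_
    filter_upwards [ae_ne_zero_powerMeasure hd (α * d)] with x hx hxB
    exact le_centeredMaximal_truncatedPower hd h1 h2 hγ0 hx (mem_closedBall_zero_iff.1 hxB)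
  refine le_trans (le_of_eq ?_) (mul_le_mul_right (ENNReal.rpow_le_rpow hlevel (by positivity)) _)
  rw [hnorm, ENNReal.mul_rpow_of_nonneg _ _ (by positivity),
    ENNReal.mul_rpow_of_nonneg _ _ (by positivity),
    ENNReal.ofReal_rpow_of_nonneg hQ.le (by positivity),
    ENNReal.ofReal_rpow_of_nonneg (by positivity) (by positivity), ← ENNReal.ofReal,
    mul_left_comm, mul_left_comm (ENNReal.ofReal t), ← ENNReal.ofReal_mul (by positivity),
    ← ENNReal.ofReal_mul ht0.le]
  congr 2
  have e1 : b ^ d = t * (((1 + s) ^ (η * d)) ^ (1 / (p : ℝ)))⁻¹ := by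
    rw [hb, mul_pow, ← Real.rpow_natCast, ← Real.rpow_natCast, ← Real.rpow_mul hκ'.le,
      ← Real.rpow_mul hs'.le, ← Real.rpow_mul hs'.le, ← Real.rpow_neg hs'.le, ht, hγ]
    congr 2 <;> ring
  clear_value η
  rw [e1, Real.div_rpow hη0.le hε.le,
    Real.div_rpow (by positivity : 0 ≤ (1 + s) ^ (η * (d : ℝ))) (by positivity : 0 ≤ η * (d : ℝ)),
    Real.div_rpow zero_le_one (by positivity : 0 ≤ (1 - α) * (d : ℝ)),
    Real.mul_rpow hη0.le hdpos.le, Real.mul_rpow hε.le hdpos.le, Real.one_rpow]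
  have n1 := (Real.rpow_pos_of_pos hη0 (1 / (p : ℝ))).ne'
  have n2 := (Real.rpow_pos_of_pos hε (1 / (p : ℝ))).ne'
  have n3 := (Real.rpow_pos_of_pos hdpos (1 / (p : ℝ))).ne'
  have n4 := (Real.rpow_pos_of_pos (Real.rpow_pos_of_pos hs' (η * d)) (1 / (p : ℝ))).ne'
  generalize η ^ (1 / (p : ℝ)) = z₁ at *
  generalize (1 - α) ^ (1 / (p : ℝ)) = z₂ at *
  generalize (d : ℝ) ^ (1 / (p : ℝ)) = z₃ at *
  generalize ((1 + s) ^ (η * (d : ℝ))) ^ (1 / (p : ℝ)) = z₄ at *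
  field_simp

end

theorem theorem3p1 :
    -- exponents `α * d` with `1/2 < α < 1`: exponential growth of the weak type `(p, p)` constants
    (∀ α : ℝ, 1 / 2 < α → α < 1 → ∀ p : ℝ≥0, 1 ≤ p →
      ∃ b : ℝ, 1 < b ∧ ∃ c : ℝ, 0 < c ∧ ∀ d : ℕ, 1 ≤ d →
        ENNReal.ofReal (c * b ^ d) ≤ radialWeakConst p (powerMeasure d (α * d))) ∧
    -- exponents at most `d / 2`
    (∃ c : ℝ, 0 < c ∧ ∀ α : ℕ → ℝ, (∀ d : ℕ, 1 ≤ d → α d ≤ (d : ℝ) / 2) →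
      (∀ d : ℕ, 1 ≤ d →
        ENNReal.ofReal (c * (Real.sqrt 5 / 2) ^ (α d))
          ≤ radialWeakConst 1 (powerMeasure d (α d))) ∧
      (limsup (fun d : ℕ => (α d : EReal)) atTop = ⊤ →
        limsup (fun d : ℕ => radialWeakConst 1 (powerMeasure d (α d))) atTop = ⊤)) ∧
    -- bounded exponents: uniform weak type `(1, 1)` and strong type `(p, p)` bounds
    (∀ A : ℝ,
      (∃ C : ℝ≥0, ∀ α : ℕ → ℝ, (∀ d : ℕ, 1 ≤ d → α d ≤ A) →
        ∀ d : ℕ, 1 ≤ d → radialWeakConst 1 (powerMeasure d (α d)) ≤ C) ∧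
      (∀ p : ℝ≥0, 1 < p → ∃ C : ℝ≥0, ∀ α : ℕ → ℝ, (∀ d : ℕ, 1 ≤ d → α d ≤ A) →
        ∀ d : ℕ, 1 ≤ d → radialStrongConst p (powerMeasure d (α d)) ≤ C)) := by
  refine ⟨fun α h1 h2 p hp => exponential_le_radialWeakConst h1 h2 hp,
    ⟨1 / 4, by norm_num, fun α hα => ?_⟩, fun A => ⟨⟨_, fun α hα d hd =>
      radialWeakConst_one_le hd (le_max_right A 0) ((hα d hd).trans (le_max_left A 0))⟩,
      fun p hp => ⟨_, fun α hα d hd =>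
      radialStrongConst_le hd (le_max_right A 0) ((hα d hd).trans (le_max_left A 0)) hp⟩⟩⟩
  have key : ∀ d : ℕ, 1 ≤ d → ENNReal.ofReal (1 / 4 * (Real.sqrt 5 / 2) ^ (α d)) ≤
      radialWeakConst 1 (powerMeasure d (α d)) := by
    intro d hd
    rcases le_total 0 (α d) with h0 | h0
    · exact rpow_le_radialWeakConst hd h0 (hα d hd)
    -- For `α d ≤ 0` the claimed bound is at most `1`.
    · have hd0 : (1 : ℝ) ≤ d := by exact_mod_cast hd
      refine le_trans ?_ (one_le_radialWeakConst hd (by linarith))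
      rw [← ENNReal.ofReal_one]
      refine ENNReal.ofReal_le_ofReal ?_
      have h5 : (1 : ℝ) ≤ Real.sqrt 5 / 2 := by
        have : (2 : ℝ) ≤ Real.sqrt 5 := Real.le_sqrt_of_sq_le (by norm_num)
        linarith
      linarith [Real.rpow_le_one_of_one_le_of_nonpos h5 h0]
  exact ⟨key, limsup_eq_top_of_rpow_le (by norm_num) key⟩
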